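/- **Conventions.** Let $\Delta=\{(\beta,\alpha)\in\mathbb R^2:\ 1<\beta<2,\ 0\le\alpha\le 2-\beta\}$ and $T_{\beta,\alpha}(x)=\beta x+\alpha \bmod 1$ (with values in $[0,1)$) on $[0,1]$. For $\beta'\in(1,2)$ and $t\in[0,1]$ put $$K^+_{\beta',0}(t)=\{x\in[0,1): T^n_{\beta',0}(x)\notin[0,t)\ \forall n\ge 0\},\qquad E^+_{\beta',0}=\{t\in[0,1): T^n_{\beta',0}(t)\notin[0,t)\ \forall n\ge 0\}.$$ Systems $(T,X)$ and $(S,Y)$, $X,Y\subseteq\mathbb R$, are *topologically conjugate* if there are a countable set $C$ and a surjection $\varphi:X\to Y$, finite-to-one everywhere, such that each point of $X\setminus C$ is alone in its fibre, $\varphi\circ T=S\circ\varphi$ on $X\setminus C$, and $\varphi|_{X\setminus C}$ is a homeomorphism onto its image. The conjugacy is *orientation-preserving* if $C$ can be chosen so that moreover $\varphi$ is strictly increasing on $X\setminus C$, and *exact* if $\varphi\circ T=S\circ\varphi$ on all of $X$. **Theorem.** 1. For every $(\beta,\alpha)\in\Delta$ there are $\beta'\in(1,2)$ and $t\in[0,1]$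 such that $(T_{\beta,\alpha},[0,1])$ is topologically conjugate to the open system $(T_{\beta',0}|_{K^+_{\beta',0}(t)},K^+_{\beta',0}(t))$. If $\alpha<2-\beta$, then for this $(\beta',t)$ the conjugacy can be taken exact and orientation-preserving. 2. The converse fails: there are $\beta'\in(1,2)$ and $t\in E^+_{\beta',0}$ with $\dim_H K^+_{\beta',0}(t)>0$ such that, for no $(\beta,\alpha)\in\Delta$, is there a topological conjugacy, in either direction, between $(T_{\beta',0}|_{K^+_{\beta',0}(t)},K^+_{\beta',0}(t))$ and $(T_{\beta,\alpha},[0,1])$. 3. Let $\beta'\in(1,2)$ with $T^n_{\beta',0}(1)=0$ for some $n\in\mathbb N$. Then there is $\delta\in(0,1/\beta')$ such that for every $t\in E^+_{\beta',0}$ with $t<\delta$ there is exactly one $(\beta,\alpha)\in\Delta$ for which $(T_{\beta,\alpha},[0,1])$ is topologically conjugate to $(T_{\beta',0}|_{K^+_{\beta',0}(t)},K^+_{\beta',0}(t))$ by an orientation-preserving conjugacy; for this $(\beta,\alpha)$ the conjugacy can also be taken exact. -/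

import Mathlib

open Set

/-- The parameter set `Δ` of pairs `(β, α)` with `1 < β < 2` and `0 ≤ α ≤ 2 - β`. -/
def paramSet : Set (ℝ × ℝ) :=
  {q | q.1 ∈ Ioo (1 : ℝ) 2 ∧ q.2 ∈ Icc (0 : ℝ) (2 - q.1)}

/-- The intermediate `β`-transformation `T_{β,α} : x ↦ β x + α mod 1`.
The greedy `β`-transformation is `betaMap β 0`. -/
noncomputable def betaMap (β α : ℝ) (x : ℝ) : ℝ := Int.fract (β * x + α)

/-- The survivor set `K⁺_{β,0}(t)` of the greedy map with hole `[0, t)`. -/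
def survivorSet (β t : ℝ) : Set ℝ :=
  {x | x ∈ Ico (0 : ℝ) 1 ∧ ∀ n : ℕ, (betaMap β 0)^[n] x ∉ Ico (0 : ℝ) t}

/-- The bifurcation set `E⁺_{β,0}` of the greedy map. -/
def bifurcationSet (β : ℝ) : Set ℝ :=
  {t | t ∈ Ico (0 : ℝ) 1 ∧ ∀ n : ℕ, (betaMap β 0)^[n] t ∉ Ico (0 : ℝ) t}

/-- `φ` is a topological conjugacy from the system `(T, X)` to the system `(S, Y)` with countable
exceptional set `C`: it maps `X` onto `Y`, it is finite-to-one everywhere, and away from `C` it is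
one-to-one, intertwines the two maps and is a homeomorphism onto its image. -/
structure IsConjugacyOff (T : ℝ → ℝ) (X : Set ℝ) (S : ℝ → ℝ) (Y : Set ℝ)
    (φ : ℝ → ℝ) (C : Set ℝ) : Prop where
  countable : C.Countable
  image_eq : φ '' X = Y
  finite_fiber : ∀ y ∈ Y, {x | x ∈ X ∧ φ x = y}.Finite
  injective_off : ∀ x ∈ X \ C, ∀ x' ∈ X, φ x' = φ x → x' = x
  semiconj_off : ∀ x ∈ X \ C, φ (T x) = S (φ x)
  isEmbedding_off : Topology.IsEmbedding ((X \ C).domRestrict φ)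

/-- `(T, X)` and `(S, Y)` are topologically conjugate, up to countable exceptional sets. -/
def TopConj (T : ℝ → ℝ) (X : Set ℝ) (S : ℝ → ℝ) (Y : Set ℝ) : Prop :=
  ∃ (φ : ℝ → ℝ) (C : Set ℝ), IsConjugacyOff T X S Y φ C

/-- `(T, X)` and `(S, Y)` are topologically conjugate by an orientation-preserving conjugacy, that
is, one that is strictly increasing away from its countable exceptional set. -/
def IncTopConj (T : ℝ → ℝ) (X : Set ℝ) (S : ℝ → ℝ) (Y : Set ℝ) : Prop :=
  ∃ (φ : ℝ → ℝ) (C : Set ℝ), IsConjugacyOff T X S Y φ C ∧ StrictMonoOn φ (X \ C)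

/-- As `IncTopConj`, with a conjugacy that intertwines the two maps at every point of `X`. -/
def ExactIncTopConj (T : ℝ → ℝ) (X : Set ℝ) (S : ℝ → ℝ) (Y : Set ℝ) : Prop :=
  ∃ (φ : ℝ → ℝ) (C : Set ℝ), IsConjugacyOff T X S Y φ C ∧ StrictMonoOn φ (X \ C) ∧
    ∀ x ∈ X, φ (T x) = S (φ x)

/-!
The itineraries of `T_{β,α}` form a family of binary sequences that lie lexicographically between
the itinerary `μ` of `0` and the left itinerary `ν` of `1`, and `x` is recovered from its
itinerary `ω` as `seqVal β α ω = ∑ (ωₙ - α) / β ^ (n + 1)`. The survivor set of the greedy map in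
base `b` with hole `[0, t)` is coded in the same way, between the expansion of `t` and the
quasi-greedy expansion of `1`. If these two pairs of kneading sequences agree (`Matched`), then
rewriting an itinerary as a greedy expansion is an exact increasing conjugacy
(`Matched.exactIncTopConj`). Everything rests on a contraction argument: lexicographic bounds on a
shift-invariant family of sequences are bounds on their values (`seqVal_le_one`,
`seqVal_nonneg`).

* Given `(β, α)` with `α < 2 - β`, a base `b` with `seqVal b 0 ν = 1` exists by the intermediate
  value theorem, and `t` is the value of `μ` (`exists_matched`). On the line `α = 2 - β` the flip
  `x ↦ 1 - x` is used.

* Given `b` and a small `t`, the parameter `β` solves `∑ (νₙ - μₙ) / β ^ (n + 1) = 1` near `b`. As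
  the orbit of `1` hits `0`, its left orbit is periodic and bounded away from `0`, and this
  survives the perturbation from `b` to `β` (`exists_hole_bound`). For uniqueness, an
  increasing conjugacy preserves kneading sequences (`Matched.kneading_eq`), and these determine
  `(β, α)` (`eq_of_kneading_eq`): a second solution `c > β` of the equation would make Parry's
  density formula an eigenfunction with eigenvalue `c` of the transfer operator, whose norm on
  `L¹` is at most `β` (`kneading_ne_one`).

* For the failure of the converse, `b` and `t` are chosen so that the kneading sequences are
  concatenations of the words `011` and `100` along the orbit of an irrational rotation. Then the
  survivor set has an uncountable relatively open piece on which the third iterate is injective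
  and which it maps into itself (`IsRotationBase.renormalization`). An intermediate map has no
  such piece, since its iterates expand Lebesgue measure (`PartialConj.false_of_injOn`). The
  survivor set has positive dimension as it contains all concatenations of `01` and `10`.
-/

open Filter Topology

namespace IntermediateBeta

/-! ### Binary sequences and their values -/

/-- A sequence of real digits, each `0` or `1`. -/
def IsBinary (ω : ℕ → ℝ) : Prop := ∀ n, ω n = 0 ∨ ω n = 1

/-- The sequence with its first `k` terms removed. -/
def seqShift (k : ℕ) (ω : ℕ → ℝ) : ℕ → ℝ := fun n => ω (n + k)

/-- The strict lexicographic order on binary sequences: at the first difference, `ω` has the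
digit `0` and `ω'` the digit `1`. -/
def LexLT (ω ω' : ℕ → ℝ) : Prop := ∃ n, (∀ k < n, ω k = ω' k) ∧ ω n = 0 ∧ ω' n = 1

/-- The point `∑ (ωₙ - α) / β ^ (n + 1)` whose orbit under the expanding branches
`x ↦ β x + α - ωₙ` stays bounded. For `α = 0` it is the value of the expansion `ω` in base `β`. -/
noncomputable def seqVal (β α : ℝ) (ω : ℕ → ℝ) : ℝ := ∑' n, (ω n - α) / β ^ (n + 1)

lemma IsBinary.shift {ω : ℕ → ℝ} (h : IsBinary ω) (k : ℕ) : IsBinary (seqShift k ω) :=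
  fun n => h (n + k)

lemma IsBinary.nonneg {ω : ℕ → ℝ} (h : IsBinary ω) (n : ℕ) : 0 ≤ ω n := by
  rcases h n with h | h <;> rw [h]; norm_num

lemma IsBinary.le_one {ω : ℕ → ℝ} (h : IsBinary ω) (n : ℕ) : ω n ≤ 1 := by
  rcases h n with h | h <;> rw [h]; norm_num

@[simp] lemma seqShift_zero (ω : ℕ → ℝ) : seqShift 0 ω = ω := rfl

lemma seqShift_seqShift (j k : ℕ) (ω : ℕ → ℝ) :
    seqShift j (seqShift k ω) = seqShift (j + k) ω := by
  funext n; simp [seqShift, add_assoc]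

lemma lex_trichotomy {ω ω' : ℕ → ℝ} (h : IsBinary ω) (h' : IsBinary ω') :
    ω = ω' ∨ LexLT ω ω' ∨ LexLT ω' ω := by
  classical
  by_cases he : ω = ω'
  · exact Or.inl he
  · right
    have hex : ∃ n, ω n ≠ ω' n := Function.ne_iff.mp he
    have hn := Nat.find_spec hex
    have hlt : ∀ k < Nat.find hex, ω k = ω' k := fun k hk => by
      simpa using Nat.find_min hex hk
    rcases h (Nat.find hex) with h0 | h0 <;> rcases h' (Nat.find hex) with h1 | h1
    · exact absurd (h0.trans h1.symm) hn
    · exact Or.inl ⟨_, hlt, h0, h1⟩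
    · exact Or.inr ⟨_, fun k hk => (hlt k hk).symm, h1, h0⟩
    · exact absurd (h0.trans h1.symm) hn

lemma geom_hasSum {β : ℝ} (hβ : 1 < β) : HasSum (fun n : ℕ => 1 / β ^ (n + 1)) (1 / (β - 1)) := by
  have h0 : (0 : ℝ) < β := by linarith
  have h := (hasSum_geometric_of_lt_one (r := β⁻¹) (by positivity)
    (inv_lt_one_of_one_lt₀ hβ)).mul_left β⁻¹
  have e1 : (fun n : ℕ => 1 / β ^ (n + 1)) = fun n => β⁻¹ * β⁻¹ ^ n := by
    funext n; rw [one_div, ← inv_pow]; ring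
  have e2 : 1 / (β - 1) = β⁻¹ * (1 - β⁻¹)⁻¹ := by
    rw [← mul_inv, mul_sub, mul_inv_cancel₀ h0.ne', mul_one, one_div]
  rw [e1, e2]
  exact h

lemma summable_seqVal {β : ℝ} (hβ : 1 < β) (α : ℝ) {ω : ℕ → ℝ} (h : IsBinary ω) :
    Summable fun n => (ω n - α) / β ^ (n + 1) := by
  have h0 : (0 : ℝ) < β := by linarith
  refine Summable.of_norm_bounded (g := fun n => (1 + |α|) * (1 / β ^ (n + 1)))
    ((geom_hasSum hβ).summable.mul_left _) fun n => ?_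
  rw [norm_div, Real.norm_eq_abs, Real.norm_eq_abs, abs_of_pos (pow_pos h0 _), mul_one_div]
  gcongr
  refine (abs_sub _ _).trans ?_
  rw [abs_of_nonneg (h.nonneg n)]
  linarith [h.le_one n]

lemma abs_seqVal_le {β : ℝ} (hβ : 1 < β) (α : ℝ) {ω : ℕ → ℝ} (h : IsBinary ω) :
    |seqVal β α ω| ≤ (1 + |α|) / (β - 1) := by
  have h0 : (0 : ℝ) < β := by linarith
  have := tsum_of_norm_bounded (f := fun n => (ω n - α) / β ^ (n + 1))
    ((geom_hasSum hβ).mul_left (1 + |α|)) fun n => ?_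
  · rw [mul_one_div] at this; exact this
  · rw [norm_div, Real.norm_eq_abs, Real.norm_eq_abs, abs_of_pos (pow_pos h0 _), mul_one_div]
    gcongr
    refine (abs_sub _ _).trans ?_
    rw [abs_of_nonneg (h.nonneg n)]
    linarith [h.le_one n]

lemma seqVal_succ {β : ℝ} (hβ : 1 < β) (α : ℝ) {ω : ℕ → ℝ} (h : IsBinary ω) :
    seqVal β α ω = (ω 0 - α + seqVal β α (seqShift 1 ω)) / β := by
  have h0 : (0 : ℝ) < β := by linarith
  rw [seqVal, (summable_seqVal hβ α h).tsum_eq_zero_add, seqVal, add_div, ← tsum_div_const]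
  congr 1
  · simp
  · refine tsum_congr fun n => ?_
    simp only [seqShift, pow_succ]
    field_simp

lemma seqVal_shift_succ {β : ℝ} (hβ : 1 < β) (α : ℝ) {ω : ℕ → ℝ} (h : IsBinary ω) (k : ℕ) :
    seqVal β α (seqShift (k + 1) ω) = β * seqVal β α (seqShift k ω) + α - ω k := by
  have h0 : (0 : ℝ) < β := by linarith
  have := seqVal_succ hβ α (h.shift k)
  rw [seqShift_seqShift, add_comm 1 k] at this
  rw [this]
  simp only [seqShift, zero_add]
  field_simp
  ring

lemma seqVal_sub_of_agree {β : ℝ} (hβ : 1 < β) (α : ℝ) {ω ω' : ℕ → ℝ} (h : IsBinary ω)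
    (h' : IsBinary ω') (n : ℕ) (hag : ∀ k < n, ω k = ω' k) :
    seqVal β α ω' - seqVal β α ω =
      (seqVal β α (seqShift n ω') - seqVal β α (seqShift n ω)) / β ^ n := by
  have h0 : (0 : ℝ) < β := by linarith
  induction n with
  | zero => simp
  | succ n ih =>
    rw [ih fun k hk => hag k (by omega), seqVal_shift_succ hβ α h, seqVal_shift_succ hβ α h',
      hag n (by omega), pow_succ]
    field_simp
    ring

lemma seqVal_sub_of_lex {β : ℝ} (hβ : 1 < β) (α : ℝ) {ω ω' : ℕ → ℝ} (h : IsBinary ω)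
    (h' : IsBinary ω') (n : ℕ) (hag : ∀ k < n, ω k = ω' k) (hn : ω n = 0) (hn' : ω' n = 1) :
    seqVal β α ω' - seqVal β α ω =
      (1 + seqVal β α (seqShift (n + 1) ω') - seqVal β α (seqShift (n + 1) ω)) / β ^ (n + 1) := by
  have h0 : (0 : ℝ) < β := by linarith
  rw [seqVal_sub_of_agree hβ α h h' n hag, seqVal_shift_succ hβ α h, seqVal_shift_succ hβ α h',
    hn, hn', pow_succ]
  field_simp
  ring

lemma lex_of_seqVal_lt {β : ℝ} (hβ : 1 < β) (α : ℝ) {ω ω' : ℕ → ℝ} (h : IsBinary ω)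
    (h' : IsBinary ω') (hI : ∀ n, seqVal β α (seqShift n ω) ∈ Icc (0 : ℝ) 1)
    (hI' : ∀ n, seqVal β α (seqShift n ω') ∈ Icc (0 : ℝ) 1)
    (hlt : seqVal β α ω < seqVal β α ω') : LexLT ω ω' := by
  rcases lex_trichotomy h h' with he | hl | ⟨n, hag, hn, hn'⟩
  · exact absurd hlt (by rw [he]; exact lt_irrefl _)
  · exact hl
  · have := seqVal_sub_of_lex hβ α h' h n hag hn hn'
    have h2 : 0 ≤ (1 + seqVal β α (seqShift (n + 1) ω) - seqVal β α (seqShift (n + 1) ω')) /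
        β ^ (n + 1) := by
      have := (hI (n + 1)).1
      have := (hI' (n + 1)).2
      have : (0 : ℝ) < β := by linarith
      apply div_nonneg _ (by positivity)
      linarith
    linarith

lemma seqVal_lt_of_lex {β : ℝ} (hβ : 1 < β) (α : ℝ) {ω ω' : ℕ → ℝ} (h : IsBinary ω)
    (h' : IsBinary ω') (hI : ∀ n, seqVal β α (seqShift n ω) < 1)
    (hI' : ∀ n, 0 ≤ seqVal β α (seqShift n ω'))
    (hlt : LexLT ω ω') : seqVal β α ω < seqVal β α ω' := by
  obtain ⟨n, hag, hn, hn'⟩ := hlt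
  have := seqVal_sub_of_lex hβ α h h' n hag hn hn'
  have h2 : 0 < (1 + seqVal β α (seqShift (n + 1) ω') - seqVal β α (seqShift (n + 1) ω)) /
        β ^ (n + 1) := by
    have := hI (n + 1)
    have := hI' (n + 1)
    have : (0 : ℝ) < β := by linarith
    apply div_pos _ (by positivity)
    linarith
  linarith

/-- If `f ≤ B`, and every value of `f` is at most `1 / β` times a later bound, then `f ≤ 0`. -/
lemma nonpos_of_contraction {ι : Type*} {β : ℝ} (hβ : 1 < β) (S : Set ι) (f : ι → ℝ) (B : ℝ)
    (hB : ∀ i ∈ S, f i ≤ B)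
    (hstep : ∀ E, 0 ≤ E → (∀ i ∈ S, f i ≤ E) → ∀ i ∈ S, f i ≤ E / β) : ∀ i ∈ S, f i ≤ 0 := by
  have h0 : (0 : ℝ) < β := by linarith
  have key : ∀ m : ℕ, ∀ i ∈ S, f i ≤ max B 0 / β ^ m := by
    intro m
    induction m with
    | zero => intro i hi; simpa using Or.inl (hB i hi)
    | succ m ih =>
      intro i hi
      have := hstep _ (by positivity) ih i hi
      rwa [div_div, ← pow_succ] at this
  intro i hi
  have hl : Tendsto (fun m : ℕ => max B 0 / β ^ m) atTop (𝓝 0) := by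
    have := (tendsto_pow_atTop_nhds_zero_of_lt_one (r := β⁻¹) (by positivity)
      (inv_lt_one_of_one_lt₀ hβ)).const_mul (max B 0)
    simpa [div_eq_mul_inv] using this
  exact ge_of_tendsto' hl fun m => key m i hi

/-- A lexicographic upper bound `ν` of a shift-invariant family is an upper bound for the values
as well, if `ν` has value `1` and its shifts have values `≥ 0`: at the first difference with `ν`
the excess over `1` is at most `1 / β` times an excess of another member of the family. -/
lemma seqVal_le_one {β : ℝ} (hβ : 1 < β) (α : ℝ) {S : Set (ℕ → ℝ)} {ν : ℕ → ℝ}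
    (hS : ∀ ω ∈ S, IsBinary ω) (hsh : ∀ ω ∈ S, ∀ k, seqShift k ω ∈ S) (hν : IsBinary ν)
    (hup : ∀ ω ∈ S, ω = ν ∨ LexLT ω ν) (h1 : seqVal β α ν = 1)
    (hpos : ∀ k, 0 ≤ seqVal β α (seqShift k ν)) : ∀ ω ∈ S, seqVal β α ω ≤ 1 := by
  have h0 : (0 : ℝ) < β := by linarith
  have := nonpos_of_contraction hβ S (fun ω => seqVal β α ω - 1) ((1 + |α|) / (β - 1) - 1)
    (fun ω hω => by linarith [(le_abs_self _).trans (abs_seqVal_le hβ α (hS ω hω))]) ?_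
  · exact fun ω hω => by linarith [this ω hω]
  · intro E hE hall ω hω
    rcases hup ω hω with he | ⟨n, hag, hn, hn'⟩
    · simp only [he, h1, sub_self]; positivity
    · have e := seqVal_sub_of_lex hβ α (hS ω hω) hν n hag hn hn'
      have h2 := hall _ (hsh ω hω (n + 1))
      have h3 := hpos (n + 1)
      have h4 : -E / β ≤ (1 + seqVal β α (seqShift (n + 1) ν) -
          seqVal β α (seqShift (n + 1) ω)) / β ^ (n + 1) := by
        calc -E / β = -(E / β) := by ring
          _ ≤ -(E / β ^ (n + 1)) := by
            apply neg_le_neg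
            apply div_le_div_of_nonneg_left hE h0
            exact le_self_pow₀ hβ.le (by omega)
          _ = -E / β ^ (n + 1) := by ring
          _ ≤ _ := by
            gcongr
            linarith
      rw [h1] at e
      have : -E / β = -(E / β) := by ring
      linarith

/-- The counterpart of `seqVal_le_one` for lexicographic lower bounds. -/
lemma seqVal_nonneg {β : ℝ} (hβ : 1 < β) (α : ℝ) {S : Set (ℕ → ℝ)} {μ : ℕ → ℝ}
    (hS : ∀ ω ∈ S, IsBinary ω) (hsh : ∀ ω ∈ S, ∀ k, seqShift k ω ∈ S) (hμ : IsBinary μ)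
    (hlo : ∀ ω ∈ S, ω = μ ∨ LexLT μ ω) (h1 : seqVal β α μ = 0)
    (hle : ∀ k, seqVal β α (seqShift k μ) ≤ 1) : ∀ ω ∈ S, 0 ≤ seqVal β α ω := by
  have h0 : (0 : ℝ) < β := by linarith
  have := nonpos_of_contraction hβ S (fun ω => -seqVal β α ω) ((1 + |α|) / (β - 1))
    (fun ω hω => (neg_le_abs _).trans (abs_seqVal_le hβ α (hS ω hω))) ?_
  · exact fun ω hω => by linarith [this ω hω]
  · intro E hE hall ω hω
    rcases hlo ω hω with he | ⟨n, hag, hn, hn'⟩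
    · simp only [he, h1, neg_zero]; positivity
    · have e := seqVal_sub_of_lex hβ α hμ (hS ω hω) n hag hn hn'
      have h2 := hall _ (hsh ω hω (n + 1))
      have h3 := hle (n + 1)
      have h4 : -E / β ≤ (1 + seqVal β α (seqShift (n + 1) ω) -
          seqVal β α (seqShift (n + 1) μ)) / β ^ (n + 1) := by
        calc -E / β = -(E / β) := by ring
          _ ≤ -(E / β ^ (n + 1)) := by
            apply neg_le_neg
            apply div_le_div_of_nonneg_left hE h0
            exact le_self_pow₀ hβ.le (by omega)
          _ = -E / β ^ (n + 1) := by ring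
          _ ≤ _ := by
            gcongr
            linarith
      rw [h1] at e
      have : -E / β = -(E / β) := by ring
      linarith

lemma seqVal_lt_one_of_lex {β : ℝ} (hβ : 1 < β) (α : ℝ) {ω ν : ℕ → ℝ} (hω : IsBinary ω)
    (hν : IsBinary ν) (hlt : LexLT ω ν) (h1 : seqVal β α ν = 1)
    (hpos : ∀ k, 0 < seqVal β α (seqShift k ν)) (hle : ∀ k, seqVal β α (seqShift k ω) ≤ 1) :
    seqVal β α ω < 1 := by
  have h0 : (0 : ℝ) < β := by linarith
  obtain ⟨n, hag, hn, hn'⟩ := hlt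
  have e := seqVal_sub_of_lex hβ α hω hν n hag hn hn'
  have : 0 < (1 + seqVal β α (seqShift (n + 1) ν) -
          seqVal β α (seqShift (n + 1) ω)) / β ^ (n + 1) := by
    apply div_pos _ (by positivity)
    linarith [hpos (n + 1), hle (n + 1)]
  linarith

lemma seqVal_eq_sub {β : ℝ} (hβ : 1 < β) (α : ℝ) {ω : ℕ → ℝ} (h : IsBinary ω) :
    seqVal β α ω = seqVal β 0 ω - α / (β - 1) := by
  have hs := summable_seqVal hβ 0 h
  have h2 := ((geom_hasSum hβ).mul_left α)
  rw [mul_one_div] at h2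
  rw [seqVal, seqVal, ← h2.tsum_eq, ← hs.tsum_sub h2.summable]
  refine tsum_congr fun n => ?_
  ring

lemma seqVal_zero_nonneg {β : ℝ} (hβ : 1 < β) {ω : ℕ → ℝ} (h : IsBinary ω) :
    0 ≤ seqVal β 0 ω := by
  have h0 : (0 : ℝ) < β := by linarith
  exact tsum_nonneg fun n => div_nonneg (by linarith [h.nonneg n]) (by positivity)

lemma seqVal_zero_lt {β : ℝ} (hβ : 1 < β) {ω : ℕ → ℝ} (h : IsBinary ω) (n : ℕ) (hn : ω n = 0) :
    seqVal β 0 ω < 1 / (β - 1) := by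
  have h0 : (0 : ℝ) < β := by linarith
  rw [← (geom_hasSum hβ).tsum_eq]
  refine Summable.tsum_lt_tsum (i := n) (fun k => ?_) ?_ (summable_seqVal hβ 0 h)
    (geom_hasSum hβ).summable
  · have := h.le_one k
    gcongr
    linarith
  · rw [hn]
    simpa using pow_pos h0 (n + 1)

/-- Raising the base lowers the value of a sequence, by at most as much as for the constant
sequence `1`. -/
lemma seqVal_zero_mono {b β : ℝ} (hb : 1 < b) (hβ : b ≤ β) {ω : ℕ → ℝ} (h : IsBinary ω) :
    seqVal β 0 ω ≤ seqVal b 0 ω ∧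
      seqVal b 0 ω - seqVal β 0 ω ≤ 1 / (b - 1) - 1 / (β - 1) := by
  have hβ' : 1 < β := by linarith
  have h0 : (0 : ℝ) < b := by linarith
  have key : ∀ n : ℕ, 1 / β ^ (n + 1) ≤ 1 / b ^ (n + 1) := fun n => by gcongr
  constructor
  · refine (summable_seqVal hβ' 0 h).tsum_le_tsum (fun n => ?_) (summable_seqVal hb 0 h)
    have := h.nonneg n
    rw [sub_zero]
    gcongr
  · have hs := (geom_hasSum hb).sub (geom_hasSum hβ')
    rw [← hs.tsum_eq, seqVal, seqVal,
      ← (summable_seqVal hb 0 h).tsum_sub (summable_seqVal hβ' 0 h)]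
    refine ((summable_seqVal hb 0 h).sub (summable_seqVal hβ' 0 h)).tsum_le_tsum (fun n => ?_)
      hs.summable
    rcases h n with h1 | h1 <;> rw [h1]
    · simpa using key n
    · simp

lemma seqVal_strictAnti {b β : ℝ} (hb : 1 < b) (hβ : b < β) {ω : ℕ → ℝ} (h : IsBinary ω) (n : ℕ)
    (hn : ω n = 1) : seqVal β 0 ω < seqVal b 0 ω := by
  have hβ' : 1 < β := by linarith
  have h0 : (0 : ℝ) < b := by linarith
  refine (summable_seqVal hβ' 0 h).tsum_lt_tsum (i := n) (fun n => ?_) ?_ (summable_seqVal hb 0 h)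
  · have := h.nonneg n
    rw [sub_zero]
    gcongr
  · rw [hn, sub_zero]
    gcongr

lemma continuousOn_seqVal {b : ℝ} (hb : 1 < b) {ω : ℕ → ℝ} (h : IsBinary ω) :
    ContinuousOn (fun β => seqVal β 0 ω) (Ici b) := by
  have h0 : (0 : ℝ) < b := by linarith
  refine continuousOn_tsum (u := fun n => 1 / b ^ (n + 1)) (fun n => ?_)
    (geom_hasSum hb).summable fun n β hβ => ?_
  · refine ContinuousOn.div continuousOn_const (by fun_prop) fun β hβ => ?_
    have : 0 < β := lt_of_lt_of_le h0 hβ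
    positivity
  · have hb' : b ≤ β := hβ
    have : 0 < β := lt_of_lt_of_le h0 hβ
    rw [Real.norm_eq_abs, abs_of_nonneg (div_nonneg (by linarith [h.nonneg n]) (by positivity)),
      sub_zero]
    have := h.le_one n
    gcongr

/-! ### Right and left itineraries -/

/-- The itinerary of `x` under `T_{β,α}`: the digits `⌊β Tⁿx + α⌋`. For `α = 0` this is the greedy
expansion of `x` in base `β`. -/
noncomputable def rcode (β α x : ℝ) : ℕ → ℝ := fun n => (⌊β * (betaMap β α)^[n] x + α⌋ : ℝ)

/-- The left-continuous version of `T_{β,α}`, with values in `(0, 1]`. -/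
noncomputable def lmap (β α x : ℝ) : ℝ := β * x + α - (⌈β * x + α⌉ - 1)

/-- The itinerary of `x` under the left-continuous map. For `α = 0` and `x = 1` this is the
quasi-greedy expansion of `1` in base `β`. -/
noncomputable def lcode (β α x : ℝ) : ℕ → ℝ := fun n => (⌈β * (lmap β α)^[n] x + α⌉ : ℝ) - 1

lemma betaMap_eq (β α x : ℝ) : betaMap β α x = β * x + α - ⌊β * x + α⌋ := rfl

lemma betaMap_mem (β α x : ℝ) : betaMap β α x ∈ Ico (0 : ℝ) 1 :=
  ⟨Int.fract_nonneg _, Int.fract_lt_one _⟩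

lemma lmap_mem (β α x : ℝ) : lmap β α x ∈ Ioc (0 : ℝ) 1 := by
  constructor
  · have := Int.ceil_lt_add_one (β * x + α); unfold lmap; linarith
  · have := Int.le_ceil (β * x + α); unfold lmap; linarith

lemma iterate_betaMap_mem {β α x : ℝ} (hx : x ∈ Ico (0 : ℝ) 1) (n : ℕ) :
    (betaMap β α)^[n] x ∈ Ico (0 : ℝ) 1 := by
  cases n with
  | zero => exact hx
  | succ n => rw [Function.iterate_succ_apply']; exact betaMap_mem _ _ _

lemma iterate_lmap_mem {β α x : ℝ} (hx : x ∈ Ioc (0 : ℝ) 1) (n : ℕ) :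
    (lmap β α)^[n] x ∈ Ioc (0 : ℝ) 1 := by
  cases n with
  | zero => exact hx
  | succ n => rw [Function.iterate_succ_apply']; exact lmap_mem _ _ _

/-- A digit computed from its defining inequalities. -/
lemma betaMap_of_mem {β α x : ℝ} (k : ℤ) (h : β * x + α - k ∈ Ico (0 : ℝ) 1) :
    ⌊β * x + α⌋ = k ∧ betaMap β α x = β * x + α - k := by
  have : ⌊β * x + α⌋ = k := by
    rw [Int.floor_eq_iff]; constructor <;> linarith [h.1, h.2]
  exact ⟨this, by rw [betaMap_eq, this]⟩

lemma lmap_of_mem {β α x : ℝ} (k : ℤ) (h : β * x + α - k ∈ Ioc (0 : ℝ) 1) :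
    ⌈β * x + α⌉ = k + 1 ∧ lmap β α x = β * x + α - k := by
  have : ⌈β * x + α⌉ = k + 1 := by
    rw [Int.ceil_eq_iff]; push_cast; constructor <;> linarith [h.1, h.2]
  exact ⟨this, by rw [lmap, this]; push_cast; ring⟩

lemma floor_digit {β α x : ℝ} (hβ : 0 < β) (hα : 0 ≤ α) (hs : β + α ≤ 2)
    (hx : x ∈ Ico (0 : ℝ) 1) : ⌊β * x + α⌋ = 0 ∨ ⌊β * x + α⌋ = 1 := by
  have h1 : 0 ≤ β * x := mul_nonneg hβ.le hx.1
  have h2 : β * x < β := by nlinarith [hx.2]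
  have h3 : 0 ≤ ⌊β * x + α⌋ := Int.floor_nonneg.mpr (by linarith)
  have h4 : ⌊β * x + α⌋ < 2 := Int.floor_lt.mpr (by push_cast; linarith)
  omega

lemma ceil_digit {β α x : ℝ} (hβ : 0 < β) (hα : 0 ≤ α) (hs : β + α ≤ 2)
    (hx : x ∈ Ioc (0 : ℝ) 1) : ⌈β * x + α⌉ = 1 ∨ ⌈β * x + α⌉ = 2 := by
  have h1 : 0 < β * x := mul_pos hβ hx.1
  have h2 : β * x ≤ β := by nlinarith [hx.2]
  have h3 : 0 < ⌈β * x + α⌉ := Int.ceil_pos.mpr (by linarith)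
  have h4 : ⌈β * x + α⌉ ≤ 2 := Int.ceil_le.mpr (by push_cast; linarith)
  omega

lemma rcode_binary {β α x : ℝ} (hβ : 0 < β) (hα : 0 ≤ α) (hs : β + α ≤ 2)
    (hx : x ∈ Ico (0 : ℝ) 1) : IsBinary (rcode β α x) := fun n => by
  rcases floor_digit hβ hα hs (iterate_betaMap_mem (β := β) (α := α) hx n) with h | h <;>
    simp [rcode, h]

lemma lcode_binary {β α x : ℝ} (hβ : 0 < β) (hα : 0 ≤ α) (hs : β + α ≤ 2)
    (hx : x ∈ Ioc (0 : ℝ) 1) : IsBinary (lcode β α x) := fun n => by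
  rcases ceil_digit hβ hα hs (iterate_lmap_mem (β := β) (α := α) hx n) with h | h
  · left; simp [lcode, h]
  · right; simp only [lcode, h]; norm_num

lemma seqShift_rcode (β α x : ℝ) (k : ℕ) :
    seqShift k (rcode β α x) = rcode β α ((betaMap β α)^[k] x) := by
  funext n; simp only [seqShift, rcode, Function.iterate_add_apply]

lemma seqShift_lcode (β α x : ℝ) (k : ℕ) :
    seqShift k (lcode β α x) = lcode β α ((lmap β α)^[k] x) := by
  funext n; simp only [seqShift, lcode, Function.iterate_add_apply]

/-- A bounded orbit of the branches selected by `ω` starts at the value of `ω`. -/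
lemma seqVal_eq_of_orbit {β : ℝ} (hβ : 1 < β) (α : ℝ) {ω : ℕ → ℝ} (h : IsBinary ω) (y : ℕ → ℝ)
    (hy : ∀ n, y n ∈ Icc (0 : ℝ) 1) (hstep : ∀ n, y (n + 1) = β * y n + α - ω n) :
    seqVal β α ω = y 0 := by
  have h0 : (0 : ℝ) < β := by linarith
  have := nonpos_of_contraction hβ univ (fun n => |y n - seqVal β α (seqShift n ω)|)
    (1 + (1 + |α|) / (β - 1)) (fun n _ => ?_) (fun E _ hE n _ => ?_) 0 (mem_univ _)
  · have := abs_nonpos_iff.mp this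
    rw [seqShift_zero] at this
    linarith
  · refine (abs_sub _ _).trans (add_le_add ?_ (abs_seqVal_le hβ α (h.shift n)))
    rw [abs_of_nonneg (hy n).1]; exact (hy n).2
  · have h1 := hE (n + 1) (mem_univ _)
    rw [hstep, seqVal_shift_succ hβ α h] at h1
    rw [le_div_iff₀ h0]
    calc _ = |β * (y n - seqVal β α (seqShift n ω))| := by
          rw [abs_mul, abs_of_pos h0, mul_comm]
      _ ≤ E := by convert h1 using 2; ring

lemma seqVal_rcode {β α x : ℝ} (hβ : 1 < β) (hα : 0 ≤ α) (hs : β + α ≤ 2)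
    (hx : x ∈ Ico (0 : ℝ) 1) : seqVal β α (rcode β α x) = x :=
  seqVal_eq_of_orbit hβ α (rcode_binary (by linarith) hα hs hx) (fun n => (betaMap β α)^[n] x)
    (fun n => Ico_subset_Icc_self (iterate_betaMap_mem hx n))
    (fun n => by rw [Function.iterate_succ_apply', betaMap_eq]; rfl)

lemma seqVal_lcode {β α x : ℝ} (hβ : 1 < β) (hα : 0 ≤ α) (hs : β + α ≤ 2)
    (hx : x ∈ Ioc (0 : ℝ) 1) : seqVal β α (lcode β α x) = x :=
  seqVal_eq_of_orbit hβ α (lcode_binary (by linarith) hα hs hx) (fun n => (lmap β α)^[n] x)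
    (fun n => Ioc_subset_Icc_self (iterate_lmap_mem hx n))
    (fun n => by rw [Function.iterate_succ_apply', lmap]; rfl)

lemma seqVal_shift_rcode {β α x : ℝ} (hβ : 1 < β) (hα : 0 ≤ α) (hs : β + α ≤ 2)
    (hx : x ∈ Ico (0 : ℝ) 1) (k : ℕ) :
    seqVal β α (seqShift k (rcode β α x)) = (betaMap β α)^[k] x := by
  rw [seqShift_rcode, seqVal_rcode hβ hα hs (iterate_betaMap_mem hx k)]

lemma seqVal_shift_lcode {β α x : ℝ} (hβ : 1 < β) (hα : 0 ≤ α) (hs : β + α ≤ 2)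
    (hx : x ∈ Ioc (0 : ℝ) 1) (k : ℕ) :
    seqVal β α (seqShift k (lcode β α x)) = (lmap β α)^[k] x := by
  rw [seqShift_lcode, seqVal_lcode hβ hα hs (iterate_lmap_mem hx k)]

lemma iterate_betaMap_seqVal {β : ℝ} (hβ : 1 < β) (α : ℝ) {ω : ℕ → ℝ} (h : IsBinary ω)
    (hI : ∀ n, seqVal β α (seqShift n ω) ∈ Ico (0 : ℝ) 1) (n : ℕ) :
    (betaMap β α)^[n] (seqVal β α ω) = seqVal β α (seqShift n ω) ∧
      (⌊β * (betaMap β α)^[n] (seqVal β α ω) + α⌋ : ℝ) = ω n := by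
  have key : ∀ n, ∃ k : ℤ, (k : ℝ) = ω n := fun n => by
    rcases h n with h | h <;> rw [h]
    · exact ⟨0, by simp⟩
    · exact ⟨1, by simp⟩
  have step : ∀ n, (⌊β * seqVal β α (seqShift n ω) + α⌋ : ℝ) = ω n ∧
      betaMap β α (seqVal β α (seqShift n ω)) = seqVal β α (seqShift (n + 1) ω) := fun n => by
    obtain ⟨k, hk⟩ := key n
    have e := seqVal_shift_succ hβ α h n
    have h2 := hI (n + 1)
    rw [e, ← hk] at h2
    obtain ⟨h3, h4⟩ := betaMap_of_mem k h2
    exact ⟨by rw [h3, hk], by rw [h4, e, hk]⟩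
  have hit : (betaMap β α)^[n] (seqVal β α ω) = seqVal β α (seqShift n ω) := by
    induction n with
    | zero => rfl
    | succ n ih => rw [Function.iterate_succ_apply', ih, (step n).2]
  exact ⟨hit, by rw [hit, (step n).1]⟩

lemma rcode_seqVal {β : ℝ} (hβ : 1 < β) (α : ℝ) {ω : ℕ → ℝ} (h : IsBinary ω)
    (hI : ∀ n, seqVal β α (seqShift n ω) ∈ Ico (0 : ℝ) 1) :
    rcode β α (seqVal β α ω) = ω :=
  funext fun n => (iterate_betaMap_seqVal hβ α h hI n).2

lemma lcode_seqVal {β : ℝ} (hβ : 1 < β) (α : ℝ) {ω : ℕ → ℝ} (h : IsBinary ω)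
    (hI : ∀ n, seqVal β α (seqShift n ω) ∈ Ioc (0 : ℝ) 1) :
    lcode β α (seqVal β α ω) = ω := by
  have key : ∀ n, ∃ k : ℤ, (k : ℝ) = ω n := fun n => by
    rcases h n with h | h <;> rw [h]
    · exact ⟨0, by simp⟩
    · exact ⟨1, by simp⟩
  have step : ∀ n, (⌈β * seqVal β α (seqShift n ω) + α⌉ : ℝ) - 1 = ω n ∧
      lmap β α (seqVal β α (seqShift n ω)) = seqVal β α (seqShift (n + 1) ω) := fun n => by
    obtain ⟨k, hk⟩ := key n
    have e := seqVal_shift_succ hβ α h n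
    have h2 := hI (n + 1)
    rw [e, ← hk] at h2
    obtain ⟨h3, h4⟩ := lmap_of_mem k h2
    exact ⟨by rw [h3]; push_cast; linarith, by rw [h4, e, hk]⟩
  have hit : ∀ n, (lmap β α)^[n] (seqVal β α ω) = seqVal β α (seqShift n ω) := fun n => by
    induction n with
    | zero => rfl
    | succ n ih => rw [Function.iterate_succ_apply', ih, (step n).2]
  funext n
  simp only [lcode]
  rw [hit, (step n).1]

lemma rcode_lex_rcode {β α x y : ℝ} (hβ : 1 < β) (hα : 0 ≤ α) (hs : β + α ≤ 2)
    (hx : x ∈ Ico (0 : ℝ) 1) (hy : y ∈ Ico (0 : ℝ) 1) (hxy : x < y) :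
    LexLT (rcode β α x) (rcode β α y) := by
  refine lex_of_seqVal_lt hβ α (rcode_binary (by linarith) hα hs hx)
    (rcode_binary (by linarith) hα hs hy) (fun n => ?_) (fun n => ?_) ?_
  · rw [seqVal_shift_rcode hβ hα hs hx]; exact Ico_subset_Icc_self (iterate_betaMap_mem hx n)
  · rw [seqVal_shift_rcode hβ hα hs hy]; exact Ico_subset_Icc_self (iterate_betaMap_mem hy n)
  · rwa [seqVal_rcode hβ hα hs hx, seqVal_rcode hβ hα hs hy]

lemma rcode_lex_lcode {β α x y : ℝ} (hβ : 1 < β) (hα : 0 ≤ α) (hs : β + α ≤ 2)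
    (hx : x ∈ Ico (0 : ℝ) 1) (hy : y ∈ Ioc (0 : ℝ) 1) (hxy : x < y) :
    LexLT (rcode β α x) (lcode β α y) := by
  refine lex_of_seqVal_lt hβ α (rcode_binary (by linarith) hα hs hx)
    (lcode_binary (by linarith) hα hs hy) (fun n => ?_) (fun n => ?_) ?_
  · rw [seqVal_shift_rcode hβ hα hs hx]; exact Ico_subset_Icc_self (iterate_betaMap_mem hx n)
  · rw [seqVal_shift_lcode hβ hα hs hy]; exact Ioc_subset_Icc_self (iterate_lmap_mem hy n)
  · rwa [seqVal_rcode hβ hα hs hx, seqVal_lcode hβ hα hs hy]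

lemma lcode_lex_lcode {β α x y : ℝ} (hβ : 1 < β) (hα : 0 ≤ α) (hs : β + α ≤ 2)
    (hx : x ∈ Ioc (0 : ℝ) 1) (hy : y ∈ Ioc (0 : ℝ) 1) (hxy : x < y) :
    LexLT (lcode β α x) (lcode β α y) := by
  refine lex_of_seqVal_lt hβ α (lcode_binary (by linarith) hα hs hx)
    (lcode_binary (by linarith) hα hs hy) (fun n => ?_) (fun n => ?_) ?_
  · rw [seqVal_shift_lcode hβ hα hs hx]; exact Ioc_subset_Icc_self (iterate_lmap_mem hx n)
  · rw [seqVal_shift_lcode hβ hα hs hy]; exact Ioc_subset_Icc_self (iterate_lmap_mem hy n)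
  · rwa [seqVal_lcode hβ hα hs hx, seqVal_lcode hβ hα hs hy]

lemma one_mem_Ioc : (1 : ℝ) ∈ Ioc (0 : ℝ) 1 := by norm_num

lemma zero_mem_Ico : (0 : ℝ) ∈ Ico (0 : ℝ) 1 := by norm_num

/-- Away from `β + α = 2`, the left itinerary of `1` is not constant. -/
lemma exists_lcode_one_eq_zero {β α : ℝ} (hβ : 1 < β) (hα : 0 ≤ α) (hs : β + α < 2) :
    ∃ n, lcode β α 1 n = 0 := by
  have hb := lcode_binary (by linarith) hα hs.le one_mem_Ioc
  by_contra! hne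
  have hall : ∀ n, lcode β α 1 n = 1 := fun n => (hb n).resolve_left (hne n)
  have h1 := seqVal_shift_lcode hβ hα hs.le one_mem_Ioc 0
  have h2 := seqVal_shift_succ hβ α hb 0
  have : seqShift (0 + 1) (lcode β α 1) = seqShift 0 (lcode β α 1) := by
    funext n; simp [seqShift, hall]
  rw [this, h1, hall, Function.iterate_zero_apply] at h2
  linarith

/-- Left itineraries contain infinitely many digits `1`. -/
lemma exists_lcode_eq_one {β α y : ℝ} (hβ : 1 < β) (hα : 0 ≤ α) (hs : β + α ≤ 2)
    (hy : y ∈ Ioc (0 : ℝ) 1) (k : ℕ) : ∃ n, k ≤ n ∧ lcode β α y n = 1 := by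
  have hb := lcode_binary (by linarith) hα hs hy
  by_contra! hne
  have h1 := seqVal_shift_lcode hβ hα hs hy k
  have h2 : seqVal β α (seqShift k (lcode β α y)) ≤ 0 := by
    refine tsum_nonpos fun n => ?_
    rw [seqShift, (hb (n + k)).resolve_right (hne _ (by omega))]
    have : (0 : ℝ) < β ^ (n + 1) := by positivity
    exact div_nonpos_of_nonpos_of_nonneg (by linarith) this.le
  linarith [(iterate_lmap_mem (β := β) (α := α) hy k).1]

lemma seqVal_zero_shift_lcode_pos {b β α y : ℝ} (hb : 1 < b) (hβ : 1 < β) (hα : 0 ≤ α)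
    (hs : β + α ≤ 2) (hy : y ∈ Ioc (0 : ℝ) 1) (k : ℕ) :
    0 < seqVal b 0 (seqShift k (lcode β α y)) := by
  have hbin := lcode_binary (by linarith) hα hs hy
  obtain ⟨n, hn, h1⟩ := exists_lcode_eq_one hβ hα hs hy k
  have h0 : (0 : ℝ) < b := by linarith
  refine (summable_seqVal hb 0 (hbin.shift k)).tsum_pos (fun n => ?_) (n - k) ?_
  · have := (hbin.shift k).nonneg n
    rw [sub_zero]; positivity
  · rw [seqShift, Nat.sub_add_cancel hn, h1, sub_zero]; positivity

lemma tendsto_affine_right {β : ℝ} (hβ : 0 < β) (a y : ℝ) :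
    Tendsto (fun x => β * x + a) (𝓝[≥] y) (𝓝[≥] (β * y + a)) := by
  refine tendsto_nhdsWithin_iff.mpr ⟨(Continuous.tendsto (by fun_prop) y).mono_left
    nhdsWithin_le_nhds, ?_⟩
  filter_upwards [self_mem_nhdsWithin] with x hx
  have : β * y ≤ β * x := mul_le_mul_of_nonneg_left hx hβ.le
  exact add_le_add_left this a

lemma tendsto_affine_left {β : ℝ} (hβ : 0 < β) (a y : ℝ) :
    Tendsto (fun x => β * x + a) (𝓝[<] y) (𝓝[<] (β * y + a)) := by
  refine tendsto_nhdsWithin_iff.mpr ⟨(Continuous.tendsto (by fun_prop) y).mono_left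
    nhdsWithin_le_nhds, ?_⟩
  filter_upwards [self_mem_nhdsWithin] with x hx
  have : β * x < β * y := mul_lt_mul_of_pos_left hx hβ
  exact add_lt_add_left this a

lemma tendsto_betaMap_right {β : ℝ} (hβ : 0 < β) (α y : ℝ) :
    Tendsto (betaMap β α) (𝓝[≥] y) (𝓝[≥] (betaMap β α y)) := by
  have h1 := (tendsto_floor_right_pure_floor _).comp (tendsto_affine_right hβ α y)
  have h2 := tendsto_affine_right hβ (α - ⌊β * y + α⌋) y
  have e : β * y + (α - ⌊β * y + α⌋) = betaMap β α y := by rw [betaMap_eq]; ring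
  rw [e] at h2
  refine h2.congr' ?_
  filter_upwards [tendsto_pure.mp h1] with x hx
  rw [betaMap_eq, show ⌊β * x + α⌋ = ⌊β * y + α⌋ from hx]; ring

lemma tendsto_betaMap_left {β : ℝ} (hβ : 0 < β) (α y : ℝ) :
    Tendsto (betaMap β α) (𝓝[<] y) (𝓝[<] (lmap β α y)) := by
  have h1 := (tendsto_floor_left_pure_ceil_sub_one _).comp (tendsto_affine_left hβ α y)
  have h2 := tendsto_affine_left hβ (α - (⌈β * y + α⌉ - 1)) y
  have e : β * y + (α - (⌈β * y + α⌉ - 1)) = lmap β α y := by rw [lmap]; ring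
  rw [e] at h2
  refine h2.congr' ?_
  filter_upwards [tendsto_pure.mp h1] with x hx
  rw [betaMap_eq, show ⌊β * x + α⌋ = ⌈β * y + α⌉ - 1 from hx]; push_cast; ring

lemma eventually_rcode_right {β : ℝ} (hβ : 0 < β) (α y : ℝ) (n : ℕ) :
    ∀ᶠ x in 𝓝[≥] y, rcode β α x n = rcode β α y n := by
  have hit : Tendsto (betaMap β α)^[n] (𝓝[≥] y) (𝓝[≥] ((betaMap β α)^[n] y)) := by
    induction n with
    | zero => exact tendsto_id
    | succ n ih =>
      rw [Function.iterate_succ', Function.comp_apply]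
      exact (tendsto_betaMap_right hβ α _).comp ih
  have h1 := (tendsto_floor_right_pure_floor _).comp ((tendsto_affine_right hβ α _).comp hit)
  filter_upwards [tendsto_pure.mp h1] with x hx
  exact congrArg (Int.cast (R := ℝ)) hx

lemma eventually_rcode_left {β : ℝ} (hβ : 0 < β) (α y : ℝ) (n : ℕ) :
    ∀ᶠ x in 𝓝[<] y, rcode β α x n = lcode β α y n := by
  have hit : Tendsto (betaMap β α)^[n] (𝓝[<] y) (𝓝[<] ((lmap β α)^[n] y)) := by
    induction n with
    | zero => exact tendsto_id
    | succ n ih =>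
      rw [Function.iterate_succ', Function.iterate_succ', Function.comp_apply]
      exact (tendsto_betaMap_left hβ α _).comp ih
  have h1 := (tendsto_floor_left_pure_ceil_sub_one _).comp
    ((tendsto_affine_left hβ α _).comp hit)
  filter_upwards [tendsto_pure.mp h1] with x hx
  have := congrArg (Int.cast (R := ℝ)) (show ⌊β * (betaMap β α)^[n] x + α⌋ = _ from hx)
  rw [rcode, lcode, this]; push_cast; ring

/-! ### Conjugacies from matching kneading sequences -/

/-- A strictly increasing function on `[0, 1)` has a continuous left inverse: its generalized
inverse is monotone and onto `[0, 1]`. -/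
lemma exists_continuous_leftInverse {φ : ℝ → ℝ} (hφ : StrictMonoOn φ (Ico 0 1)) :
    ∃ g : ℝ → ℝ, Continuous g ∧ ∀ x ∈ Ico (0 : ℝ) 1, g (φ x) = x := by
  set A : ℝ → Set ℝ := fun y => insert 0 {x | x ∈ Ico (0 : ℝ) 1 ∧ φ x ≤ y} with hA
  have hbdd : ∀ y, BddAbove (A y) := fun y => ⟨1, by
    rintro x (rfl | hx)
    · norm_num
    · exact hx.1.2.le⟩
  have hne : ∀ y, (A y).Nonempty := fun y => ⟨0, mem_insert _ _⟩
  have hmem : ∀ y, sSup (A y) ∈ Icc (0 : ℝ) 1 := fun y => by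
    constructor
    · exact le_csSup (hbdd y) (mem_insert _ _)
    · refine csSup_le (hne y) ?_
      rintro x (rfl | hx)
      · norm_num
      · exact hx.1.2.le
  have hmono : Monotone fun y => (⟨sSup (A y), hmem y⟩ : Icc (0 : ℝ) 1) := fun y z hyz => by
    refine Subtype.mk_le_mk.mpr (csSup_le_csSup (hbdd z) (hne y) ?_)
    exact insert_subset_insert fun x hx => ⟨hx.1, hx.2.trans hyz⟩
  have hval : ∀ x ∈ Ico (0 : ℝ) 1, sSup (A (φ x)) = x := fun x hx => by
    refine IsGreatest.csSup_eq ⟨Or.inr ⟨hx, le_rfl⟩, ?_⟩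
    rintro z (rfl | hz)
    · exact hx.1
    · exact (hφ.le_iff_le hz.1 hx).mp hz.2
  have hdense : DenseRange fun y => (⟨sSup (A y), hmem y⟩ : Icc (0 : ℝ) 1) := by
    have hsub : {z : Icc (0 : ℝ) 1 | z < ⟨1, by norm_num⟩} ⊆
        range fun y => (⟨sSup (A y), hmem y⟩ : Icc (0 : ℝ) 1) := by
      rintro ⟨z, hz⟩ hz1
      exact ⟨φ z, Subtype.ext (hval z ⟨hz.1, hz1⟩)⟩
    refine Dense.mono hsub ?_
    intro z
    have := closure_Iio' (a := (⟨1, by norm_num⟩ : Icc (0 : ℝ) 1))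
      ⟨⟨0, by norm_num⟩, (zero_lt_one : (0 : ℝ) < 1)⟩
    change z ∈ closure (Iio _)
    rw [this]
    exact z.2.2
  refine ⟨fun y => sSup (A y), ?_, hval⟩
  exact continuous_subtype_val.comp (hmono.continuous_of_denseRange hdense)

/-- A strictly increasing function on `[0, 1)` is an embedding away from its discontinuities,
which are countably many. -/
lemma exists_countable_isEmbedding {φ : ℝ → ℝ} (hφ : StrictMonoOn φ (Ico 0 1)) :
    ∃ D : Set ℝ, D.Countable ∧
      ∀ Z ⊆ Ico (0 : ℝ) 1, Disjoint Z D → Topology.IsEmbedding (Z.domRestrict φ) := by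
  obtain ⟨g, hg, hgφ⟩ := exists_continuous_leftInverse hφ
  refine ⟨_, hφ.monotoneOn.countable_not_continuousWithinAt, fun Z hZ hdis => ?_⟩
  have hcont : ContinuousOn φ Z := fun x hx => by
    by_contra hc
    exact hdis.le_bot ⟨hx, hZ hx, fun hc' => hc (hc'.mono hZ)⟩
  refine Topology.IsEmbedding.of_comp (continuousOn_iff_continuous_domRestrict.mp hcont) hg ?_
  have : g ∘ Z.domRestrict φ = Subtype.val := funext fun x => hgφ x (hZ x.2)
  rw [this]
  exact Topology.IsEmbedding.subtypeVal

/-- The data of two parameters with the same kneading sequences: `0` and `1` have for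
`T_{β,α}` the itineraries that `t` and `1` have for the greedy map in base `b`. -/
structure Matched (β α b t : ℝ) : Prop where
  one_lt : 1 < β
  nonneg : 0 ≤ α
  lt_two : β + α < 2
  one_lt_base : 1 < b
  base_lt_two : b < 2
  hole_mem : t ∈ Ico (0 : ℝ) 1
  lower : rcode β α 0 = rcode b 0 t
  upper : lcode β α 1 = lcode b 0 1

namespace Matched

variable {β α b t : ℝ}

lemma binary_rcode (h : Matched β α b t) {x : ℝ} (hx : x ∈ Ico (0 : ℝ) 1) :
    IsBinary (rcode β α x) :=
  rcode_binary (by linarith [h.one_lt]) h.nonneg h.lt_two.le hx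

lemma binary_greedy (h : Matched β α b t) {x : ℝ} (hx : x ∈ Ico (0 : ℝ) 1) :
    IsBinary (rcode b 0 x) :=
  rcode_binary (by linarith [h.one_lt_base]) le_rfl (by linarith [h.base_lt_two]) hx

lemma binary_lcode (h : Matched β α b t) : IsBinary (lcode β α 1) :=
  lcode_binary (by linarith [h.one_lt]) h.nonneg h.lt_two.le one_mem_Ioc

/-- Itineraries of `T_{β,α}` are greedy expansions in base `b`. -/
lemma seqVal_rcode_mem (h : Matched β α b t) {x : ℝ} (hx : x ∈ Ico (0 : ℝ) 1) :
    seqVal b 0 (rcode β α x) ∈ Ico (0 : ℝ) 1 := by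
  have hb := h.one_lt_base
  have hβ := h.one_lt
  have hpos := seqVal_zero_shift_lcode_pos hb hβ h.nonneg h.lt_two.le one_mem_Ioc
  have h1 : seqVal b 0 (lcode β α 1) = 1 := by
    rw [h.upper, seqVal_lcode hb le_rfl (by linarith [h.base_lt_two]) one_mem_Ioc]
  have hlex : ∀ z ∈ Ico (0 : ℝ) 1, LexLT (rcode β α z) (lcode β α 1) := fun z hz =>
    rcode_lex_lcode hβ h.nonneg h.lt_two.le hz one_mem_Ioc hz.2
  have hle := seqVal_le_one hb 0 (S := rcode β α '' Ico 0 1) (ν := lcode β α 1)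
    (by rintro _ ⟨z, hz, rfl⟩; exact h.binary_rcode hz)
    (by rintro _ ⟨z, hz, rfl⟩ k
        exact ⟨_, iterate_betaMap_mem hz k, (seqShift_rcode _ _ _ _).symm⟩)
    h.binary_lcode (by rintro _ ⟨z, hz, rfl⟩; exact Or.inr (hlex z hz)) h1
    (fun k => (hpos k).le)
  refine ⟨seqVal_zero_nonneg hb (h.binary_rcode hx), ?_⟩
  refine seqVal_lt_one_of_lex hb 0 (h.binary_rcode hx) h.binary_lcode (hlex x hx) h1 hpos
    fun k => ?_
  exact hle _ ⟨_, iterate_betaMap_mem hx k, (seqShift_rcode _ _ _ _).symm⟩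

lemma rcode_seqVal_rcode (h : Matched β α b t) {x : ℝ} (hx : x ∈ Ico (0 : ℝ) 1) :
    rcode b 0 (seqVal b 0 (rcode β α x)) = rcode β α x :=
  rcode_seqVal h.one_lt_base 0 (h.binary_rcode hx) fun n => by
    rw [seqShift_rcode]; exact h.seqVal_rcode_mem (iterate_betaMap_mem hx n)

lemma iterate_seqVal_rcode (h : Matched β α b t) {x : ℝ} (hx : x ∈ Ico (0 : ℝ) 1) (n : ℕ) :
    (betaMap b 0)^[n] (seqVal b 0 (rcode β α x)) =
      seqVal b 0 (rcode β α ((betaMap β α)^[n] x)) := by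
  rw [← seqShift_rcode]
  exact (iterate_betaMap_seqVal h.one_lt_base 0 (h.binary_rcode hx) (fun n => by
    rw [seqShift_rcode]; exact h.seqVal_rcode_mem (iterate_betaMap_mem hx n)) n).1

lemma strictMonoOn (h : Matched β α b t) :
    StrictMonoOn (fun x => seqVal b 0 (rcode β α x)) (Ico 0 1) := fun x hx y hy hxy => by
  refine seqVal_lt_of_lex h.one_lt_base 0 (h.binary_rcode hx) (h.binary_rcode hy)
    (fun n => ?_) (fun n => ?_) (rcode_lex_rcode h.one_lt h.nonneg h.lt_two.le hx hy hxy)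
  · rw [seqShift_rcode]; exact (h.seqVal_rcode_mem (iterate_betaMap_mem hx n)).2
  · rw [seqShift_rcode]; exact (h.seqVal_rcode_mem (iterate_betaMap_mem hy n)).1

lemma seqVal_rcode_zero (h : Matched β α b t) : seqVal b 0 (rcode β α 0) = t := by
  rw [h.lower, seqVal_rcode h.one_lt_base le_rfl (by linarith [h.base_lt_two]) h.hole_mem]

lemma seqVal_rcode_mem_survivorSet (h : Matched β α b t) {x : ℝ} (hx : x ∈ Ico (0 : ℝ) 1) :
    seqVal b 0 (rcode β α x) ∈ survivorSet b t := by
  refine ⟨h.seqVal_rcode_mem hx, fun n hn => ?_⟩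
  rw [h.iterate_seqVal_rcode hx] at hn
  have hm := iterate_betaMap_mem (β := β) (α := α) hx n
  have := h.strictMonoOn.monotoneOn zero_mem_Ico hm hm.1
  simp only [h.seqVal_rcode_zero] at this
  exact absurd hn.2 this.not_gt

lemma iterate_mem_survivorSet {y : ℝ} (hy : y ∈ survivorSet b t) (k : ℕ) :
    (betaMap b 0)^[k] y ∈ survivorSet b t := by
  refine ⟨iterate_betaMap_mem hy.1 k, fun n => ?_⟩
  rw [← Function.iterate_add_apply]
  exact hy.2 _

lemma le_of_mem_survivorSet {y : ℝ} (hy : y ∈ survivorSet b t) : t ≤ y := by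
  by_contra! hlt
  exact hy.2 0 ⟨hy.1.1, hlt⟩

/-- Greedy expansions of surviving points are itineraries of `T_{β,α}`. -/
lemma seqVal_greedy_mem (h : Matched β α b t) {y : ℝ} (hy : y ∈ survivorSet b t) :
    seqVal β α (rcode b 0 y) ∈ Ico (0 : ℝ) 1 := by
  have hb := h.one_lt_base
  have hb2 : b + 0 ≤ 2 := by linarith [h.base_lt_two]
  have hβ := h.one_lt
  have hpos : ∀ k, 0 < seqVal β α (seqShift k (lcode b 0 1)) := fun k => by
    rw [← h.upper, seqVal_shift_lcode hβ h.nonneg h.lt_two.le one_mem_Ioc]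
    exact (iterate_lmap_mem one_mem_Ioc k).1
  have h1 : seqVal β α (lcode b 0 1) = 1 := by
    rw [← h.upper, seqVal_lcode hβ h.nonneg h.lt_two.le one_mem_Ioc]
  have hν : IsBinary (lcode b 0 1) := h.upper ▸ h.binary_lcode
  have hlex : ∀ z ∈ survivorSet b t, LexLT (rcode b 0 z) (lcode b 0 1) := fun z hz =>
    rcode_lex_lcode hb le_rfl hb2 hz.1 one_mem_Ioc hz.1.2
  have hbin : ∀ ω ∈ rcode b 0 '' survivorSet b t, IsBinary ω := by
    rintro _ ⟨z, hz, rfl⟩; exact h.binary_greedy hz.1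
  have hsh : ∀ ω ∈ rcode b 0 '' survivorSet b t, ∀ k,
      seqShift k ω ∈ rcode b 0 '' survivorSet b t := by
    rintro _ ⟨z, hz, rfl⟩ k
    exact ⟨_, iterate_mem_survivorSet hz k, (seqShift_rcode _ _ _ _).symm⟩
  have hle := seqVal_le_one hβ α hbin hsh hν
    (by rintro _ ⟨z, hz, rfl⟩; exact Or.inr (hlex z hz)) h1 (fun k => (hpos k).le)
  have hge := seqVal_nonneg hβ α hbin hsh (μ := rcode b 0 t) (h.binary_greedy h.hole_mem)
    (by
      rintro _ ⟨z, hz, rfl⟩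
      rcases (le_of_mem_survivorSet hz).eq_or_lt with he | hlt
      · exact Or.inl (by rw [he])
      · exact Or.inr (rcode_lex_rcode hb le_rfl hb2 h.hole_mem hz.1 hlt))
    (by rw [← h.lower, seqVal_rcode hβ h.nonneg h.lt_two.le zero_mem_Ico])
    (fun k => by
      rw [← h.lower, seqVal_shift_rcode hβ h.nonneg h.lt_two.le zero_mem_Ico]
      exact (iterate_betaMap_mem zero_mem_Ico k).2.le)
  refine ⟨hge _ ⟨y, hy, rfl⟩, ?_⟩
  exact seqVal_lt_one_of_lex hβ α (h.binary_greedy hy.1) hν (hlex y hy) h1 hpos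
    fun k => hle _ (hsh _ ⟨y, hy, rfl⟩ k)

lemma rcode_seqVal_greedy (h : Matched β α b t) {y : ℝ} (hy : y ∈ survivorSet b t) :
    rcode β α (seqVal β α (rcode b 0 y)) = rcode b 0 y :=
  rcode_seqVal h.one_lt α (h.binary_greedy hy.1) fun n => by
    rw [seqShift_rcode]; exact h.seqVal_greedy_mem (iterate_mem_survivorSet hy n)

lemma seqVal_rcode_seqVal (h : Matched β α b t) {y : ℝ} (hy : y ∈ survivorSet b t) :
    seqVal b 0 (rcode β α (seqVal β α (rcode b 0 y))) = y := by
  rw [h.rcode_seqVal_greedy hy,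
    seqVal_rcode h.one_lt_base le_rfl (by linarith [h.base_lt_two]) hy.1]

/-- Matching kneading sequences give an exact conjugacy. The endpoint `1` does not correspond to
a point of the survivor set; it is sent to the image of the other preimage `1 - 1 / β` of
`T_{β,α}(1)`. -/
lemma exactIncTopConj (h : Matched β α b t) :
    ExactIncTopConj (betaMap β α) (Icc 0 1) (betaMap b 0) (survivorSet b t) := by
  have hβ := h.one_lt
  have h0 : (0 : ℝ) < β := by linarith
  set f : ℝ → ℝ := fun x => seqVal b 0 (rcode β α x) with hf
  set r : ℝ → ℝ := fun x => if x = 1 then 1 - 1 / β else x with hr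
  have hc : 1 - 1 / β ∈ Ico (0 : ℝ) 1 := by
    have : 1 / β < 1 := by rw [div_lt_one h0]; exact hβ
    have : 0 < 1 / β := by positivity
    constructor <;> linarith
  have hrmem : ∀ x ∈ Icc (0 : ℝ) 1, r x ∈ Ico (0 : ℝ) 1 := fun x hx => by
    by_cases hx1 : x = 1
    · simp only [hr, hx1, if_true]; exact hc
    · simp only [hr, hx1, if_false]; exact ⟨hx.1, lt_of_le_of_ne hx.2 hx1⟩
  have hrid : ∀ x ∈ Ico (0 : ℝ) 1, r x = x := fun x hx => by
    simp only [hr, hx.2.ne, if_false]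
  have hT : ∀ x, betaMap β α (r x) = betaMap β α x := fun x => by
    by_cases hx1 : x = 1
    · simp only [hr, hx1, if_true, betaMap]
      rw [show β * (1 - 1 / β) + α = β * 1 + α - 1 by field_simp; ring, Int.fract_sub_one]
    · simp only [hr, hx1, if_false]
  have hsemi : ∀ x ∈ Icc (0 : ℝ) 1, f (r (betaMap β α x)) = betaMap b 0 (f (r x)) :=
    fun x hx => by
    rw [hrid _ (betaMap_mem _ _ _), ← hT x]
    exact (h.iterate_seqVal_rcode (hrmem x hx) 1).symm
  obtain ⟨D, hD, hemb⟩ := exists_countable_isEmbedding h.strictMonoOn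
  have hinj := h.strictMonoOn.injOn
  have hmono : StrictMonoOn (fun x => f (r x)) (Ico 0 1) := fun x hx y hy hxy => by
    simp only [hrid x hx, hrid y hy]; exact h.strictMonoOn hx hy hxy
  refine ⟨fun x => f (r x), insert 1 (insert (1 - 1 / β) D), ⟨?_, ?_, ?_, ?_, ?_, ?_⟩, ?_, hsemi⟩
  · exact (hD.insert _).insert _
  · ext y
    constructor
    · rintro ⟨x, hx, rfl⟩
      exact h.seqVal_rcode_mem_survivorSet (hrmem x hx)
    · intro hy
      have hm := h.seqVal_greedy_mem hy
      exact ⟨_, Ico_subset_Icc_self hm, by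
        simp only [hrid _ hm]; exact h.seqVal_rcode_seqVal hy⟩
  · rintro y -
    by_cases hy : ∃ z ∈ Ico (0 : ℝ) 1, f z = y
    · obtain ⟨z, hz, rfl⟩ := hy
      refine (Set.toFinite {z, 1}).subset ?_
      rintro x ⟨hx, hxz⟩
      have := hinj (hrmem x hx) hz hxz
      by_cases hx1 : x = 1
      · exact Or.inr hx1
      · left; simpa only [hr, hx1, if_false] using this
    · convert Set.finite_empty
      ext x
      simp only [mem_ofPred_eq, mem_empty_iff_false, iff_false]
      rintro ⟨hx, hxy⟩
      exact hy ⟨_, hrmem x hx, hxy⟩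
  · rintro x ⟨hx, hxC⟩ x' hx' he
    have he' := hinj (hrmem x' hx') (hrmem x hx) he
    simp only [mem_insert_iff, not_or] at hxC
    by_cases hx1 : x' = 1
    · simp only [hr, hx1, if_true, hxC.1, if_false] at he'
      exact absurd he'.symm hxC.2.1
    · simpa only [hr, hx1, hxC.1, if_false] using he'
  · exact fun x hx => hsemi x hx.1
  · have hsub : Icc (0 : ℝ) 1 \ insert 1 (insert (1 - 1 / β) D) ⊆ Ico 0 1 := by
      rintro x ⟨hx, hxC⟩
      exact ⟨hx.1, lt_of_le_of_ne hx.2 fun he => hxC (Or.inl he)⟩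
    have := hemb _ hsub (disjoint_left.mpr fun x hx hxD => hx.2 (Or.inr (Or.inr hxD)))
    convert this using 1
    funext x
    simp only [domRestrict_apply, hrid _ (hsub x.2)]
    rfl
  · refine hmono.mono ?_
    rintro x ⟨hx, hxC⟩
    exact ⟨hx.1, lt_of_le_of_ne hx.2 fun he => hxC (Or.inl he)⟩

end Matched

/-! ### Every intermediate map is an open greedy map -/

/-- A base `b ∈ (1, 2)` for which the left itinerary of `1` is an expansion of `1`. -/
lemma exists_base {β α : ℝ} (hβ : 1 < β) (hα : 0 ≤ α) (hs : β + α < 2) :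
    ∃ b ∈ Ioo (1 : ℝ) 2, seqVal b 0 (lcode β α 1) = 1 := by
  have hbin := lcode_binary (by linarith) hα hs.le one_mem_Ioc
  obtain ⟨i, -, hi⟩ := exists_lcode_eq_one hβ hα hs.le one_mem_Ioc 0
  obtain ⟨j, hij, hj⟩ := exists_lcode_eq_one hβ hα hs.le one_mem_Ioc (i + 1)
  obtain ⟨m, hm⟩ := exists_lcode_one_eq_zero hβ hα hs
  -- Close to base `1` the two digits `1` at `i < j` already contribute more than `1`.
  obtain ⟨c, hc1, hc2, hcj⟩ : ∃ c : ℝ, 1 < c ∧ c < 2 ∧ c ^ (j + 1) < 2 := by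
    have hcont : Tendsto (fun c : ℝ => c ^ (j + 1)) (𝓝[>] 1) (𝓝 (1 ^ (j + 1))) :=
      ((continuous_pow (j + 1)).tendsto 1).mono_left nhdsWithin_le_nhds
    rw [one_pow] at hcont
    have h1 := hcont.eventually (gt_mem_nhds (show (1 : ℝ) < 2 by norm_num))
    have h2 : ∀ᶠ c : ℝ in 𝓝[>] 1, c < 2 :=
      mem_nhdsWithin_of_mem_nhds (Iio_mem_nhds (by norm_num))
    obtain ⟨c, h3, h4, h5⟩ := (h1.and (h2.and self_mem_nhdsWithin)).exists
    exact ⟨c, h5, h4, h3⟩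
  have hc0 : (0 : ℝ) < c := by linarith
  have hbig : 1 < seqVal c 0 (lcode β α 1) := by
    have hsum := (summable_seqVal hc1 0 hbin).sum_le_tsum {i, j} (fun n _ =>
      div_nonneg (by linarith [hbin.nonneg n]) (by positivity))
    rw [Finset.sum_pair (by omega), hi, hj, sub_zero] at hsum
    have h1 : (1 : ℝ) / 2 < 1 / c ^ (j + 1) := one_div_lt_one_div_of_lt (by positivity) hcj
    have h2 : (1 : ℝ) / c ^ (j + 1) ≤ 1 / c ^ (i + 1) := by
      apply one_div_le_one_div_of_le (by positivity)
      exact pow_le_pow_right₀ hc1.le (by omega)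
    unfold seqVal
    linarith
  have hsmall : seqVal 2 0 (lcode β α 1) < 1 := by
    have := seqVal_zero_lt (β := 2) (by norm_num) hbin m hm
    norm_num at this
    exact this
  have hcont : ContinuousOn (fun b => seqVal b 0 (lcode β α 1)) (Icc c 2) :=
    (continuousOn_seqVal hc1 hbin).mono Icc_subset_Ici_self
  obtain ⟨b, hb, hb1⟩ := intermediate_value_Ioo' hc2.le hcont ⟨hsmall, hbig⟩
  exact ⟨b, ⟨hc1.trans hb.1, hb.2⟩, hb1⟩

lemma exists_matched {β α : ℝ} (hβ : 1 < β) (hα : 0 ≤ α) (hs : β + α < 2) :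
    ∃ b t, Matched β α b t := by
  obtain ⟨b, ⟨hb1, hb2⟩, hb⟩ := exists_base hβ hα hs
  have hbin := lcode_binary (by linarith) hα hs.le one_mem_Ioc
  have hpos := seqVal_zero_shift_lcode_pos hb1 hβ hα hs.le one_mem_Ioc
  have hR : ∀ z ∈ Ico (0 : ℝ) 1, IsBinary (rcode β α z) := fun z hz =>
    rcode_binary (by linarith) hα hs.le hz
  have hlex : ∀ z ∈ Ico (0 : ℝ) 1, LexLT (rcode β α z) (lcode β α 1) := fun z hz =>
    rcode_lex_lcode hβ hα hs.le hz one_mem_Ioc hz.2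
  have hleR := seqVal_le_one hb1 0 (S := rcode β α '' Ico 0 1) (ν := lcode β α 1)
    (by rintro _ ⟨z, hz, rfl⟩; exact hR z hz)
    (by rintro _ ⟨z, hz, rfl⟩ k
        exact ⟨_, iterate_betaMap_mem hz k, (seqShift_rcode _ _ _ _).symm⟩)
    hbin (by rintro _ ⟨z, hz, rfl⟩; exact Or.inr (hlex z hz)) hb (fun k => (hpos k).le)
  have hleL := seqVal_le_one hb1 0 (S := lcode β α '' Ioc 0 1) (ν := lcode β α 1)
    (by rintro _ ⟨z, hz, rfl⟩; exact lcode_binary (by linarith) hα hs.le hz)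
    (by rintro _ ⟨z, hz, rfl⟩ k
        exact ⟨_, iterate_lmap_mem hz k, (seqShift_lcode _ _ _ _).symm⟩)
    hbin
    (by
      rintro _ ⟨z, hz, rfl⟩
      rcases hz.2.eq_or_lt with he | hlt
      · exact Or.inl (by rw [he])
      · exact Or.inr (lcode_lex_lcode hβ hα hs.le hz one_mem_Ioc hlt))
    hb (fun k => (hpos k).le)
  have hmem : ∀ z ∈ Ico (0 : ℝ) 1, seqVal b 0 (rcode β α z) ∈ Ico (0 : ℝ) 1 := fun z hz =>
    ⟨seqVal_zero_nonneg hb1 (hR z hz), seqVal_lt_one_of_lex hb1 0 (hR z hz) hbin (hlex z hz) hb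
      hpos fun k => hleR _ ⟨_, iterate_betaMap_mem hz k, (seqShift_rcode _ _ _ _).symm⟩⟩
  refine ⟨b, seqVal b 0 (rcode β α 0), hβ, hα, hs, hb1, hb2, hmem 0 zero_mem_Ico, ?_, ?_⟩
  · refine (rcode_seqVal hb1 0 (hR 0 zero_mem_Ico) fun n => ?_).symm
    rw [seqShift_rcode]
    exact hmem _ (iterate_betaMap_mem zero_mem_Ico n)
  · have := lcode_seqVal hb1 0 hbin fun n => ⟨hpos n, hleL _ ⟨_, iterate_lmap_mem one_mem_Ioc n,
      (seqShift_lcode _ _ _ _).symm⟩⟩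
    rw [hb] at this
    exact this.symm

lemma exactIncTopConj_topConj {T S : ℝ → ℝ} {X Y : Set ℝ} (h : ExactIncTopConj T X S Y) :
    TopConj T X S Y := by
  obtain ⟨φ, C, h, -, -⟩ := h
  exact ⟨φ, C, h⟩

lemma survivorSet_zero (b : ℝ) : survivorSet b 0 = Ico 0 1 := by
  ext x; simp [survivorSet]

/-- On the boundary `α = 2 - β` the flip `x ↦ 1 - x` conjugates to the greedy map, away from the
finitely many points where `β x + α` is an integer. -/
lemma topConj_flip {β : ℝ} (hβ : 1 < β) :
    TopConj (betaMap β (2 - β)) (Icc 0 1) (betaMap β 0) (survivorSet β 0) := by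
  have h0 : (0 : ℝ) < β := by linarith
  set φ : ℝ → ℝ := fun x => if x = 0 then 0 else 1 - x with hφ
  have hne : ∀ x, x ≠ 0 → φ x = 1 - x := fun x hx => by simp only [hφ, hx, if_false]
  set C : Set ℝ := {0, 1} ∪ range fun k : ℤ => ((k : ℝ) - (2 - β)) / β with hC
  have hC0 : ∀ x, x ∉ C → x ≠ 0 ∧ x ≠ 1 ∧ ∀ k : ℤ, β * x + (2 - β) ≠ k := fun x hx => by
    simp only [hC, mem_union, mem_insert_iff, mem_singleton_iff, mem_range, not_or,
      not_exists] at hx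
    refine ⟨hx.1.1, hx.1.2, fun k hk => hx.2 k ?_⟩
    rw [← hk]; field_simp; ring
  refine ⟨φ, C, ?_, ?_, ?_, ?_, ?_, ?_⟩
  · exact (Set.toFinite _).countable.union (countable_range _)
  · rw [survivorSet_zero]
    ext y
    constructor
    · rintro ⟨x, hx, rfl⟩
      by_cases hx0 : x = 0
      · simp [hφ, hx0]
      · rw [hne x hx0]
        have : 0 < x := lt_of_le_of_ne hx.1 (Ne.symm hx0)
        exact ⟨by linarith [hx.2], by linarith⟩
    · intro hy
      refine ⟨1 - y, ⟨by linarith [hy.2], by linarith [hy.1]⟩, ?_⟩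
      rw [hne _ (by linarith [hy.2])]; ring
  · rintro y -
    refine (Set.toFinite {0, 1 - y}).subset ?_
    rintro x ⟨-, hx⟩
    by_cases hx0 : x = 0
    · exact Or.inl hx0
    · rw [hne x hx0] at hx
      right; rw [mem_singleton_iff]; linarith
  · rintro x ⟨-, hxC⟩ x' - he
    obtain ⟨hx0, hx1, -⟩ := hC0 x hxC
    rw [hne x hx0] at he
    by_cases hx0' : x' = 0
    · rw [hx0'] at he
      simp only [hφ, if_true] at he
      exact absurd (by linarith) hx1
    · rw [hne x' hx0'] at he
      linarith
  · rintro x ⟨-, hxC⟩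
    obtain ⟨hx0, hx1, hk⟩ := hC0 x hxC
    have hfr : Int.fract (β * x + (2 - β)) ≠ 0 := fun h => by
      obtain ⟨k, hk'⟩ := Int.fract_eq_zero_iff.mp h
      exact hk k hk'.symm
    have e : betaMap β 0 (1 - x) = Int.fract (-(β * x + (2 - β))) := by
      rw [betaMap, show β * (1 - x) + 0 = -(β * x + (2 - β)) + (2 : ℤ) by push_cast; ring,
        Int.fract_add_intCast]
    rw [hne x hx0, e, Int.fract_neg hfr]
    exact hne _ hfr
  · have : (Icc (0 : ℝ) 1 \ C).domRestrict φ = (Homeomorph.subLeft 1) ∘ Subtype.val := by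
      funext x
      exact hne _ (hC0 _ x.2.2).1
    rw [this]
    exact (Homeomorph.isEmbedding _).comp Topology.IsEmbedding.subtypeVal

/-! ### Holes that are small for a base with a finite orbit of `1` -/

/-- If the orbit of `1` hits `0`, then the left orbit of `1` is periodic, so it stays away
from `0`. -/
lemma exists_lower_bound_lmap {b : ℝ} (h : ∃ n : ℕ, (betaMap b 0)^[n] 1 = 0) :
    ∃ η > 0, ∀ k, η ≤ (lmap b 0)^[k] 1 := by
  classical
  have hn := Nat.find_spec h
  set n := Nat.find h with hndef
  have hagree : ∀ k, k < n → (lmap b 0)^[k] 1 = (betaMap b 0)^[k] 1 := by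
    intro k
    induction k with
    | zero => intro _; rfl
    | succ k ih =>
      intro hk
      have hne : (betaMap b 0)^[k + 1] 1 ≠ 0 := Nat.find_min h hk
      rw [Function.iterate_succ_apply'] at hne
      rw [Function.iterate_succ_apply', Function.iterate_succ_apply', ih (by omega)]
      have hm := betaMap_mem b 0 ((betaMap b 0)^[k] 1)
      rw [betaMap_eq] at hm hne
      have := (lmap_of_mem ⌊b * (betaMap b 0)^[k] 1 + 0⌋
        ⟨lt_of_le_of_ne hm.1 (Ne.symm hne), hm.2.le⟩).2
      rw [this, betaMap_eq]
  have hn0 : n ≠ 0 := fun h0 => by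
    rw [h0] at hn; simp at hn
  obtain ⟨m, hm⟩ := Nat.exists_eq_succ_of_ne_zero hn0
  have hper : (lmap b 0)^[n] 1 = 1 := by
    rw [hm, Function.iterate_succ_apply'] at hn
    rw [hm, Function.iterate_succ_apply', hagree m (by omega)]
    rw [betaMap_eq] at hn
    have := (lmap_of_mem (β := b) (α := 0) (x := (betaMap b 0)^[m] 1)
      (⌊b * (betaMap b 0)^[m] 1 + 0⌋ - 1) ⟨by push_cast; linarith, by push_cast; linarith⟩).2
    rw [this]; push_cast; linarith
  have hnpos : 0 < n := Nat.pos_of_ne_zero hn0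
  obtain ⟨i, -, hi⟩ := (Finset.range n).exists_min_image (fun k => (lmap b 0)^[k] 1)
    ⟨0, Finset.mem_range.mpr hnpos⟩
  refine ⟨(lmap b 0)^[i] 1, (iterate_lmap_mem one_mem_Ioc i).1, fun k => ?_⟩
  have : (lmap b 0)^[k] 1 = (lmap b 0)^[k % n] 1 := by
    have hp : Function.IsPeriodicPt (lmap b 0) n 1 := hper
    exact (hp.iterate_mod_apply k).symm
  rw [this]
  exact hi _ (Finset.mem_range.mpr (Nat.mod_lt _ hnpos))

/-- A greedy expansion of a small number starts with many digits `0`, so it has a small value in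
every base. -/
lemma seqVal_rcode_le_of_lt {b c t : ℝ} (hb : 1 < b) (hb2 : b < 2) (hc : 1 < c) (N : ℕ)
    (ht : t ∈ Ico (0 : ℝ) 1) (hN : t < 1 / b ^ N) :
    seqVal c 0 (rcode b 0 t) ≤ (1 / (c - 1)) / c ^ N := by
  have h0 : (0 : ℝ) < b := by linarith
  have hc0 : (0 : ℝ) < c := by linarith
  have hbin : IsBinary (rcode b 0 t) := rcode_binary h0 le_rfl (by linarith) ht
  have hzero : IsBinary (fun _ : ℕ => (0 : ℝ)) := fun _ => Or.inl rfl
  have hdig : ∀ k < N, (fun _ : ℕ => (0 : ℝ)) k = rcode b 0 t k := by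
    have hit : ∀ k, k ≤ N → (betaMap b 0)^[k] t = b ^ k * t ∧
        ∀ j < k, rcode b 0 t j = 0 := by
      intro k
      induction k with
      | zero => intro _; simp
      | succ k ih =>
        intro hk
        obtain ⟨h1, h2⟩ := ih (by omega)
        have hlt : b ^ (k + 1) * t < 1 := by
          have : b ^ (k + 1) ≤ b ^ N := pow_le_pow_right₀ hb.le hk
          rw [lt_div_iff₀ (by positivity)] at hN
          have := mul_le_mul_of_nonneg_right this ht.1
          linarith
        have hm : b * (betaMap b 0)^[k] t + 0 - (0 : ℤ) ∈ Ico (0 : ℝ) 1 := by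
          rw [h1]
          have : b * (b ^ k * t) + 0 - ((0 : ℤ) : ℝ) = b ^ (k + 1) * t := by
            push_cast; ring
          rw [this]
          exact ⟨mul_nonneg (by positivity) ht.1, hlt⟩
        obtain ⟨h3, h4⟩ := betaMap_of_mem 0 hm
        refine ⟨?_, fun j hj => ?_⟩
        · rw [Function.iterate_succ_apply', h4, h1]; push_cast; ring
        · rcases Nat.lt_succ_iff_lt_or_eq.mp hj with hj | rfl
          · exact h2 j hj
          · simp only [rcode, h3, Int.cast_zero]
    exact fun k hk => ((hit N le_rfl).2 k hk).symm
  have e := seqVal_sub_of_agree hc 0 hzero hbin N hdig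
  have hz : ∀ k, seqVal c 0 (seqShift k fun _ : ℕ => (0 : ℝ)) = 0 := fun k => by
    simp [seqVal, seqShift]
  have hz0 := hz 0
  rw [seqShift_zero] at hz0
  rw [hz, hz0, sub_zero, sub_zero] at e
  rw [e]
  gcongr
  have := (le_abs_self _).trans (abs_seqVal_le hc 0 (hbin.shift N))
  simpa using this

/-- Small holes are realized by intermediate maps. The parameter `β` solves
`∑ (νₙ - μₙ) / β ^ (n + 1) = 1` close to `b`, where `ν` and `μ` are the kneading sequences; since
the shifts of `ν` have values bounded away from `0` in base `b`, they keep values in `(0, 1]`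
under the perturbation. -/
lemma exists_hole_bound {b : ℝ} (hb : b ∈ Ioo (1 : ℝ) 2)
    (h : ∃ n : ℕ, (betaMap b 0)^[n] 1 = 0) :
    ∃ δ ∈ Ioo (0 : ℝ) b⁻¹, ∀ t ∈ bifurcationSet b, t < δ → ∃ β α, Matched β α b t := by
  obtain ⟨hb1, hb2⟩ := hb
  have hb2' : b + 0 ≤ 2 := by linarith
  have hb0 : 0 < b := by linarith
  obtain ⟨η, hη, hηle⟩ := exists_lower_bound_lmap h
  set ν := lcode b 0 1 with hν
  have hνb : IsBinary ν := lcode_binary hb0 le_rfl hb2' one_mem_Ioc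
  have hν1 : seqVal b 0 ν = 1 := seqVal_lcode hb1 le_rfl hb2' one_mem_Ioc
  obtain ⟨c, hc1, hcb, hcη⟩ : ∃ c, 1 < c ∧ c < b ∧ 1 / (c - 1) - 1 / (b - 1) < η := by
    have hcont : ContinuousAt (fun c : ℝ => 1 / (c - 1) - 1 / (b - 1)) b := by
      have : b - 1 ≠ 0 := by linarith
      fun_prop (disch := assumption)
    have h1 := (hcont.tendsto.mono_left (nhdsWithin_le_nhds (s := Iio b))).eventually
      (gt_mem_nhds (show 1 / (b - 1) - 1 / (b - 1) < η by linarith))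
    have h2 : ∀ᶠ c : ℝ in 𝓝[<] b, 1 < c := mem_nhdsWithin_of_mem_nhds (Ioi_mem_nhds hb1)
    obtain ⟨c, h3, h4, h5⟩ := (h1.and (h2.and self_mem_nhdsWithin)).exists
    exact ⟨c, h4, h5, h3⟩
  have hc0 : 0 < c := by linarith
  have hexc : 1 < seqVal c 0 ν := by
    obtain ⟨n, -, hn⟩ := exists_lcode_eq_one hb1 le_rfl hb2' one_mem_Ioc 0
    rw [← hν1]; exact seqVal_strictAnti hc1 hcb hνb n hn
  obtain ⟨N, hN2, hN⟩ : ∃ N : ℕ, 2 ≤ N ∧ (1 / (c - 1)) / c ^ N < seqVal c 0 ν - 1 := by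
    have hl : Tendsto (fun m : ℕ => (1 / (c - 1)) / c ^ m) atTop (𝓝 0) := by
      have := (tendsto_pow_atTop_nhds_zero_of_lt_one (r := c⁻¹) (by positivity)
        (inv_lt_one_of_one_lt₀ hc1)).const_mul (1 / (c - 1))
      rw [mul_zero] at this
      refine this.congr fun m => ?_
      rw [inv_pow, div_eq_mul_inv _ (c ^ m)]
    obtain ⟨N, h1, h2⟩ := ((hl.eventually (gt_mem_nhds (sub_pos.mpr hexc))).and
      (eventually_ge_atTop 2)).exists
    exact ⟨N, h2, h1⟩
  refine ⟨1 / b ^ N, ⟨by positivity, ?_⟩, fun t ht htN => ?_⟩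
  · rw [one_div]
    apply inv_strictAnti₀ hb0
    exact lt_self_pow₀ hb1 (by omega)
  have ht1 : t ∈ Ico (0 : ℝ) 1 := ht.1
  set μ := rcode b 0 t with hμ
  have hμb : IsBinary μ := rcode_binary hb0 le_rfl hb2' ht1
  have hμt : seqVal b 0 μ = t := seqVal_rcode hb1 le_rfl hb2' ht1
  obtain ⟨β, hβ, hβ1⟩ : ∃ β ∈ Icc c b, seqVal β 0 ν - seqVal β 0 μ = 1 := by
    have hcont : ContinuousOn (fun β => seqVal β 0 ν - seqVal β 0 μ) (Icc c b) :=
      ((continuousOn_seqVal hc1 hνb).sub (continuousOn_seqVal hc1 hμb)).mono Icc_subset_Ici_self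
    have := intermediate_value_Icc' hcb.le hcont
    refine this ⟨?_, ?_⟩
    · rw [hν1, hμt]; linarith [ht1.1]
    · have := seqVal_rcode_le_of_lt hb1 hb2 hc1 N ht1 htN
      linarith
  have hβ1' : 1 < β := lt_of_lt_of_le hc1 hβ.1
  set α := (β - 1) * seqVal β 0 μ with hα
  have hα0 : 0 ≤ α := mul_nonneg (by linarith) (seqVal_zero_nonneg hβ1' hμb)
  have hval : ∀ ω, IsBinary ω → seqVal β α ω = seqVal β 0 ω - seqVal β 0 μ := fun ω hω => by
    rw [seqVal_eq_sub hβ1' α hω, hα, mul_div_cancel_left₀]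
    linarith
  have hvν : seqVal β α ν = 1 := by rw [hval ν hνb, hβ1]
  have hvμ : seqVal β α μ = 0 := by rw [hval μ hμb, sub_self]
  have hpos : ∀ k, 0 < seqVal β α (seqShift k ν) := fun k => by
    rw [hval _ (hνb.shift k)]
    have h1 := (seqVal_zero_mono hβ1' hβ.2 (hνb.shift k)).1
    have h2 := (seqVal_zero_mono hβ1' hβ.2 hνb).2
    have h3 : 1 / (β - 1) ≤ 1 / (c - 1) :=
      one_div_le_one_div_of_le (by linarith) (by linarith [hβ.1])
    have h4 : η ≤ seqVal b 0 (seqShift k ν) := by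
      rw [hν, seqVal_shift_lcode hb1 le_rfl hb2' one_mem_Ioc]; exact hηle k
    linarith
  have hR : ∀ z ∈ Ico (0 : ℝ) 1, IsBinary (rcode b 0 z) := fun z hz =>
    rcode_binary hb0 le_rfl hb2' hz
  have hlex : ∀ z ∈ Ico (0 : ℝ) 1, LexLT (rcode b 0 z) ν := fun z hz =>
    rcode_lex_lcode hb1 le_rfl hb2' hz one_mem_Ioc hz.2
  have hleL := seqVal_le_one hβ1' α (S := lcode b 0 '' Ioc 0 1) (ν := ν)
    (by rintro _ ⟨z, hz, rfl⟩; exact lcode_binary hb0 le_rfl hb2' hz)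
    (by rintro _ ⟨z, hz, rfl⟩ k
        exact ⟨_, iterate_lmap_mem hz k, (seqShift_lcode _ _ _ _).symm⟩)
    hνb
    (by
      rintro _ ⟨z, hz, rfl⟩
      rcases hz.2.eq_or_lt with he | hlt
      · exact Or.inl (by rw [he])
      · exact Or.inr (lcode_lex_lcode hb1 le_rfl hb2' hz one_mem_Ioc hlt))
    hvν (fun k => (hpos k).le)
  have hleL' : ∀ k, seqVal β α (seqShift k ν) ≤ 1 := fun k =>
    hleL _ ⟨_, iterate_lmap_mem one_mem_Ioc k, (seqShift_lcode _ _ _ _).symm⟩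
  have hleR := seqVal_le_one hβ1' α (S := rcode b 0 '' Ico 0 1) (ν := ν)
    (by rintro _ ⟨z, hz, rfl⟩; exact hR z hz)
    (by rintro _ ⟨z, hz, rfl⟩ k
        exact ⟨_, iterate_betaMap_mem hz k, (seqShift_rcode _ _ _ _).symm⟩)
    hνb (by rintro _ ⟨z, hz, rfl⟩; exact Or.inr (hlex z hz)) hvν (fun k => (hpos k).le)
  have hleR' : ∀ z ∈ Ico (0 : ℝ) 1, ∀ k, seqVal β α (seqShift k (rcode b 0 z)) ≤ 1 :=
    fun z hz k => hleR _ ⟨_, iterate_betaMap_mem hz k, (seqShift_rcode _ _ _ _).symm⟩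
  have hgeR := seqVal_nonneg hβ1' α (S := rcode b 0 '' survivorSet b t) (μ := μ)
    (by rintro _ ⟨z, hz, rfl⟩; exact hR z hz.1)
    (by rintro _ ⟨z, hz, rfl⟩ k
        exact ⟨_, Matched.iterate_mem_survivorSet hz k, (seqShift_rcode _ _ _ _).symm⟩)
    hμb
    (by
      rintro _ ⟨z, hz, rfl⟩
      rcases (Matched.le_of_mem_survivorSet hz).eq_or_lt with he | hlt
      · exact Or.inl (by rw [← he])
      · exact Or.inr (rcode_lex_rcode hb1 le_rfl hb2' ht1 hz.1 hlt))
    hvμ (hleR' t ht1)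
  have hmem : ∀ z ∈ survivorSet b t, seqVal β α (rcode b 0 z) ∈ Ico (0 : ℝ) 1 := fun z hz =>
    ⟨hgeR _ ⟨z, hz, rfl⟩,
      seqVal_lt_one_of_lex hβ1' α (hR z hz.1) hνb (hlex z hz.1) hvν hpos (hleR' z hz.1)⟩
  have ht' : t ∈ survivorSet b t := ht
  refine ⟨β, α, hβ1', hα0, ?_, hb1, hb2, ht1, ?_, ?_⟩
  · -- `β + α ≥ 2` would make `ν` constant, which forces `b = 2`.
    have h1 := seqVal_shift_succ hβ1' α hνb 0
    rw [seqShift_zero, hvν] at h1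
    have h2 := hνb.le_one 0
    have h3 := hleL' 1
    rw [zero_add] at h1
    by_contra! hge
    have h4 : seqVal β α (seqShift 1 ν) = 1 := by linarith
    have h5 : seqShift 1 ν = ν := by
      rw [hν, seqShift_lcode]
      rcases (iterate_lmap_mem (β := b) (α := 0) one_mem_Ioc 1).2.eq_or_lt with he | hlt
      · rw [he]
      · exfalso
        have hm := iterate_lmap_mem (β := b) (α := 0) one_mem_Ioc 1
        have hl := lcode_lex_lcode hb1 le_rfl hb2' hm one_mem_Ioc hlt
        have := seqVal_lt_one_of_lex hβ1' α (lcode_binary hb0 le_rfl hb2' hm) hνb hl hvν hpos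
          (fun k => by rw [← seqShift_lcode, seqShift_seqShift]; exact hleL' _)
        rw [← seqShift_lcode] at this
        exact absurd h4 this.ne
    have h6 := seqVal_shift_succ hb1 0 hνb 0
    rw [zero_add, h5, seqShift_zero, hν1] at h6
    linarith
  · have := rcode_seqVal hβ1' α hμb fun n => by
      rw [hμ, seqShift_rcode]
      exact hmem _ (Matched.iterate_mem_survivorSet ht' n)
    rw [hvμ] at this
    exact this
  · have := lcode_seqVal hβ1' α hνb fun n => ⟨hpos n, hleL' n⟩
    rw [hvν] at this
    exact this

/-! ### The kneading sequences determine the parameters -/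

/-- The weighted count `∑ sⁿ 1_{x < yₙ}` of the points of a sequence above `x`. The difference of
two such functions, for the orbits of `1` and `0`, is Parry's formula for an invariant density. -/
noncomputable def tailCount (s : ℝ) (y : ℕ → ℝ) (x : ℝ) : ℝ :=
  ∑' n, s ^ n * (if x < y n then 1 else 0)

lemma summable_tailCount {s : ℝ} (hs : 0 ≤ s) (hs1 : s < 1) (y : ℕ → ℝ) (x : ℝ) :
    Summable fun n => s ^ n * (if x < y n then (1 : ℝ) else 0) := by
  refine Summable.of_nonneg_of_le (fun n => ?_) (fun n => ?_) (summable_geometric_of_lt_one hs hs1)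
  · split_ifs <;> simp [pow_nonneg hs n]
  · split_ifs <;> simp [pow_nonneg hs n]

lemma antitone_tailCount {s : ℝ} (hs : 0 ≤ s) (hs1 : s < 1) (y : ℕ → ℝ) :
    Antitone (tailCount s y) := fun a b hab => by
  refine (summable_tailCount hs hs1 y b).tsum_le_tsum (fun n => ?_) (summable_tailCount hs hs1 y a)
  refine mul_le_mul_of_nonneg_left ?_ (pow_nonneg hs n)
  by_cases h : b < y n
  · rw [if_pos h, if_pos (hab.trans_lt h)]
  · rw [if_neg h]; split_ifs <;> norm_num

lemma tailCount_of_one_le {s : ℝ} {y : ℕ → ℝ} (hy : ∀ n, y n ≤ 1) {x : ℝ} (hx : 1 ≤ x) :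
    tailCount s y x = 0 := by
  have : ∀ n, ¬ x < y n := fun n => not_lt.mpr ((hy n).trans hx)
  simp [tailCount, this]

lemma tendsto_tailCount {s : ℝ} (hs : 0 ≤ s) (hs1 : s < 1) (y : ℕ → ℝ) :
    Tendsto (tailCount s y) (𝓝[>] 0) (𝓝 (tailCount s y 0)) := by
  refine tendsto_tsum_of_dominated_convergence (bound := fun n => s ^ n)
    (summable_geometric_of_lt_one hs hs1) (fun n => ?_) (Eventually.of_forall fun x n => ?_)
  · refine tendsto_const_nhds.congr' ?_
    by_cases h : 0 < y n
    · have h1 : ∀ᶠ x in 𝓝[>] (0 : ℝ), x < y n :=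
        mem_nhdsWithin_of_mem_nhds (Iio_mem_nhds h)
      filter_upwards [h1] with x hx
      rw [if_pos h, if_pos hx]
    · filter_upwards [self_mem_nhdsWithin] with x hx
      rw [if_neg h, if_neg fun hx' => h (lt_trans hx hx')]
  · rw [Real.norm_eq_abs, abs_of_nonneg]
    · split_ifs <;> simp [pow_nonneg hs n]
    · split_ifs <;> simp [pow_nonneg hs n]

/-- The transfer operator of `T_{β,α}` on the indicator function of `[0, a)`. -/
lemma transfer_indicator {β α a d x : ℝ} (hβ : 0 < β) (hd : d = 0 ∨ d = 1) (ha : 0 ≤ a)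
    (ha' : β * a + α - d ∈ Icc (0 : ℝ) 1) (hx : x ∈ Ico (0 : ℝ) 1) :
    ((if α ≤ x then (if (x - α) / β < a then (1 : ℝ) else 0) else 0) +
      if (x + 1 - α) / β < a then (1 : ℝ) else 0) =
      d + (if x < β * a + α - d then 1 else 0) - if x < α then 1 else 0 := by
  have h0 := mul_nonneg hβ.le ha
  simp only [div_lt_iff₀ hβ, mul_comm a β]
  obtain ⟨h1, h2⟩ := ha'
  obtain ⟨h3, h4⟩ := hx
  rcases hd with rfl | rfl <;> split_ifs <;> linarith

/-- The transfer operator acts on the weighted count of an orbit by a shift of the orbit. -/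
lemma transfer_tailCount {β α s x : ℝ} (hβ : 0 < β) (hs : 0 ≤ s) (hs1 : s < 1) {y d : ℕ → ℝ}
    (hd : IsBinary d) (hy : ∀ n, y n ∈ Icc (0 : ℝ) 1) (hstep : ∀ n, y (n + 1) = β * y n + α - d n)
    (hx : x ∈ Ico (0 : ℝ) 1) :
    s * ((if α ≤ x then tailCount s y ((x - α) / β) else 0) + tailCount s y ((x + 1 - α) / β)) =
      s * (∑' n, s ^ n * d n) + tailCount s y x - (if x < y 0 then 1 else 0) -
        s * ∑' n, s ^ n * (if x < α then 1 else 0) := by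
  have hg := summable_geometric_of_lt_one hs hs1
  have hsd : Summable fun n => s ^ n * d n := by
    refine Summable.of_nonneg_of_le (fun n => mul_nonneg (pow_nonneg hs n) (hd.nonneg n))
      (fun n => mul_le_of_le_one_right (pow_nonneg hs n) (hd.le_one n)) hg
  have h1 := (summable_tailCount hs hs1 y ((x - α) / β)).hasSum
  have h2 := (summable_tailCount hs hs1 y ((x + 1 - α) / β)).hasSum
  have h3 := (summable_tailCount hs hs1 (fun n => y (n + 1)) x).hasSum
  have h4 : HasSum (fun n => s ^ n * (if α ≤ x then (if (x - α) / β < y n then (1 : ℝ) else 0)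
      else 0)) (if α ≤ x then tailCount s y ((x - α) / β) else 0) := by
    split_ifs with h
    · exact h1
    · simp only [mul_zero]; exact hasSum_zero
  have h5 := (hsd.hasSum.add h3).sub (hg.mul_right (if x < α then (1 : ℝ) else 0)).hasSum
  have h6 := h4.add h2
  have h7 : (fun n => s ^ n * (if α ≤ x then (if (x - α) / β < y n then (1 : ℝ) else 0) else 0) +
      s ^ n * (if (x + 1 - α) / β < y n then (1 : ℝ) else 0)) = fun n => s ^ n * d n +
      s ^ n * (if x < y (n + 1) then 1 else 0) - s ^ n * (if x < α then (1 : ℝ) else 0) := by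
    funext n
    rw [← mul_add, ← mul_add, ← mul_sub, hstep]
    congr 1
    exact transfer_indicator hβ (hd n) (hy n).1 (hstep n ▸ hy (n + 1)) hx
  rw [h7] at h6
  have h8 := h6.unique h5
  have h9 : tailCount s y x = (if x < y 0 then 1 else 0) +
      s * ∑' n, s ^ n * (if x < y (n + 1) then (1 : ℝ) else 0) := by
    rw [tailCount, (summable_tailCount hs hs1 y x).tsum_eq_zero_add, ← tsum_mul_left]
    congr 1
    · simp
    · exact tsum_congr fun n => by rw [pow_succ]; ring
  simp only [tailCount] at h8 h9 ⊢
  rw [h8, h9]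
  ring

lemma intervalIntegrable_abs_sub {f g : ℝ → ℝ} (hf : Antitone f) (hg : Antitone g) (a b : ℝ) :
    IntervalIntegrable (fun x => |f x - g x|) MeasureTheory.volume a b :=
  ((hf.antitoneOn _).intervalIntegrable.sub (hg.antitoneOn _).intervalIntegrable).abs

/-- The equation `∑ (νₙ - μₙ) / c ^ (n + 1) = 1` between the kneading sequences of `T_{β,α}` has
no solution `c > β`: otherwise Parry's formula with `c` in place of `β` would give an
eigenfunction of the transfer operator with eigenvalue `c`, while the operator multiplies
`L¹`-norms by at most `β`. The eigenfunction is not zero, since it is positive close to `0`. -/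
lemma kneading_ne_one {β α c : ℝ} (hβ : 1 < β) (hα : 0 ≤ α) (hs : β + α ≤ 2) (hc : β < c) :
    seqVal c 0 (lcode β α 1) - seqVal c 0 (rcode β α 0) ≠ 1 := by
  intro heq
  have hβ0 : 0 < β := by linarith
  have hc1 : 1 < c := hβ.trans hc
  have hc0 : 0 < c := by linarith
  set s := c⁻¹ with hsdef
  have hs0 : 0 < s := inv_pos.mpr hc0
  have hs1 : s < 1 := inv_lt_one_of_one_lt₀ hc1
  have hνb := lcode_binary hβ0 hα hs one_mem_Ioc
  have hμb := rcode_binary hβ0 hα hs zero_mem_Ico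
  set y : ℕ → ℝ := fun n => (lmap β α)^[n] 1 with hy
  set z : ℕ → ℝ := fun n => (betaMap β α)^[n] 0 with hz
  have hyI : ∀ n, y n ∈ Ioc (0 : ℝ) 1 := fun n => iterate_lmap_mem one_mem_Ioc n
  have hzI : ∀ n, z n ∈ Ico (0 : ℝ) 1 := fun n => iterate_betaMap_mem zero_mem_Ico n
  have hystep : ∀ n, y (n + 1) = β * y n + α - lcode β α 1 n := fun n => by
    simp only [hy, Function.iterate_succ_apply', lcode]; rfl
  have hzstep : ∀ n, z (n + 1) = β * z n + α - rcode β α 0 n := fun n => by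
    simp only [hz, Function.iterate_succ_apply', rcode]; rfl
  have hA : ∀ ω : ℕ → ℝ, s * ∑' n, s ^ n * ω n = seqVal c 0 ω := fun ω => by
    rw [← tsum_mul_left, seqVal]
    refine tsum_congr fun n => ?_
    rw [sub_zero, div_eq_mul_inv, ← inv_pow, pow_succ]; ring
  set k : ℝ → ℝ := fun x => |tailCount s y x - tailCount s z x| with hk
  have hay := antitone_tailCount hs0.le hs1 y
  have haz := antitone_tailCount hs0.le hs1 z
  have hfun : ∀ x ∈ Ico (0 : ℝ) 1, k x ≤
      s * ((if α ≤ x then k ((x - α) / β) else 0) + k ((x + 1 - α) / β)) := by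
    intro x hx
    have e1 := transfer_tailCount hβ0 hs0.le hs1 hνb (fun n => Ioc_subset_Icc_self (hyI n))
      hystep hx
    have e2 := transfer_tailCount hβ0 hs0.le hs1 hμb (fun n => Ico_subset_Icc_self (hzI n))
      hzstep hx
    rw [hA] at e1 e2
    have hy0 : x < y 0 := hx.2
    have hz0 : ¬ x < z 0 := not_lt.mpr hx.1
    rw [if_pos hy0] at e1
    rw [if_neg hz0] at e2
    simp only [hk]
    by_cases hxα : α ≤ x
    · rw [if_pos hxα] at e1 e2 ⊢
      have e : tailCount s y x - tailCount s z x =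
        s * ((tailCount s y ((x - α) / β) - tailCount s z ((x - α) / β)) +
          (tailCount s y ((x + 1 - α) / β) - tailCount s z ((x + 1 - α) / β))) := by
        linarith
      rw [e, abs_mul, abs_of_pos hs0]
      exact mul_le_mul_of_nonneg_left (abs_add_le _ _) hs0.le
    · rw [if_neg hxα] at e1 e2 ⊢
      have e : tailCount s y x - tailCount s z x =
        s * (0 + (tailCount s y ((x + 1 - α) / β) - tailCount s z ((x + 1 - α) / β))) := by
        linarith
      rw [e, abs_mul, abs_of_pos hs0, zero_add, zero_add]
  have hkint : ∀ a b, IntervalIntegrable k MeasureTheory.volume a b :=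
    intervalIntegrable_abs_sub hay haz
  have hkaff : ∀ e a b, IntervalIntegrable (fun x => k ((x + e) / β)) MeasureTheory.volume a b :=
    fun e a b => by
      have hmono : Monotone fun x : ℝ => (x + e) / β := fun x x' h => by
        simp only; gcongr
      exact intervalIntegrable_abs_sub (hay.comp_monotone hmono) (haz.comp_monotone hmono) a b
  have hsubst : ∀ e a b, ∫ x in a..b, k ((x + e) / β) =
      β * ∫ x in (a + e) / β..(b + e) / β, k x := fun e a b => by
    have h1 := intervalIntegral.integral_comp_mul_add (a := a) (b := b) k
      (inv_ne_zero hβ0.ne') (e / β)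
    rw [inv_inv, smul_eq_mul] at h1
    have h2 : ∀ x, β⁻¹ * x + e / β = (x + e) / β := fun x => by field_simp
    simp only [h2] at h1
    exact h1
  have hknn : ∀ x, 0 ≤ k x := fun x => abs_nonneg _
  have hα1 : α ≤ 1 := by linarith
  have hI1 : ∫ x in (0 : ℝ)..α, k x ≤ ∫ x in (0 : ℝ)..α, s * k ((x + (1 - α)) / β) := by
    refine intervalIntegral.integral_mono_on_of_le_Ioo hα (hkint _ _)
      ((hkaff _ _ _).const_mul _) fun x hx => ?_
    have := hfun x ⟨hx.1.le, hx.2.trans_le hα1⟩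
    rw [if_neg (not_le.mpr hx.2), zero_add] at this
    rwa [← add_sub_assoc]
  have hI2 : ∫ x in α..1, k x ≤
      ∫ x in α..1, (s * k ((x + -α) / β) + s * k ((x + (1 - α)) / β)) := by
    refine intervalIntegral.integral_mono_on_of_le_Ioo hα1 (hkint _ _)
      (((hkaff _ _ _).const_mul _).add ((hkaff _ _ _).const_mul _)) fun x hx => ?_
    have := hfun x ⟨hα.trans hx.1.le, hx.2⟩
    rw [if_pos hx.1.le, mul_add] at this
    rwa [← add_sub_assoc, ← sub_eq_add_neg]
  rw [intervalIntegral.integral_add ((hkaff _ _ _).const_mul _) ((hkaff _ _ _).const_mul _)] at hI2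
  have hI3 := intervalIntegral.integral_add_adjacent_intervals
    (((hkaff (1 - α) 0 α).const_mul s)) (((hkaff (1 - α) α 1).const_mul s))
  rw [intervalIntegral.integral_const_mul s (a := 0) (b := 1), hsubst] at hI3
  rw [intervalIntegral.integral_const_mul s (f := fun x => k ((x + -α) / β)), hsubst] at hI2
  have hI4 := intervalIntegral.integral_add_adjacent_intervals (hkint 0 α) (hkint α 1)
  have hI5 := intervalIntegral.integral_add_adjacent_intervals (hkint 0 ((1 - α) / β))
    (hkint ((1 - α) / β) ((2 - α) / β))
  have h21 : 1 ≤ (2 - α) / β := by rw [le_div_iff₀ hβ0]; linarith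
  have hI6 := intervalIntegral.integral_add_adjacent_intervals (hkint 0 1)
    (hkint 1 ((2 - α) / β))
  have hI7 : ∫ x in (1 : ℝ)..(2 - α) / β, k x = 0 := by
    refine intervalIntegral.integral_zero_ae (Eventually.of_forall fun x hx => ?_)
    rw [uIoc_of_le h21] at hx
    simp only [hk]
    rw [tailCount_of_one_le (fun n => (hyI n).2) hx.1.le,
      tailCount_of_one_le (fun n => (hzI n).2.le) hx.1.le, sub_zero, abs_zero]
  have e1 : (α + -α) / β = 0 := by simp
  have e2 : (1 + -α) / β = (1 - α) / β := by rw [sub_eq_add_neg]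
  have e3 : (0 + (1 - α)) / β = (1 - α) / β := by rw [zero_add]
  have e4 : (1 + (1 - α)) / β = (2 - α) / β := by ring_nf
  rw [e1, e2] at hI2
  rw [e3, e4] at hI3
  have hle : ∫ x in (0 : ℝ)..1, k x ≤ s * β * ∫ x in (0 : ℝ)..1, k x := by
    have e5 : s * β * ∫ x in (0 : ℝ)..1, k x = s * (β * ∫ x in (0 : ℝ)..(1 - α) / β, k x) +
        s * (β * ∫ x in (1 - α) / β..(2 - α) / β, k x) := by
      rw [← mul_add, ← mul_add, hI5, ← hI6, hI7, add_zero, mul_assoc]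
    linarith
  have hpos0 : 0 < tailCount s y 0 - tailCount s z 0 := by
    have hy0 : tailCount s y 0 = ∑' n, s ^ n := by
      refine tsum_congr fun n => ?_
      rw [if_pos (hyI n).1, mul_one]
    rw [hy0, sub_pos]
    refine (summable_tailCount hs0.le hs1 z 0).tsum_lt_tsum (i := 0) (fun n => ?_) ?_
      (summable_geometric_of_lt_one hs0.le hs1)
    · split_ifs <;> simp [pow_nonneg hs0.le n]
    · simp [hz]
  have hev := ((tendsto_tailCount hs0.le hs1 y).sub
    (tendsto_tailCount hs0.le hs1 z)).eventually (lt_mem_nhds hpos0)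
  obtain ⟨r, hr, hrpos⟩ := mem_nhdsGT_iff_exists_Ioo_subset.mp hev
  have hr0 : (0 : ℝ) < min r 1 := lt_min hr one_pos
  have hI8 : 0 < ∫ x in (0 : ℝ)..min r 1, k x := by
    refine intervalIntegral.intervalIntegral_pos_of_pos_on (hkint _ _) (fun x hx => ?_) hr0
    exact abs_pos.mpr (ne_of_gt (hrpos ⟨hx.1, hx.2.trans_le (min_le_left _ _)⟩))
  have hI9 : 0 ≤ ∫ x in min r 1..1, k x :=
    intervalIntegral.integral_nonneg (min_le_right _ _) fun x _ => hknn x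
  have hI10 := intervalIntegral.integral_add_adjacent_intervals (hkint 0 (min r 1))
    (hkint (min r 1) 1)
  have hpos : 0 < ∫ x in (0 : ℝ)..1, k x := by linarith
  have hsβ : s * β < 1 := by
    rw [hsdef, inv_mul_lt_iff₀ hc0, mul_one]; exact hc
  nlinarith

/-- Two intermediate maps with the same kneading sequences are equal. -/
lemma eq_of_kneading_eq {β α β' α' : ℝ} (hβ : 1 < β) (hα : 0 ≤ α) (hs : β + α ≤ 2)
    (hβ' : 1 < β') (hα' : 0 ≤ α') (hs' : β' + α' ≤ 2) (hlo : rcode β α 0 = rcode β' α' 0)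
    (hup : lcode β α 1 = lcode β' α' 1) : β = β' ∧ α = α' := by
  have key : ∀ {β α : ℝ}, 1 < β → 0 ≤ α → β + α ≤ 2 →
      seqVal β 0 (rcode β α 0) = α / (β - 1) ∧
      seqVal β 0 (lcode β α 1) - seqVal β 0 (rcode β α 0) = 1 := fun {β α} hβ hα hs => by
    have h1 := seqVal_eq_sub hβ α (rcode_binary (by linarith) hα hs zero_mem_Ico)
    have h2 := seqVal_eq_sub hβ α (lcode_binary (by linarith) hα hs one_mem_Ioc)
    rw [seqVal_rcode hβ hα hs zero_mem_Ico] at h1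
    rw [seqVal_lcode hβ hα hs one_mem_Ioc] at h2
    constructor <;> linarith
  have hββ : β = β' := by
    rcases lt_trichotomy β β' with h | h | h
    · refine absurd ?_ (kneading_ne_one hβ hα hs h)
      rw [hlo, hup]; exact (key hβ' hα' hs').2
    · exact h
    · refine absurd ?_ (kneading_ne_one hβ' hα' hs' h)
      rw [← hlo, ← hup]; exact (key hβ hα hs).2
  subst hββ
  refine ⟨rfl, ?_⟩
  have h1 := (key hβ hα hs).1
  have h2 := (key hβ' hα' hs').1
  rw [hlo, h2] at h1
  have : β - 1 ≠ 0 := by linarith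
  field_simp at h1
  exact h1.symm

/-! ### Orientation-preserving conjugacies respect itineraries -/

lemma countable_preimage_betaMap {β : ℝ} (hβ : β ≠ 0) (α : ℝ) {S : Set ℝ} (hS : S.Countable) :
    (betaMap β α ⁻¹' S).Countable := by
  refine (countable_iUnion fun k : ℤ => hS.image fun y => (y + k - α) / β).mono fun x hx => ?_
  refine mem_iUnion.mpr ⟨⌊β * x + α⌋, betaMap β α x, hx, ?_⟩
  rw [betaMap_eq]
  field_simp
  ring

lemma countable_preimage_iterate {β : ℝ} (hβ : β ≠ 0) (α : ℝ) {S : Set ℝ} (hS : S.Countable)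
    (n : ℕ) : ((betaMap β α)^[n] ⁻¹' S).Countable := by
  induction n with
  | zero => exact hS
  | succ n ih =>
    rw [Function.iterate_succ, preimage_comp]
    exact countable_preimage_betaMap hβ α ih

lemma exists_mem_Ioo_notMem {B : Set ℝ} (hB : B.Countable) {a b : ℝ} (hab : a < b) :
    ∃ x ∈ Ioo a b, x ∉ B := by
  obtain ⟨x, hx, hx'⟩ := (hB.dense_compl ℝ).exists_between hab
  exact ⟨x, hx', hx⟩

/-- Close to its discontinuity `(1 - α) / β`, the map `T_{β,α}` has points `x < x'` with
`T x > T x'`, which can be chosen outside a countable set. -/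
lemma exists_inversion {β α : ℝ} (hβ : 1 < β) {B : Set ℝ} (hB : B.Countable)
    {p q : ℝ} (hp : p < (1 - α) / β) (hq : (1 - α) / β < q) :
    ∃ x ∈ Ioo p ((1 - α) / β), ∃ x' ∈ Ioo ((1 - α) / β) q, x ∉ B ∧ x' ∉ B ∧
      betaMap β α x' < betaMap β α x := by
  have h0 : (0 : ℝ) < β := by linarith
  set c := (1 - α) / β with hc
  have hcβ : β * c = 1 - α := by rw [hc]; field_simp
  have h2 : 0 < 1 / (2 * β) := by positivity
  have h3 : β * (1 / (2 * β)) = 1 / 2 := by field_simp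
  obtain ⟨x, hx, hxB⟩ := exists_mem_Ioo_notMem hB (max_lt hp (sub_lt_self c h2))
  obtain ⟨x', hx', hxB'⟩ := exists_mem_Ioo_notMem hB (lt_min hq (lt_add_of_pos_right c h2))
  have hx1 := mul_lt_mul_of_pos_left ((le_max_right _ _).trans_lt hx.1) h0
  have hx2 := mul_lt_mul_of_pos_left hx.2 h0
  have hx3 := mul_lt_mul_of_pos_left hx'.1 h0
  have hx4 := mul_lt_mul_of_pos_left (hx'.2.trans_le (min_le_right _ _)) h0
  rw [mul_sub] at hx1
  rw [mul_add] at hx4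
  have e1 := (betaMap_of_mem (β := β) (α := α) (x := x) 0
    (by push_cast; constructor <;> linarith)).2
  have e2 := (betaMap_of_mem (β := β) (α := α) (x := x') 1
    (by push_cast; constructor <;> linarith)).2
  refine ⟨x, ⟨(le_max_left _ _).trans_lt hx.1, hx.2⟩, x',
    ⟨hx'.1, hx'.2.trans_le (min_le_left _ _)⟩, hxB, hxB', ?_⟩
  rw [e1, e2]
  push_cast
  linarith

/-- An orientation-preserving conjugacy from `T_{β',α'}` to a survivor set that is matched with
`T_{β,α}` forces the kneading sequences of both intermediate maps to agree. Away from a countable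
set it preserves digits, because the discontinuity of `T_{β',α'}` is the only place where the map
fails to be increasing; the kneading sequences are limits of such itineraries. -/
lemma Matched.kneading_eq {β α b t β' α' : ℝ} (hm : Matched β α b t) (hβ' : 1 < β')
    (hα' : 0 ≤ α') (hs' : β' + α' ≤ 2)
    (h : IncTopConj (betaMap β' α') (Icc 0 1) (betaMap b 0) (survivorSet b t)) :
    rcode β' α' 0 = rcode β α 0 ∧ lcode β' α' 1 = lcode β α 1 := by
  obtain ⟨φ, C, hφ, hmono⟩ := h
  have h0 : 0 < β' := by linarith
  have hb0 : 0 < b := by linarith [hm.one_lt_base]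
  have hb2 : b + 0 ≤ 2 := by linarith [hm.base_lt_two]
  set c := (1 - α') / β' with hc
  have hcβ : β' * c = 1 - α' := by rw [hc]; field_simp
  have hc0 : 0 < c := by rw [hc]; apply div_pos _ h0; linarith
  have hc1 : c < 1 := by rw [hc, div_lt_one h0]; linarith
  -- the points whose orbits meet the exceptional set
  set B : Set ℝ := ⋃ n : ℕ, (betaMap β' α')^[n] ⁻¹' (C ∪ {0, 1}) with hB
  have hBc : B.Countable := countable_iUnion fun n =>
    countable_preimage_iterate h0.ne' α' (hφ.countable.union (Set.toFinite _).countable) n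
  have hCB : ∀ x, x ∉ B → x ∉ C := fun x hx hxC => hx (mem_iUnion.mpr ⟨0, Or.inl hxC⟩)
  have h0B : ∀ x, x ∉ B → x ≠ 0 := fun x hx hx0 =>
    hx (mem_iUnion.mpr ⟨0, Or.inr (Or.inl hx0)⟩)
  have h1B : ∀ x, x ∉ B → x ≠ 1 := fun x hx hx0 =>
    hx (mem_iUnion.mpr ⟨0, Or.inr (Or.inr hx0)⟩)
  have hTB : ∀ x, x ∉ B → betaMap β' α' x ∉ B := fun x hx hTx => by
    obtain ⟨n, hn⟩ := mem_iUnion.mp hTx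
    exact hx (mem_iUnion.mpr ⟨n + 1, hn⟩)
  have hGI : ∀ x ∈ Icc (0 : ℝ) 1, x ∉ B → x ∈ Ioo (0 : ℝ) 1 := fun x hx hxB =>
    ⟨lt_of_le_of_ne hx.1 (h0B x hxB).symm, lt_of_le_of_ne hx.2 (h1B x hxB)⟩
  have hφmono : ∀ x ∈ Icc (0 : ℝ) 1, x ∉ B → ∀ x' ∈ Icc (0 : ℝ) 1, x' ∉ B → x < x' →
      φ x < φ x' := fun x hx hxB x' hx' hxB' hlt =>
    hmono ⟨hx, hCB x hxB⟩ ⟨hx', hCB x' hxB'⟩ hlt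
  have hφK : ∀ x ∈ Icc (0 : ℝ) 1, φ x ∈ survivorSet b t := fun x hx =>
    hφ.image_eq ▸ mem_image_of_mem φ hx
  have hTI : ∀ x, betaMap β' α' x ∈ Icc (0 : ℝ) 1 := fun x =>
    Ico_subset_Icc_self (betaMap_mem _ _ _)
  have hsemi : ∀ x ∈ Icc (0 : ℝ) 1, x ∉ B → φ (betaMap β' α' x) = betaMap b 0 (φ x) :=
    fun x hx hxB => hφ.semiconj_off x ⟨hx, hCB x hxB⟩
  have hdig : ∀ x ∈ Icc (0 : ℝ) 1, ⌊b * φ x + 0⌋ = 0 ∨ ⌊b * φ x + 0⌋ = 1 := fun x hx =>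
    floor_digit hb0 le_rfl hb2 (hφK x hx).1
  have hfl : ∀ x x', φ x < φ x' → ⌊b * φ x + 0⌋ ≤ ⌊b * φ x' + 0⌋ := fun x x' hlt => by
    apply Int.floor_le_floor; gcongr
  have hinv : ∀ p q, 0 ≤ p → q ≤ 1 → p < c → c < q → ∃ x ∈ Ioo p c, ∃ x' ∈ Ioo c q,
      x ∉ B ∧ x' ∉ B ∧ ⌊b * φ x + 0⌋ = 0 ∧ ⌊b * φ x' + 0⌋ = 1 := by
    intro p q hp0 hq1 hp hq
    obtain ⟨x, hx, x', hx', hxB, hxB', hlt⟩ := exists_inversion hβ' hBc hp hq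
    have hxI : x ∈ Icc (0 : ℝ) 1 := ⟨hp0.trans hx.1.le, (hx.2.trans hc1).le⟩
    have hxI' : x' ∈ Icc (0 : ℝ) 1 := ⟨(hc0.trans hx'.1).le, hx'.2.le.trans hq1⟩
    have h1 := hφmono x hxI hxB x' hxI' hxB' (hx.2.trans hx'.1)
    have h2 := hφmono _ (hTI x') (hTB x' hxB') _ (hTI x) (hTB x hxB) hlt
    rw [hsemi x hxI hxB, hsemi x' hxI' hxB', betaMap_eq, betaMap_eq] at h2
    have h3 := mul_lt_mul_of_pos_left h1 hb0
    refine ⟨x, hx, x', hx', hxB, hxB', ?_⟩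
    have h4 := hfl x x' h1
    have h5 : ⌊b * φ x + 0⌋ ≠ ⌊b * φ x' + 0⌋ := fun he => by
      rw [he] at h2; linarith
    rcases hdig x hxI with h | h <;> rcases hdig x' hxI' with h' | h' <;> omega
  have hdigit : ∀ x ∈ Icc (0 : ℝ) 1, x ∉ B → ⌊β' * x + α'⌋ = ⌊b * φ x + 0⌋ := by
    intro x hx hxB
    obtain ⟨hx0, hx1⟩ := hGI x hx hxB
    rcases lt_trichotomy x c with hlt | heq | hgt
    · obtain ⟨z, hz, -, -, hzB, -, hz0, -⟩ := hinv x 1 hx.1 le_rfl hlt hc1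
      have h1 := hfl x z (hφmono x hx hxB z ⟨hx.1.trans hz.1.le, (hz.2.trans hc1).le⟩ hzB hz.1)
      have h2 := mul_lt_mul_of_pos_left hlt h0
      have h3 := mul_pos h0 hx0
      have h4 := (betaMap_of_mem (β := β') (α := α') (x := x) 0
        (by push_cast; constructor <;> linarith)).1
      rcases hdig x hx with h | h <;> omega
    · -- the discontinuity itself is sent to `0`, which is exceptional
      exfalso
      have h4 := (betaMap_of_mem (β := β') (α := α') (x := x) 1
        (by rw [heq, hcβ]; push_cast; constructor <;> linarith)).2
      refine h0B _ (hTB x hxB) ?_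
      rw [h4, heq, hcβ]; push_cast; ring
    · obtain ⟨-, -, z, hz, -, hzB, -, hz1⟩ := hinv 0 x le_rfl hx.2 hc0 hgt
      have h1 := hfl z x (hφmono z ⟨(hc0.trans hz.1).le, hz.2.le.trans hx.2⟩ hzB x hx hxB hz.2)
      have h2 := mul_lt_mul_of_pos_left hgt h0
      have h3 := mul_lt_mul_of_pos_left hx1 h0
      have h4 := (betaMap_of_mem (β := β') (α := α') (x := x) 1
        (by push_cast; constructor <;> linarith)).1
      rcases hdig x hx with h | h <;> omega
  have hiter : ∀ n, ∀ x ∈ Icc (0 : ℝ) 1, x ∉ B →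
      (betaMap β' α')^[n] x ∈ Icc (0 : ℝ) 1 ∧ (betaMap β' α')^[n] x ∉ B ∧
        φ ((betaMap β' α')^[n] x) = (betaMap b 0)^[n] (φ x) := by
    intro n
    induction n with
    | zero => exact fun x hx hxB => ⟨hx, hxB, rfl⟩
    | succ n ih =>
      intro x hx hxB
      rw [Function.iterate_succ_apply, Function.iterate_succ_apply, ← hsemi x hx hxB]
      exact ih _ (hTI x) (hTB x hxB)
  have hcode : ∀ x ∈ Icc (0 : ℝ) 1, x ∉ B → rcode β' α' x = rcode b 0 (φ x) := by
    intro x hx hxB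
    funext n
    obtain ⟨h1, h2, h3⟩ := hiter n x hx hxB
    simp only [rcode]
    rw [← h3, hdigit _ h1 h2]
  -- the composition with the inverse of the exact conjugacy
  set g : ℝ → ℝ := fun x => seqVal β α (rcode b 0 (φ x)) with hg
  set f : ℝ → ℝ := fun x => seqVal b 0 (rcode β α x) with hf
  have hgI : ∀ x ∈ Icc (0 : ℝ) 1, g x ∈ Ico (0 : ℝ) 1 := fun x hx =>
    hm.seqVal_greedy_mem (hφK x hx)
  have hgcode : ∀ x ∈ Icc (0 : ℝ) 1, x ∉ B → rcode β' α' x = rcode β α (g x) :=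
    fun x hx hxB => by
      rw [hcode x hx hxB]; exact (hm.rcode_seqVal_greedy (hφK x hx)).symm
  have hfg : ∀ x ∈ Icc (0 : ℝ) 1, f (g x) = φ x := fun x hx =>
    hm.seqVal_rcode_seqVal (hφK x hx)
  have hgmono : ∀ x ∈ Icc (0 : ℝ) 1, x ∉ B → ∀ x' ∈ Icc (0 : ℝ) 1, x' ∉ B → x < x' →
      g x < g x' := fun x hx hxB x' hx' hxB' hlt => by
    rw [← hm.strictMonoOn.lt_iff_lt (hgI x hx) (hgI x' hx')]
    have := hφmono x hx hxB x' hx' hxB' hlt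
    rwa [← hfg x hx, ← hfg x' hx'] at this
  have hgdense : ∀ p q, 0 ≤ p → q ≤ 1 → p < q → ∃ x ∈ Icc (0 : ℝ) 1, x ∉ B ∧ g x ∈ Ioo p q := by
    intro p q hp hq hpq
    have hbad : (Ico (0 : ℝ) 1 ∩ f ⁻¹' (φ '' B)).Countable :=
      MapsTo.countable_of_injOn (f := f) (t := φ '' B) (fun z hz => hz.2)
        (hm.strictMonoOn.injOn.mono inter_subset_left) (hBc.image φ)
    obtain ⟨z, hz, hzbad⟩ := exists_mem_Ioo_notMem hbad hpq
    have hzI : z ∈ Ico (0 : ℝ) 1 := ⟨hp.trans hz.1.le, hz.2.trans_le hq⟩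
    have hfz : f z ∈ φ '' Icc 0 1 := hφ.image_eq ▸ hm.seqVal_rcode_mem_survivorSet hzI
    obtain ⟨x, hx, hxz⟩ := hfz
    refine ⟨x, hx, fun hxB => hzbad ⟨hzI, x, hxB, hxz⟩, ?_⟩
    have : g x = z := by
      have h1 : g x = seqVal β α (rcode b 0 (f z)) := by rw [hg, ← hxz]
      rw [h1, hf]
      simp only
      rw [hm.rcode_seqVal_rcode hzI, seqVal_rcode hm.one_lt hm.nonneg hm.lt_two.le hzI]
    rwa [this]
  have hβ0 : 0 < β := by linarith [hm.one_lt]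
  constructor
  · funext n
    obtain ⟨r, hr, hr'⟩ := mem_nhdsGE_iff_exists_Ico_subset.mp (eventually_rcode_right h0 α' 0 n)
    obtain ⟨u, hu, hu'⟩ := mem_nhdsGE_iff_exists_Ico_subset.mp (eventually_rcode_right hβ0 α 0 n)
    have hr0 : (0 : ℝ) < r := hr
    have hu0 : (0 : ℝ) < u := hu
    obtain ⟨x₀, hx₀, hx₀B, hgx₀⟩ := hgdense 0 (min u 1) le_rfl (min_le_right _ _)
      (lt_min hu0 one_pos)
    obtain ⟨x, hx, hxB⟩ := exists_mem_Ioo_notMem hBc (lt_min (hGI x₀ hx₀ hx₀B).1 hr0)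
    have hxx₀ := hx.2.trans_le (min_le_left _ _)
    have hxI : x ∈ Icc (0 : ℝ) 1 := ⟨hx.1.le, hxx₀.le.trans hx₀.2⟩
    have h1 : rcode β' α' x n = rcode β' α' 0 n :=
      hr' ⟨hx.1.le, hx.2.trans_le (min_le_right _ _)⟩
    have h2 : rcode β α (g x) n = rcode β α 0 n :=
      hu' ⟨(hgI x hxI).1, (hgmono x hxI hxB x₀ hx₀ hx₀B hxx₀).trans
        (hgx₀.2.trans_le (min_le_left _ _))⟩
    rw [← h1, ← h2, hgcode x hxI hxB]
  · funext n
    obtain ⟨r, hr, hr'⟩ := mem_nhdsLT_iff_exists_Ioo_subset.mp (eventually_rcode_left h0 α' 1 n)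
    obtain ⟨u, hu, hu'⟩ := mem_nhdsLT_iff_exists_Ioo_subset.mp (eventually_rcode_left hβ0 α 1 n)
    have hr0 : r < (1 : ℝ) := hr
    have hu0 : u < (1 : ℝ) := hu
    obtain ⟨x₀, hx₀, hx₀B, hgx₀⟩ := hgdense (max u 0) 1 (le_max_right _ _) le_rfl
      (max_lt hu0 one_pos)
    obtain ⟨x, hx, hxB⟩ := exists_mem_Ioo_notMem hBc (max_lt (hGI x₀ hx₀ hx₀B).2 hr0)
    have hxx₀ := (le_max_left _ _).trans_lt hx.1
    have hxI : x ∈ Icc (0 : ℝ) 1 := ⟨hx₀.1.trans hxx₀.le, hx.2.le⟩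
    have h1 : rcode β' α' x n = lcode β' α' 1 n :=
      hr' ⟨(le_max_right _ _).trans_lt hx.1, hx.2⟩
    have h2 : rcode β α (g x) n = lcode β α 1 n :=
      hu' ⟨((le_max_left _ _).trans_lt hgx₀.1).trans
        (hgmono x₀ hx₀ hx₀B x hxI hxB hxx₀), (hgI x hxI).2⟩
    rw [← h1, ← h2, hgcode x hxI hxB]

/-! ### An obstruction to being conjugate to an intermediate map -/

open MeasureTheory in
/-- Where it is injective, `T_{β,α}` multiplies Lebesgue measure by `β`. -/
lemma volume_image_betaMap {β : ℝ} (hβ : 0 < β) (α : ℝ) {V : Set ℝ} (hV : MeasurableSet V)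
    (hinj : InjOn (betaMap β α) V) :
    MeasurableSet (betaMap β α '' V) ∧
      volume (betaMap β α '' V) = ENNReal.ofReal β * volume V := by
  set P : ℤ → Set ℝ := fun k => V ∩ (fun x => ⌊β * x + α⌋) ⁻¹' {k} with hP
  have hmeas : ∀ k, MeasurableSet (P k) := fun k =>
    hV.inter ((Int.measurable_floor.comp (by fun_prop)) (measurableSet_singleton k))
  have hPu : V = ⋃ k, P k := by
    ext x; simp [hP]
  have hPd : Pairwise (Function.onFun Disjoint P) := fun i j hij =>
    disjoint_left.mpr fun x hx hx' => hij (hx.2.symm.trans hx'.2)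
  have himg : ∀ k, betaMap β α '' P k = (fun x => x + (α - k)) '' ((fun x => β * x) '' P k) := by
    intro k
    rw [image_image]
    refine image_congr fun x hx => ?_
    rw [betaMap_eq, show ⌊β * x + α⌋ = k from hx.2]
    ring
  have hm1 : ∀ k, MeasurableSet (betaMap β α '' P k) := fun k => by
    rw [himg]
    have h1 : MeasurableSet ((fun x => β * x) '' P k) :=
      (measurableEmbedding_mulLeft₀ hβ.ne').measurableSet_image.mpr (hmeas k)
    exact (measurableEmbedding_addRight (α - k)).measurableSet_image.mpr h1
  have hv1 : ∀ k, volume (betaMap β α '' P k) = ENNReal.ofReal β * volume (P k) := fun k => by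
    rw [himg, image_add_right, measure_preimage_add_right]
    have := Measure.addHaar_smul (volume : Measure ℝ) β (P k)
    rw [Module.finrank_self, pow_one, abs_of_pos hβ] at this
    exact this
  have hd1 : Pairwise (Function.onFun Disjoint fun k => betaMap β α '' P k) := fun i j hij => by
    refine disjoint_left.mpr ?_
    rintro _ ⟨x, hx, rfl⟩ ⟨x', hx', he⟩
    have := hinj hx'.1 hx.1 he
    subst this
    exact hij (hx.2.symm.trans hx'.2)
  have hu : betaMap β α '' V = ⋃ k, betaMap β α '' P k := by
    conv_lhs => rw [hPu]
    exact image_iUnion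
  rw [hu]
  refine ⟨MeasurableSet.iUnion hm1, ?_⟩
  rw [measure_iUnion hd1 hm1]
  simp_rw [hv1]
  rw [ENNReal.tsum_mul_left, ← measure_iUnion hPd hmeas, ← hPu]

open MeasureTheory in
lemma volume_image_iterate {β : ℝ} (hβ : 0 < β) (α : ℝ) {V : Set ℝ} (hV : MeasurableSet V)
    (n : ℕ) (hinj : InjOn (betaMap β α)^[n] V) :
    MeasurableSet ((betaMap β α)^[n] '' V) ∧
      volume ((betaMap β α)^[n] '' V) = ENNReal.ofReal β ^ n * volume V := by
  induction n with
  | zero => simpa using hV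
  | succ n ih =>
    rw [Function.iterate_succ'] at hinj ⊢
    have h1 : InjOn (betaMap β α)^[n] V := fun x hx y hy he =>
      hinj hx hy (congrArg (betaMap β α) he)
    obtain ⟨h2, h3⟩ := ih h1
    have h4 : InjOn (betaMap β α) ((betaMap β α)^[n] '' V) := by
      rintro _ ⟨x, hx, rfl⟩ _ ⟨y, hy, rfl⟩ he
      rw [hinj hx hy he]
    obtain ⟨h5, h6⟩ := volume_image_betaMap hβ α h2 h4
    rw [image_comp]
    refine ⟨h5, ?_⟩
    rw [h6, h3, pow_succ']
    exact (mul_assoc _ _ _).symm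

/-- A conjugacy from `(T, X)` to `(S, Y)` outside countable sets `C` and `D`, with inverse `ψ`.
It is the part common to conjugacies in both directions. -/
structure PartialConj (T : ℝ → ℝ) (X : Set ℝ) (S : ℝ → ℝ) (Y : Set ℝ)
    (φ ψ : ℝ → ℝ) (C D : Set ℝ) : Prop where
  countable_left : C.Countable
  countable_right : D.Countable
  mapsTo : ∀ x ∈ X \ C, φ x ∈ Y \ D
  mapsTo_inv : ∀ y ∈ Y \ D, ψ y ∈ X \ C
  left_inv : ∀ x ∈ X \ C, ψ (φ x) = x
  right_inv : ∀ y ∈ Y \ D, φ (ψ y) = y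
  continuousOn : ContinuousOn φ (X \ C)
  semiconj : ∀ x ∈ X \ C, T x ∉ C → φ (T x) = S (φ x)

lemma _root_.IsConjugacyOff.injOn {T S φ : ℝ → ℝ} {X Y C : Set ℝ} (h : IsConjugacyOff T X S Y φ C) :
    InjOn φ (X \ C) := fun x hx y hy he => h.injective_off y hy x hx.1 he

lemma _root_.IsConjugacyOff.mem {T S φ : ℝ → ℝ} {X Y C : Set ℝ} (h : IsConjugacyOff T X S Y φ C)
    {x : ℝ} (hx : x ∈ X \ C) : φ x ∈ Y \ φ '' (X ∩ C) := by
  refine ⟨h.image_eq ▸ mem_image_of_mem φ hx.1, ?_⟩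
  rintro ⟨x', hx', he⟩
  have := h.injective_off x hx x' hx'.1 he
  exact hx.2 (this ▸ hx'.2)

lemma _root_.IsConjugacyOff.exists_of_mem {T S φ : ℝ → ℝ} {X Y C : Set ℝ}
    (h : IsConjugacyOff T X S Y φ C) {y : ℝ} (hy : y ∈ Y \ φ '' (X ∩ C)) :
    ∃ x ∈ X \ C, φ x = y := by
  obtain ⟨hy1, hy2⟩ := hy
  rw [← h.image_eq] at hy1
  obtain ⟨x, hx, rfl⟩ := hy1
  exact ⟨x, ⟨hx, fun hxC => hy2 ⟨x, ⟨hx, hxC⟩, rfl⟩⟩, rfl⟩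

lemma _root_.IsConjugacyOff.partialConj {T S φ : ℝ → ℝ} {X Y C : Set ℝ}
    (h : IsConjugacyOff T X S Y φ C) :
    PartialConj T X S Y φ (Function.invFunOn φ (X \ C)) C (φ '' (X ∩ C)) where
  countable_left := h.countable
  countable_right := (h.countable.mono inter_subset_right).image φ
  mapsTo _ hx := h.mem hx
  mapsTo_inv _ hy := Function.invFunOn_mem (h.exists_of_mem hy)
  left_inv _ hx := h.injOn.leftInvOn_invFunOn hx
  right_inv _ hy := Function.invFunOn_eq (h.exists_of_mem hy)
  continuousOn := continuousOn_iff_continuous_domRestrict.mpr h.isEmbedding_off.continuous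
  semiconj x hx _ := h.semiconj_off x hx

lemma _root_.IsConjugacyOff.partialConj_symm {T S φ : ℝ → ℝ} {X Y C : Set ℝ}
    (h : IsConjugacyOff S Y T X φ C) (hS : ∀ y ∈ Y, S y ∈ Y) :
    PartialConj T X S Y (Function.invFunOn φ (Y \ C)) φ (φ '' (Y ∩ C)) C where
  countable_left := (h.countable.mono inter_subset_right).image φ
  countable_right := h.countable
  mapsTo _ hx := Function.invFunOn_mem (h.exists_of_mem hx)
  mapsTo_inv _ hy := h.mem hy
  left_inv _ hx := Function.invFunOn_eq (h.exists_of_mem hx)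
  right_inv _ hy := h.injOn.leftInvOn_invFunOn hy
  continuousOn := by
    rw [continuousOn_iff_continuous_domRestrict]
    have h1 : ∀ x : ↥(X \ φ '' (Y ∩ C)), Function.invFunOn φ (Y \ C) x ∈ Y \ C := fun x =>
      Function.invFunOn_mem (h.exists_of_mem x.2)
    have h2 : Continuous fun x : ↥(X \ φ '' (Y ∩ C)) =>
        (⟨Function.invFunOn φ (Y \ C) x, h1 x⟩ : ↥(Y \ C)) := by
      rw [h.isEmbedding_off.continuous_iff]
      have : (Y \ C).domRestrict φ ∘ (fun x : ↥(X \ φ '' (Y ∩ C)) =>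
          (⟨Function.invFunOn φ (Y \ C) x, h1 x⟩ : ↥(Y \ C))) = Subtype.val :=
        funext fun x => Function.invFunOn_eq (h.exists_of_mem x.2)
      rw [this]
      exact continuous_subtype_val
    exact continuous_subtype_val.comp h2
  semiconj x hx hTx := by
    have hy : Function.invFunOn φ (Y \ C) x ∈ Y \ C := Function.invFunOn_mem (h.exists_of_mem hx)
    have hyx : φ (Function.invFunOn φ (Y \ C) x) = x :=
      Function.invFunOn_eq (h.exists_of_mem hx)
    set y := Function.invFunOn φ (Y \ C) x
    have h1 := h.semiconj_off y hy
    rw [hyx] at h1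
    have h2 : S y ∈ Y \ C := ⟨hS y hy.1, fun hc => hTx ⟨S y, ⟨hS y hy.1, hc⟩, h1⟩⟩
    rw [← h1]
    exact h.injOn.leftInvOn_invFunOn h2

open MeasureTheory in
/-- A system with an uncountable relatively open piece which an iterate `S^p` maps injectively
into itself, up to countably many points, is not conjugate to an intermediate map: the piece would
correspond to an open set on which `T_{β,α}^p` is injective almost everywhere, while it multiplies
Lebesgue measure by `β ^ p`. -/
lemma PartialConj.false_of_injOn {β α : ℝ} (hβ : 1 < β) {S : ℝ → ℝ} {Y : Set ℝ} {φ ψ : ℝ → ℝ}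
    {C D : Set ℝ} (h : PartialConj (betaMap β α) (Icc 0 1) S Y φ ψ C D) {O N : Set ℝ}
    (hO : IsOpen O) (hN : N.Countable) (hunc : ¬ (Y ∩ O).Countable) {p : ℕ} (hp : p ≠ 0)
    (hinv : ∀ y ∈ Y ∩ O, y ∉ N → S^[p] y ∈ O) (hinj : InjOn S^[p] (Y ∩ O)) : False := by
  have h0 : 0 < β := by linarith
  obtain ⟨W, hW, hWeq⟩ := (continuousOn_iff'.mp h.continuousOn) O hO
  set E : Set ℝ := (⋃ n : ℕ, (betaMap β α)^[n] ⁻¹' C) ∪ ψ '' N with hE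
  have hEc : E.Countable := (countable_iUnion fun n =>
    countable_preimage_iterate h0.ne' α h.countable_left n).union (hN.image ψ)
  set V : Set ℝ := (W ∩ Icc 0 1) \ E with hV
  have hVm : MeasurableSet V := (hW.measurableSet.inter measurableSet_Icc).diff hEc.measurableSet
  have hvol : volume V = volume (W ∩ Icc 0 1) := measure_sdiff_null (hEc.measure_zero _)
  have hiter : ∀ n, ∀ x ∈ V, (betaMap β α)^[n] x ∈ Icc (0 : ℝ) 1 \ C ∧
      φ ((betaMap β α)^[n] x) = S^[n] (φ x) := by
    intro n x hx
    have hnC : ∀ n, (betaMap β α)^[n] x ∉ C := fun n hn =>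
      hx.2 (Or.inl (mem_iUnion.mpr ⟨n, hn⟩))
    induction n with
    | zero => exact ⟨⟨hx.1.2, hnC 0⟩, rfl⟩
    | succ n ih =>
      have h1 := hnC (n + 1)
      rw [Function.iterate_succ_apply'] at h1 ⊢
      refine ⟨⟨Ico_subset_Icc_self (betaMap_mem _ _ _), h1⟩, ?_⟩
      rw [Function.iterate_succ_apply', h.semiconj _ ih.1 h1, ih.2]
  have hVO : ∀ x ∈ V, φ x ∈ Y ∩ O := fun x hx => by
    have h1 := (hiter 0 x hx).1
    have h2 : x ∈ φ ⁻¹' O ∩ (Icc 0 1 \ C) := by rw [hWeq]; exact ⟨hx.1.1, h1⟩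
    exact ⟨(h.mapsTo x h1).1, h2.1⟩
  have hinjV : InjOn (betaMap β α)^[p] V := fun x hx y hy he => by
    have h1 := (hiter p x hx).2
    rw [he, (hiter p y hy).2] at h1
    have h2 := hinj (hVO x hx) (hVO y hy) h1.symm
    rw [← h.left_inv x (hiter 0 x hx).1, ← h.left_inv y (hiter 0 y hy).1, h2]
  have hmaps : (betaMap β α)^[p] '' V ⊆ W ∩ Icc 0 1 := by
    rintro _ ⟨x, hx, rfl⟩
    obtain ⟨h1, h2⟩ := hiter p x hx
    have hxN : φ x ∉ N := fun hn => hx.2 (Or.inr ⟨φ x, hn, h.left_inv x (hiter 0 x hx).1⟩)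
    have h3 : (betaMap β α)^[p] x ∈ φ ⁻¹' O ∩ (Icc 0 1 \ C) :=
      ⟨by rw [mem_preimage, h2]; exact hinv _ (hVO x hx) hxN, h1⟩
    rw [hWeq] at h3
    exact ⟨h3.1, h1.1⟩
  have hpos : 0 < volume (W ∩ Icc (0 : ℝ) 1) := by
    obtain ⟨y, hy, hyD⟩ : ∃ y ∈ Y ∩ O, y ∉ D := by
      by_contra! hall
      exact hunc (h.countable_right.mono hall)
    have h1 := h.mapsTo_inv y ⟨hy.1, hyD⟩
    have h2 : ψ y ∈ φ ⁻¹' O ∩ (Icc 0 1 \ C) :=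
      ⟨by rw [mem_preimage, h.right_inv y ⟨hy.1, hyD⟩]; exact hy.2, h1⟩
    rw [hWeq] at h2
    have h3 : ψ y ∈ closure (Ioo (0 : ℝ) 1) := by
      rw [closure_Ioo zero_ne_one]; exact h1.1
    obtain ⟨z, hzW, hz⟩ := mem_closure_iff.mp h3 W hW h2.1
    exact ((hW.inter isOpen_Ioo).measure_pos volume ⟨z, hzW, hz⟩).trans_le
      (measure_mono (inter_subset_inter_right _ Ioo_subset_Icc_self))
  have hfin : volume (W ∩ Icc (0 : ℝ) 1) ≠ ⊤ :=
    ((measure_mono inter_subset_right).trans_lt measure_Icc_lt_top).ne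
  have hle := measure_mono (μ := volume) hmaps
  rw [(volume_image_iterate h0 α hVm p hinjV).2, hvol] at hle
  have hone : 1 < ENNReal.ofReal β ^ p :=
    one_lt_pow₀ (ENNReal.one_lt_ofReal.mpr hβ) hp
  have := ENNReal.mul_lt_mul_left hpos.ne' hfin hone
  rw [one_mul] at this
  exact absurd hle this.not_ge

/-! ### Itineraries under an irrational rotation -/

lemma iterate_betaMap_one (θ x : ℝ) (hx : x ∈ Ico (0 : ℝ) 1) (n : ℕ) :
    (betaMap 1 θ)^[n] x = Int.fract (x + n * θ) := by
  induction n with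
  | zero => simp [Int.fract_eq_self.mpr hx]
  | succ n ih =>
    rw [Function.iterate_succ_apply', ih, betaMap]
    have : 1 * Int.fract (x + n * θ) + θ = x + (n + 1 : ℕ) * θ - (⌊x + n * θ⌋ : ℤ) := by
      rw [Int.fract]; push_cast; ring
    rw [this, Int.fract_sub_intCast]

/-- The forward orbits of an irrational rotation enter every interval `(1 - ε, 1)`. -/
lemma exists_fract_gt {θ : ℝ} (hθ : Irrational θ) {x ε : ℝ} (hε : 0 < ε) (hε1 : ε ≤ 1) :
    ∃ n : ℕ, 1 - ε < Int.fract (x + n * θ) := by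
  have hd : DenseRange (· • (θ : AddCircle (1 : ℝ)) : ℕ → AddCircle (1 : ℝ)) := by
    rw [← denseRange_zsmul_iff_nsmul, AddCircle.denseRange_zsmul_coe_iff, div_one]
    exact hθ
  have hO : IsOpen ((fun r : ℝ => (r : AddCircle (1 : ℝ))) '' Ioo (1 - ε - x) (1 - x)) :=
    QuotientAddGroup.isOpenMap_coe _ isOpen_Ioo
  obtain ⟨n, hn⟩ := hd.exists_mem_open hO
    ((nonempty_Ioo.mpr (by linarith : 1 - ε - x < 1 - x)).image _)
  obtain ⟨r, hr, hrn⟩ := hn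
  have h1 : ((r : ℝ) : AddCircle (1 : ℝ)) = ((n * θ : ℝ) : AddCircle (1 : ℝ)) := by
    rw [show ((r : ℝ) : AddCircle (1 : ℝ)) = n • (θ : AddCircle (1 : ℝ)) from hrn,
      ← AddCircle.coe_nsmul, nsmul_eq_mul]
  rw [QuotientAddGroup.eq] at h1
  obtain ⟨k, hk⟩ := AddSubgroup.mem_zmultiples_iff.mp h1
  refine ⟨n, ?_⟩
  have h2 : x + n * θ = x + r + (k : ℤ) := by
    rw [zsmul_eq_mul, mul_one] at hk
    linarith
  rw [h2, Int.fract_add_intCast, Int.fract_eq_self.mpr]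
  · linarith [hr.1]
  · constructor <;> linarith [hr.1, hr.2]

/-- Under an irrational rotation, itineraries are strictly increasing. -/
lemma rotation_lex {θ : ℝ} (hθ : Irrational θ) (hθ0 : 0 ≤ θ) (hθ1 : θ ≤ 1) {x y : ℝ}
    (hx : x ∈ Ico (0 : ℝ) 1) (hy : y ∈ Ico (0 : ℝ) 1) (hxy : x < y) :
    LexLT (rcode 1 θ x) (rcode 1 θ y) := by
  have hbx : IsBinary (rcode 1 θ x) := rcode_binary one_pos hθ0 (by linarith) hx
  have hby : IsBinary (rcode 1 θ y) := rcode_binary one_pos hθ0 (by linarith) hy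
  have hdiff : ∀ n, (∀ k < n, rcode 1 θ x k = rcode 1 θ y k) →
      (betaMap 1 θ)^[n] y - (betaMap 1 θ)^[n] x = y - x := by
    intro n
    induction n with
    | zero => intro _; rfl
    | succ n ih =>
      intro h
      have h1 := ih fun k hk => h k (by omega)
      have h2 := h n (by omega)
      simp only [rcode] at h2
      rw [Function.iterate_succ_apply', Function.iterate_succ_apply', betaMap_eq, betaMap_eq, h2]
      linarith
  rcases lex_trichotomy hbx hby with he | hl | ⟨n, hag, hn, hn'⟩
  · exfalso
    obtain ⟨n, hn⟩ := exists_fract_gt (x := x) hθ (sub_pos.mpr hxy) (by linarith [hx.1, hy.2])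
    rw [← iterate_betaMap_one θ x hx n] at hn
    have h1 := hdiff n fun k _ => by rw [he]
    have h2 := (iterate_betaMap_mem (β := 1) (α := θ) hy n).2
    linarith
  · exact hl
  · exfalso
    have h1 := hdiff n fun k hk => (hag k hk).symm
    have h2 : ⌊1 * (betaMap 1 θ)^[n] x + θ⌋ ≤ ⌊1 * (betaMap 1 θ)^[n] y + θ⌋ :=
      Int.floor_le_floor (by linarith)
    have h3 : (⌊1 * (betaMap 1 θ)^[n] x + θ⌋ : ℝ) ≤ ⌊1 * (betaMap 1 θ)^[n] y + θ⌋ := by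
      exact_mod_cast h2
    simp only [rcode] at hn hn'
    rw [hn, hn'] at h3
    norm_num at h3

/-! ### Values of concatenations of two blocks -/

/-- The value `∑ v(ωₙ) / B ^ n` with `v(0) = u` and `v(1) = v`: for `B = β ^ p` this is the value
in base `β` of a concatenation of two words of length `p` with values `u` and `v`. -/
noncomputable def blockVal (B u v : ℝ) (ω : ℕ → ℝ) : ℝ :=
  u * B / (B - 1) + (v - u) * B * seqVal B 0 ω

lemma blockVal_succ {B : ℝ} (hB : 1 < B) (u v : ℝ) {ω : ℕ → ℝ} (h : IsBinary ω) :
    blockVal B u v ω = u + (v - u) * ω 0 + blockVal B u v (seqShift 1 ω) / B := by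
  have h1 : B - 1 ≠ 0 := by linarith
  have h0 : B ≠ 0 := by linarith
  rw [blockVal, blockVal, seqVal_succ hB 0 h]
  field_simp
  ring

lemma seqVal_zero_le {B : ℝ} (hB : 1 < B) {ω : ℕ → ℝ} (h : IsBinary ω) :
    seqVal B 0 ω ≤ 1 / (B - 1) := by
  have := (le_abs_self _).trans (abs_seqVal_le hB 0 h)
  simpa using this

lemma blockVal_lt_of_lex {B u v : ℝ} (hB : 2 < B) (huv : u < v) {ω ω' : ℕ → ℝ} (h : IsBinary ω)
    (h' : IsBinary ω') (hlt : LexLT ω ω') : blockVal B u v ω < blockVal B u v ω' := by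
  have hB1 : 1 < B := by linarith
  have h1 := seqVal_lt_of_lex hB1 0 h h' (fun n => ?_)
    (fun n => seqVal_zero_nonneg hB1 (h'.shift n)) hlt
  · have : 0 < (v - u) * B := mul_pos (sub_pos.mpr huv) (by linarith)
    have := mul_lt_mul_of_pos_left h1 this
    unfold blockVal
    linarith
  · refine (seqVal_zero_le hB1 (h.shift n)).trans_lt ?_
    rw [div_lt_one] <;> linarith

lemma blockVal_mem {B u v : ℝ} (hB : 1 < B) (huv : u ≤ v) {ω : ℕ → ℝ} (h : IsBinary ω) :
    blockVal B u v ω ∈ Icc (u * B / (B - 1)) (v * B / (B - 1)) := by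
  have h1 := seqVal_zero_nonneg hB h
  have h2 := seqVal_zero_le hB h
  have h3 : 0 ≤ (v - u) * B := mul_nonneg (by linarith) (by linarith)
  have h4 := mul_le_mul_of_nonneg_left h2 h3
  have h5 := mul_nonneg h3 h1
  have h6 : v * B / (B - 1) = u * B / (B - 1) + (v - u) * B * (1 / (B - 1)) := by ring
  unfold blockVal
  constructor <;> linarith

/-! ### Survivor sets -/

lemma betaMap_mem_survivorSet {b t y : ℝ} (hy : y ∈ survivorSet b t) :
    betaMap b 0 y ∈ survivorSet b t :=
  Matched.iterate_mem_survivorSet hy 1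

/-- A set whose points stay above `t` until they return to it consists of surviving points. -/
lemma subset_survivorSet_of_return {b t : ℝ} {A : Set ℝ} {p : ℕ} (hp : 0 < p)
    (hA : ∀ a ∈ A, a ∈ Ico (0 : ℝ) 1 ∧ (∀ j < p, t ≤ (betaMap b 0)^[j] a) ∧
      (betaMap b 0)^[p] a ∈ A) : A ⊆ survivorSet b t := by
  have hit : ∀ q, ∀ a ∈ A, (betaMap b 0)^[p * q] a ∈ A := by
    intro q
    induction q with
    | zero => exact fun a ha => ha
    | succ q ih =>
      intro a ha
      rw [Nat.mul_succ, Function.iterate_add_apply]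
      exact ih _ (hA a ha).2.2
  refine fun a ha => ⟨(hA a ha).1, fun n hn => ?_⟩
  have h1 := (hA _ (hit (n / p) a ha)).2.1 (n % p) (Nat.mod_lt _ hp)
  rw [← Function.iterate_add_apply, Nat.mod_add_div] at h1
  exact absurd hn.2 h1.not_gt

/-- A subset of the line which is parametrized by `[0, 1)` so that distances are at least a
multiple of the squared distances of parameters has positive dimension. -/
lemma dimH_pos_of_sq_le {P : ℝ → ℝ} {κ : ℝ} (hκ : 0 < κ)
    (h : ∀ x ∈ Ico (0 : ℝ) 1, ∀ y ∈ Ico (0 : ℝ) 1, x < y → κ * (y - x) ^ 2 ≤ P y - P x) :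
    0 < dimH (P '' Ico 0 1) := by
  have habs : ∀ x ∈ Ico (0 : ℝ) 1, ∀ y ∈ Ico (0 : ℝ) 1, κ * (x - y) ^ 2 ≤ |P x - P y| := by
    intro x hx y hy
    rcases lt_trichotomy x y with hlt | rfl | hlt
    · rw [abs_sub_comm, ← neg_sub, neg_sq]; exact (h x hx y hy hlt).trans (le_abs_self _)
    · simp
    · exact (h y hy x hx hlt).trans (le_abs_self _)
  have hinj : InjOn P (Ico 0 1) := fun x hx y hy he => by
    have := habs x hx y hy
    rw [he, sub_self, abs_zero] at this
    have h2 : (x - y) ^ 2 = 0 := le_antisymm (by nlinarith) (sq_nonneg _)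
    exact sub_eq_zero.mp (pow_eq_zero_iff two_ne_zero |>.mp h2)
  set f := Function.invFunOn P (Ico 0 1) with hf
  have hleft : ∀ x ∈ Ico (0 : ℝ) 1, f (P x) = x := fun x hx => hinj.leftInvOn_invFunOn hx
  set K : NNReal := Real.toNNReal (Real.sqrt κ⁻¹) with hK
  have hhol : HolderOnWith K (1 / 2) f (P '' Ico 0 1) := by
    rintro _ ⟨x, hx, rfl⟩ _ ⟨y, hy, rfl⟩
    rw [hleft x hx, hleft y hy, edist_dist, edist_dist, Real.dist_eq, Real.dist_eq,
      ENNReal.ofReal_rpow_of_nonneg (abs_nonneg _) (by positivity), hK, ENNReal.ofNNReal_toNNReal,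
      ← ENNReal.ofReal_mul (Real.sqrt_nonneg _)]
    apply ENNReal.ofReal_le_ofReal
    have e : ((1 / 2 : NNReal) : ℝ) = 1 / 2 := by norm_num
    rw [e, ← Real.sqrt_eq_rpow, ← Real.sqrt_mul (by positivity)]
    apply Real.le_sqrt_of_sq_le
    rw [sq_abs, inv_mul_eq_div, le_div_iff₀ hκ, mul_comm]
    exact habs x hx y hy
  have himg : f '' (P '' Ico 0 1) = Ico 0 1 := by
    rw [image_image]
    exact (image_congr fun x hx => hleft x hx).trans (image_id _)
  have hdim := hhol.dimH_image_le (by norm_num)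
  rw [himg, Real.dimH_of_nonempty_interior (by rw [interior_Ico]; exact ⟨1 / 2, by norm_num⟩)]
    at hdim
  by_contra h0
  have h0' : dimH (P '' Ico 0 1) = 0 := by simpa using h0
  rw [h0', ENNReal.zero_div] at hdim
  simp at hdim

/-! ### A greedy map with a hole whose survivor set contains a rotation -/

/-- The value in base `β` of the concatenation of the words `011` and `100` that codes the orbit
of `x` under the rotation by `θ`. -/
noncomputable def rotPoint (β θ x : ℝ) : ℝ :=
  blockVal (β ^ 3) ((β + 1) / β ^ 3) (β ^ 2 / β ^ 3) (rcode 1 θ x)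

/-- The right endpoint of the hole `[0, t)` of the example, chosen so
that its second image is `rotPoint β θ 0`. -/
noncomputable def rotHole (β θ : ℝ) : ℝ := rotPoint β θ 0 / β ^ 2

/-- The value in base `β` of the concatenation of the words `01` and `10` selected by the binary
expansion of `x`. -/
noncomputable def freePoint (β x : ℝ) : ℝ :=
  blockVal (β ^ 2) (1 / β ^ 2) (β / β ^ 2) (rcode 2 0 x)

/-- The conditions on a base `β` and an irrational angle `θ` under which the greedy map with hole
`[0, rotHole β θ)` contains the rotation by `θ` as a renormalization. The equation says
that the left limit at `1` of the coding of the rotation is `β ^ 2 - β - 1`, which is the second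
image of `1` under the greedy map. -/
structure IsRotationBase (β θ : ℝ) : Prop where
  irrational : Irrational θ
  angle_mem : θ ∈ Ioo (0 : ℝ) 1
  lower : 91 / 50 ≤ β
  upper : β < 2
  kneading : rotPoint β θ θ = β ^ 3 * (β ^ 2 - β - 1) - β ^ 2

lemma exists_isRotationBase : ∃ β θ, IsRotationBase β θ := by
  set θ : ℝ := √2 - 1 with hθ
  have hirr : Irrational θ := by simpa [hθ] using irrational_sqrt_two.sub_natCast 1
  have hθm : θ ∈ Ioo (0 : ℝ) 1 := by
    have h1 : √2 < 2 := by rw [Real.sqrt_lt' (by norm_num)]; norm_num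
    constructor
    · rw [hθ, sub_pos]; exact Real.one_lt_sqrt_two
    · rw [hθ]; linarith
  have hb : IsBinary (rcode 1 θ θ) :=
    rcode_binary one_pos hθm.1.le (by linarith [hθm.2]) ⟨hθm.1.le, hθm.2⟩
  set F : ℝ → ℝ := fun β => (β + 1) / (β ^ 3 - 1) + (β ^ 2 - β - 1) * seqVal (β ^ 3) 0 (rcode 1 θ θ)
    - (β ^ 3 * (β ^ 2 - β - 1) - β ^ 2) with hF
  have hpow : ∀ β ∈ Icc (91 / 50 : ℝ) 2, (2 : ℝ) ≤ β ^ 3 := fun β hβ => by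
    calc (2 : ℝ) ≤ (91 / 50) ^ 3 := by norm_num
      _ ≤ β ^ 3 := by gcongr; exact hβ.1
  have hcont : ContinuousOn F (Icc (91 / 50) 2) := by
    have h1 : ContinuousOn (fun β : ℝ => (β + 1) / (β ^ 3 - 1)) (Icc (91 / 50) 2) := by
      refine ContinuousOn.div (by fun_prop) (by fun_prop) fun β hβ => ?_
      linarith [hpow β hβ]
    have h2 : ContinuousOn (fun β : ℝ => seqVal (β ^ 3) 0 (rcode 1 θ θ)) (Icc (91 / 50) 2) :=
      (continuousOn_seqVal (b := 2) (by norm_num) hb).comp (by fun_prop) hpow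
    exact (h1.add (ContinuousOn.mul (by fun_prop) h2)).sub (by fun_prop)
  have hlow : 0 < F (91 / 50) := by
    have h1 := seqVal_zero_nonneg (β := (91 / 50 : ℝ) ^ 3) (by norm_num) hb
    have h2 : 0 ≤ ((91 / 50 : ℝ) ^ 2 - 91 / 50 - 1) * seqVal ((91 / 50) ^ 3) 0 (rcode 1 θ θ) :=
      mul_nonneg (by norm_num) h1
    have h3 : (0 : ℝ) < (91 / 50 + 1) / ((91 / 50) ^ 3 - 1) -
      ((91 / 50) ^ 3 * ((91 / 50) ^ 2 - 91 / 50 - 1) - (91 / 50) ^ 2) := by norm_num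
    simp only [hF]
    linarith
  have hup : F 2 < 0 := by
    have h1 := seqVal_zero_le (B := (2 : ℝ) ^ 3) (by norm_num) hb
    simp only [hF]
    norm_num at h1 ⊢
    linarith
  obtain ⟨β, hβ, hβ0⟩ := intermediate_value_Ioo' (by norm_num) hcont ⟨hup, hlow⟩
  refine ⟨β, θ, hirr, hθm, hβ.1.le, hβ.2, ?_⟩
  have hp := hpow β (Ioo_subset_Icc_self hβ)
  have h0 : β ^ 3 ≠ 0 := by linarith
  have h1 : β ^ 3 - 1 ≠ 0 := by linarith
  rw [← sub_eq_zero, ← hβ0, rotPoint, blockVal, hF]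
  simp only
  rw [div_mul_cancel₀ _ h0, sub_mul, div_mul_cancel₀ _ h0, div_mul_cancel₀ _ h0]
  ring

lemma betaMap_eq_mul {b y : ℝ} (h : b * y ∈ Ico (0 : ℝ) 1) : betaMap b 0 y = b * y := by
  have := (betaMap_of_mem (β := b) (α := 0) (x := y) 0 (by simpa using h)).2
  simpa using this

lemma betaMap_eq_mul_sub_one {b y : ℝ} (h : b * y - 1 ∈ Ico (0 : ℝ) 1) :
    betaMap b 0 y = b * y - 1 := by
  have := (betaMap_of_mem (β := b) (α := 0) (x := y) 1 (by simpa using h)).2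
  simpa using this

namespace IsRotationBase

variable {β θ : ℝ}

lemma pow_bounds (h : IsRotationBase β θ) : 3 < β ^ 2 ∧ β ^ 2 < 4 ∧ 6 < β ^ 3 := by
  have h1 := h.lower
  have h2 := h.upper
  refine ⟨by nlinarith, by nlinarith, ?_⟩
  calc (6 : ℝ) < (91 / 50) ^ 3 := by norm_num
    _ ≤ β ^ 3 := by gcongr

lemma top_pos (h : IsRotationBase β θ) : 0 < β ^ 2 - β - 1 := by
  nlinarith [h.lower]

lemma angle_mem_Ico (h : IsRotationBase β θ) : θ ∈ Ico (0 : ℝ) 1 :=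
  ⟨h.angle_mem.1.le, h.angle_mem.2⟩

lemma binary (h : IsRotationBase β θ) {x : ℝ} (hx : x ∈ Ico (0 : ℝ) 1) :
    IsBinary (rcode 1 θ x) :=
  rcode_binary one_pos h.angle_mem.1.le (by linarith [h.angle_mem.2]) hx

lemma mul_rotPoint (h : IsRotationBase β θ) {x : ℝ} (hx : x ∈ Ico (0 : ℝ) 1) :
    β ^ 3 * rotPoint β θ x =
      β + 1 + (β ^ 2 - β - 1) * rcode 1 θ x 0 + rotPoint β θ (betaMap 1 θ x) := by
  have h3 := h.pow_bounds.2.2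
  have h0 : β ^ 3 ≠ 0 := by linarith
  rw [rotPoint, blockVal_succ (by linarith) _ _ (h.binary hx), seqShift_rcode,
    Function.iterate_one, rotPoint]
  generalize blockVal _ _ _ (rcode 1 θ (betaMap 1 θ x)) = Y
  have hβ0 : β ≠ 0 := by linarith [h.lower]
  field_simp
  ring

lemma mul_rotPoint_of_lt (h : IsRotationBase β θ) {x : ℝ} (hx : x ∈ Ico (0 : ℝ) 1)
    (hlt : x < 1 - θ) : x + θ ∈ Ico (0 : ℝ) 1 ∧
      β ^ 3 * rotPoint β θ x = β + 1 + rotPoint β θ (x + θ) := by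
  have h1 : x + θ ∈ Ico (0 : ℝ) 1 := ⟨by linarith [hx.1, h.angle_mem.1], by linarith⟩
  obtain ⟨h2, h3⟩ := betaMap_of_mem (β := 1) (α := θ) (x := x) 0 (by simpa using h1)
  have h4 : rcode 1 θ x 0 = 0 := by
    have : rcode 1 θ x 0 = (⌊1 * x + θ⌋ : ℝ) := rfl
    rw [this, h2, Int.cast_zero]
  have h5 : betaMap 1 θ x = x + θ := by rw [h3]; push_cast; ring
  refine ⟨h1, ?_⟩
  rw [h.mul_rotPoint hx, h4, h5]
  ring

lemma mul_rotPoint_of_ge (h : IsRotationBase β θ) {x : ℝ} (hx : x ∈ Ico (0 : ℝ) 1)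
    (hge : 1 - θ ≤ x) : x + θ - 1 ∈ Ico (0 : ℝ) 1 ∧
      β ^ 3 * rotPoint β θ x = β ^ 2 + rotPoint β θ (x + θ - 1) := by
  have h1 : x + θ - 1 ∈ Ico (0 : ℝ) 1 := ⟨by linarith, by linarith [hx.2, h.angle_mem.2]⟩
  obtain ⟨h2, h3⟩ := betaMap_of_mem (β := 1) (α := θ) (x := x) 1 (by simpa using h1)
  have h4 : rcode 1 θ x 0 = 1 := by
    have : rcode 1 θ x 0 = (⌊1 * x + θ⌋ : ℝ) := rfl
    rw [this, h2, Int.cast_one]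
  have h5 : betaMap 1 θ x = x + θ - 1 := by rw [h3]; push_cast; ring
  refine ⟨h1, ?_⟩
  rw [h.mul_rotPoint hx, h4, h5]
  ring

lemma strictMonoOn (h : IsRotationBase β θ) : StrictMonoOn (rotPoint β θ) (Ico 0 1) :=
  fun x hx y hy hxy => by
    have h3 := h.pow_bounds.2.2
    refine blockVal_lt_of_lex (by linarith) ?_ (h.binary hx) (h.binary hy)
      (rotation_lex h.irrational h.angle_mem.1.le h.angle_mem.2.le hx hy hxy)
    have := h.top_pos
    gcongr
    linarith

lemma mul_rotPoint_zero (h : IsRotationBase β θ) :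
    β ^ 3 * rotPoint β θ 0 = β + 1 + rotPoint β θ θ := by
  have := (h.mul_rotPoint_of_lt zero_mem_Ico (by linarith [h.angle_mem.2])).2
  rwa [zero_add] at this

lemma rotPoint_zero_le (h : IsRotationBase β θ) {x : ℝ} (hx : x ∈ Ico (0 : ℝ) 1) :
    rotPoint β θ 0 ≤ rotPoint β θ x :=
  h.strictMonoOn.monotoneOn zero_mem_Ico hx hx.1

lemma rotPoint_zero_pos (h : IsRotationBase β θ) : 0 < rotPoint β θ 0 := by
  have h1 := h.mul_rotPoint_zero
  have h2 := h.rotPoint_zero_le h.angle_mem_Ico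
  have h3 := h.pow_bounds.2.2
  nlinarith [h.lower]

lemma rotPoint_lt (h : IsRotationBase β θ) {x : ℝ} (hx : x ∈ Ico (0 : ℝ) 1) :
    rotPoint β θ x < β ^ 2 - β - 1 := by
  have h3 := h.pow_bounds.2.2
  have hk := h.kneading
  have key : β ^ 3 * rotPoint β θ x < β ^ 3 * (β ^ 2 - β - 1) := by
    rcases lt_or_ge x (1 - θ) with hlt | hge
    · have hm : 1 - θ ∈ Ico (0 : ℝ) 1 := ⟨by linarith [h.angle_mem.2], by linarith [h.angle_mem.1]⟩
      have h1 := h.strictMonoOn hx hm hlt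
      have h2 := (h.mul_rotPoint_of_ge hm le_rfl).2
      rw [show 1 - θ + θ - 1 = 0 by ring] at h2
      have h4 := h.rotPoint_zero_le h.angle_mem_Ico
      have h5 : β ^ 3 * rotPoint β θ x < β ^ 3 * rotPoint β θ (1 - θ) :=
        mul_lt_mul_of_pos_left h1 (by linarith)
      linarith
    · obtain ⟨h1, h2⟩ := h.mul_rotPoint_of_ge hx hge
      have h4 := h.strictMonoOn h1 h.angle_mem_Ico (by linarith [hx.2])
      linarith
  exact lt_of_mul_lt_mul_left key (by linarith)

lemma top_lt (h : IsRotationBase β θ) : β ^ 2 - β - 1 < β - 1 := by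
  nlinarith [h.lower, h.upper]

lemma mul_rotHole (h : IsRotationBase β θ) : β ^ 2 * rotHole β θ = rotPoint β θ 0 := by
  have : β ≠ 0 := by linarith [h.lower]
  rw [rotHole]; field_simp

lemma rotHole_pos (h : IsRotationBase β θ) : 0 < rotHole β θ := by
  have := h.pow_bounds.1
  exact div_pos h.rotPoint_zero_pos (by linarith)

lemma rotPoint_orbit (h : IsRotationBase β θ) {x : ℝ} (hx : x ∈ Ico (0 : ℝ) 1) :
    rotPoint β θ x ∈ Ico (0 : ℝ) 1 ∧
      (∀ j < 3, rotHole β θ ≤ (betaMap β 0)^[j] (rotPoint β θ x)) ∧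
      (betaMap β 0)^[3] (rotPoint β θ x) ∈ rotPoint β θ '' Ico 0 1 := by
  have hβ := h.lower
  have hβ2 := h.upper
  have hβ0 : 0 < β := by linarith
  obtain ⟨hp1, hp2, hp3⟩ := h.pow_bounds
  have ht := h.mul_rotHole
  have ht0 := h.rotHole_pos
  have hm := h.rotPoint_zero_pos
  have hmx := h.rotPoint_zero_le hx
  have hxM := h.rotPoint_lt hx
  have hM := h.top_lt
  set y := rotPoint β θ x with hy
  set t := rotHole β θ with htdef
  have hy0 : t ≤ y := by nlinarith
  rcases lt_or_ge x (1 - θ) with hlt | hge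
  · obtain ⟨h1, h2⟩ := h.mul_rotPoint_of_lt hx hlt
    have h3 := h.rotPoint_zero_le h1
    have h4 := h.rotPoint_lt h1
    set y' := rotPoint β θ (x + θ) with hy'
    have e1 : betaMap β 0 y = β * y := betaMap_eq_mul ⟨by nlinarith, by
      refine lt_of_mul_lt_mul_left (a := β ^ 2) ?_ (by linarith)
      calc β ^ 2 * (β * y) = β + 1 + y' := by rw [← h2]; ring
        _ < β ^ 2 * 1 := by linarith⟩
    have e2' : β * (β * (β * y) - 1) = 1 + y' := by
      calc β * (β * (β * y) - 1) = β ^ 3 * y - β := by ring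
        _ = 1 + y' := by rw [h2]; ring
    have hpos2 : 0 < β * (β * y) - 1 := by
      have : 0 < β * (β * (β * y) - 1) := by rw [e2']; linarith
      exact pos_of_mul_pos_right this hβ0.le
    have e2 : betaMap β 0 (β * y) = β * (β * y) - 1 := betaMap_eq_mul_sub_one ⟨hpos2.le, by
      refine lt_of_mul_lt_mul_left (a := β) ?_ hβ0.le
      rw [e2']; linarith⟩
    have e3 : betaMap β 0 (β * (β * y) - 1) = y' := by
      have : β * (β * (β * y) - 1) - 1 = y' := by rw [e2']; ring
      rw [betaMap_eq_mul_sub_one (by rw [this]; constructor <;> linarith), this]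
    refine ⟨⟨by linarith, by linarith⟩, fun j hj => ?_, x + θ, h1, ?_⟩
    · interval_cases j
      · exact hy0
      · change t ≤ betaMap β 0 y
        rw [e1]; nlinarith
      · change t ≤ betaMap β 0 (betaMap β 0 y)
        rw [e1, e2]
        refine le_of_mul_le_mul_left (a := β) ?_ hβ0
        rw [e2']; nlinarith
    · change y' = betaMap β 0 (betaMap β 0 (betaMap β 0 y))
      rw [e1, e2, e3]
  · obtain ⟨h1, h2⟩ := h.mul_rotPoint_of_ge hx hge
    have h3 := h.rotPoint_zero_le h1
    have h4 := h.rotPoint_lt h1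
    set y' := rotPoint β θ (x + θ - 1) with hy'
    have e1' : β ^ 2 * (β * y - 1) = y' := by
      calc β ^ 2 * (β * y - 1) = β ^ 3 * y - β ^ 2 := by ring
        _ = y' := by rw [h2]; ring
    have hge1 : t ≤ β * y - 1 := by
      refine le_of_mul_le_mul_left (a := β ^ 2) ?_ (by linarith)
      rw [e1', ht]; exact h3
    have hlt2 : β * (β * y - 1) < 1 := by
      refine lt_of_mul_lt_mul_left (a := β) ?_ hβ0.le
      calc β * (β * (β * y - 1)) = y' := by rw [← e1']; ring
        _ < β * 1 := by linarith
    have e1 : betaMap β 0 y = β * y - 1 := betaMap_eq_mul_sub_one ⟨by linarith, by nlinarith⟩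
    have e2 : betaMap β 0 (β * y - 1) = β * (β * y - 1) :=
      betaMap_eq_mul ⟨mul_nonneg hβ0.le (by linarith), hlt2⟩
    have e3 : betaMap β 0 (β * (β * y - 1)) = y' := by
      have : β * (β * (β * y - 1)) = y' := by rw [← e1']; ring
      rw [betaMap_eq_mul (by rw [this]; constructor <;> linarith), this]
    refine ⟨⟨by linarith, by linarith⟩, fun j hj => ?_, x + θ - 1, h1, ?_⟩
    · interval_cases j
      · exact hy0
      · change t ≤ betaMap β 0 y
        rw [e1]; exact hge1
      · change t ≤ betaMap β 0 (betaMap β 0 y)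
        rw [e1, e2]; nlinarith
    · change y' = betaMap β 0 (betaMap β 0 (betaMap β 0 y))
      rw [e1, e2, e3]

lemma rotPoint_mem_survivorSet (h : IsRotationBase β θ) {x : ℝ} (hx : x ∈ Ico (0 : ℝ) 1) :
    rotPoint β θ x ∈ survivorSet β (rotHole β θ) := by
  refine subset_survivorSet_of_return (A := rotPoint β θ '' Ico 0 1) (p := 3) (by norm_num) ?_
    ⟨x, hx, rfl⟩
  rintro _ ⟨z, hz, rfl⟩
  exact h.rotPoint_orbit hz

lemma rotPoint_zero_lt_one (h : IsRotationBase β θ) : rotPoint β θ 0 < 1 :=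
  (h.rotPoint_mem_survivorSet zero_mem_Ico).1.2

lemma rotHole_mem_bifurcationSet (h : IsRotationBase β θ) :
    rotHole β θ ∈ bifurcationSet β := by
  have hβ := h.lower
  have hβ0 : 0 < β := by linarith
  have hp := h.pow_bounds.1
  have ht := h.mul_rotHole
  have ht0 := h.rotHole_pos
  have hm1 := h.rotPoint_zero_lt_one
  set t := rotHole β θ with htdef
  have hlt : β * t < 1 := by nlinarith
  have e1 : betaMap β 0 t = β * t := betaMap_eq_mul ⟨by positivity, hlt⟩
  have e2 : betaMap β 0 (β * t) = rotPoint β θ 0 := by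
    have : β * (β * t) = rotPoint β θ 0 := by rw [← ht]; ring
    rw [betaMap_eq_mul (by rw [this]; exact ⟨h.rotPoint_zero_pos.le, hm1⟩), this]
  refine ⟨⟨ht0.le, by nlinarith⟩, fun n => ?_⟩
  match n with
  | 0 => exact fun hn => lt_irrefl _ hn.2
  | 1 =>
    intro hn
    change betaMap β 0 t ∈ _ at hn
    rw [e1] at hn
    nlinarith [hn.2]
  | n + 2 =>
    rw [Function.iterate_add_apply]
    change (betaMap β 0)^[n] (betaMap β 0 (betaMap β 0 t)) ∉ _
    rw [e1, e2]
    exact (h.rotPoint_mem_survivorSet zero_mem_Ico).2 n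

/-- The third iterate of the greedy map on the piece of the survivor set around the discontinuity
`1 / β`: it is injective there, since the images of the two sides are separated by
`rotPoint β θ θ`, and maps the piece into itself, up to one point. -/
lemma renormalization (h : IsRotationBase β θ) {y : ℝ} (hy : y ∈ survivorSet β (rotHole β θ))
    (hyO : y ∈ Ioo (rotPoint β θ 0) (β ^ 2 - β - 1)) :
    ((betaMap β 0)^[3] y = β ^ 3 * y - β - 1 ∧ rotPoint β θ θ < (betaMap β 0)^[3] y ∧
        (betaMap β 0)^[3] y < β ^ 2 - β - 1) ∨
      ((betaMap β 0)^[3] y = β ^ 3 * y - β ^ 2 ∧ (betaMap β 0)^[3] y < rotPoint β θ θ ∧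
        rotPoint β θ 0 ≤ (betaMap β 0)^[3] y ∧
          ((betaMap β 0)^[3] y = rotPoint β θ 0 → y = (1 + rotHole β θ) / β)) := by
  have hβ := h.lower
  have hβ2 := h.upper
  have hβ0 : 0 < β := by linarith
  obtain ⟨hp1, hp2, hp3⟩ := h.pow_bounds
  have ht := h.mul_rotHole
  have ht0 := h.rotHole_pos
  have hm := h.rotPoint_zero_pos
  have hm3 := h.mul_rotPoint_zero
  have hk := h.kneading
  have hM := h.top_lt
  have hθM := h.rotPoint_lt h.angle_mem_Ico
  have h0θ := h.rotPoint_zero_le h.angle_mem_Ico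
  obtain ⟨hy1, hy2⟩ := hyO
  have h3lo : β ^ 3 * rotPoint β θ 0 < β ^ 3 * y := mul_lt_mul_of_pos_left hy1 (by linarith)
  have h3hi : β ^ 3 * y < β ^ 3 * (β ^ 2 - β - 1) := mul_lt_mul_of_pos_left hy2 (by linarith)
  set t := rotHole β θ with htdef
  set m := rotPoint β θ 0 with hmdef
  set r := rotPoint β θ θ with hrdef
  rcases lt_or_ge (β * y) 1 with hlt | hge
  · left
    have e1 : betaMap β 0 y = β * y := betaMap_eq_mul ⟨by nlinarith, hlt⟩
    have e2' : β * (β * (β * y) - 1) = β ^ 3 * y - β := by ring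
    have hpos2 : 0 < β * (β * y) - 1 := by
      have : 0 < β * (β * (β * y) - 1) := by rw [e2']; linarith
      exact pos_of_mul_pos_right this hβ0.le
    have e2 : betaMap β 0 (β * y) = β * (β * y) - 1 :=
      betaMap_eq_mul_sub_one ⟨hpos2.le, by nlinarith⟩
    have hub : β ^ 3 * y < β ^ 2 := by
      calc β ^ 3 * y = β ^ 2 * (β * y) := by ring
        _ < β ^ 2 * 1 := mul_lt_mul_of_pos_left hlt (by linarith)
        _ = β ^ 2 := mul_one _
    have e3 : betaMap β 0 (β * (β * y) - 1) = β ^ 3 * y - β - 1 := by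
      rw [betaMap_eq_mul_sub_one (by rw [e2']; constructor <;> linarith), e2']
    have e : (betaMap β 0)^[3] y = β ^ 3 * y - β - 1 := by
      change betaMap β 0 (betaMap β 0 (betaMap β 0 y)) = _
      rw [e1, e2, e3]
    rw [e]
    exact ⟨rfl, by linarith, by linarith⟩
  · right
    have e1 : betaMap β 0 y = β * y - 1 := betaMap_eq_mul_sub_one ⟨by linarith, by nlinarith⟩
    have htS : t ≤ β * y - 1 := by
      rw [← e1]; exact Matched.le_of_mem_survivorSet (betaMap_mem_survivorSet hy)
    have e2' : β ^ 2 * (β * y - 1) = β ^ 3 * y - β ^ 2 := by ring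
    have e2'' : β * (β * (β * y - 1)) = β ^ 3 * y - β ^ 2 := by ring
    have hlt2 : β * (β * y - 1) < 1 := by
      refine lt_of_mul_lt_mul_left (a := β) ?_ hβ0.le
      rw [e2'']; linarith
    have e2 : betaMap β 0 (β * y - 1) = β * (β * y - 1) :=
      betaMap_eq_mul ⟨mul_nonneg hβ0.le (by linarith), hlt2⟩
    have hlo : m ≤ β ^ 3 * y - β ^ 2 := by
      rw [← ht, ← e2']
      exact mul_le_mul_of_nonneg_left htS (by linarith)
    have e3 : betaMap β 0 (β * (β * y - 1)) = β ^ 3 * y - β ^ 2 := by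
      rw [betaMap_eq_mul (by rw [e2'']; constructor <;> linarith), e2'']
    have e : (betaMap β 0)^[3] y = β ^ 3 * y - β ^ 2 := by
      change betaMap β 0 (betaMap β 0 (betaMap β 0 y)) = _
      rw [e1, e2, e3]
    rw [e]
    refine ⟨rfl, by linarith, hlo, fun he => ?_⟩
    rw [← e2', ← ht] at he
    have := mul_left_cancel₀ (by positivity) he
    rw [eq_div_iff hβ0.ne']
    linarith

/-- The survivor set of the example is not conjugate to any intermediate map. -/
lemma partialConj_false (h : IsRotationBase β θ) {b α : ℝ} (hb : 1 < b) {φ ψ : ℝ → ℝ}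
    {C D : Set ℝ} (hc : PartialConj (betaMap b α) (Icc 0 1) (betaMap β 0)
      (survivorSet β (rotHole β θ)) φ ψ C D) : False := by
  refine hc.false_of_injOn hb (O := Ioo (rotPoint β θ 0) (β ^ 2 - β - 1))
    (N := {(1 + rotHole β θ) / β}) isOpen_Ioo (countable_singleton _) ?_ (p := 3) (by norm_num)
    ?_ ?_
  · intro hcount
    have h1 : (Ioo (0 : ℝ) 1).Countable := by
      refine MapsTo.countable_of_injOn (f := rotPoint β θ) (fun x hx => ?_)
        (h.strictMonoOn.injOn.mono Ioo_subset_Ico_self) hcount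
      have hx' := Ioo_subset_Ico_self hx
      exact ⟨h.rotPoint_mem_survivorSet hx', h.strictMonoOn zero_mem_Ico hx' hx.1,
        h.rotPoint_lt hx'⟩
    exact Cardinal.Real.Ioo_countable_iff.not.mpr (by norm_num) h1
  · rintro y ⟨hy, hyO⟩ hyN
    rcases h.renormalization hy hyO with ⟨-, h1, h2⟩ | ⟨-, h1, h2, h3⟩
    · exact ⟨(h.rotPoint_zero_le h.angle_mem_Ico).trans_lt h1, h2⟩
    · exact ⟨lt_of_le_of_ne h2 fun he => hyN (h3 he.symm),
        h1.trans (h.rotPoint_lt h.angle_mem_Ico)⟩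
  · have h0 : β ^ 3 ≠ 0 := by linarith [h.pow_bounds.2.2]
    rintro y ⟨hy, hyO⟩ z ⟨hz, hzO⟩ he
    rcases h.renormalization hy hyO with ⟨h1, h2, -⟩ | ⟨h1, h2, -, -⟩ <;>
      rcases h.renormalization hz hzO with ⟨h3, h4, -⟩ | ⟨h3, h4, -, -⟩
    · exact mul_left_cancel₀ h0 (by linarith)
    · exact absurd (he ▸ h4) h2.not_gt
    · exact absurd (he ▸ h4) h2.not_gt
    · exact mul_left_cancel₀ h0 (by linarith)

lemma binary_two {x : ℝ} (hx : x ∈ Ico (0 : ℝ) 1) : IsBinary (rcode 2 0 x) :=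
  rcode_binary two_pos le_rfl (by norm_num) hx

/-- Concatenations of `01` and `10` avoid the hole, so the survivor set contains the values of a
full shift on two symbols. -/
lemma freePoint_mem_survivorSet (h : IsRotationBase β θ) {x : ℝ} (hx : x ∈ Ico (0 : ℝ) 1) :
    freePoint β x ∈ survivorSet β (rotHole β θ) := by
  have hβ := h.lower
  have hβ2 := h.upper
  have hβ0 : 0 < β := by linarith
  obtain ⟨hp1, hp2, hp3⟩ := h.pow_bounds
  have hne : β ^ 2 ≠ 0 := by linarith
  have hne1 : β ^ 2 - 1 ≠ 0 := by linarith
  have ht := h.mul_rotHole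
  have ht0 := h.rotHole_pos
  have hm1 := h.rotPoint_zero_lt_one
  have hθM := h.rotPoint_lt h.angle_mem_Ico
  have hm3 := h.mul_rotPoint_zero
  have hbounds : ∀ z ∈ Ico (0 : ℝ) 1, 1 ≤ β ^ 2 * freePoint β z ∧ freePoint β z < β - 1 := by
    intro z hz
    have hm := blockVal_mem (B := β ^ 2) (u := 1 / β ^ 2) (v := β / β ^ 2) (by linarith)
      (by gcongr; linarith) (binary_two hz)
    rw [div_mul_cancel₀ _ hne, div_mul_cancel₀ _ hne] at hm
    obtain ⟨h1, h2⟩ := hm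
    change _ ≤ freePoint β z at h1
    change freePoint β z ≤ _ at h2
    rw [div_le_iff₀ (by linarith)] at h1
    rw [le_div_iff₀ (by linarith)] at h2
    have hpos : 0 < freePoint β z := by nlinarith
    refine ⟨by nlinarith, ?_⟩
    have h3 : β < (β - 1) * (β ^ 2 - 1) := by nlinarith
    exact lt_of_mul_lt_mul_right (h2.trans_lt h3) (by linarith)
  -- the hole is shorter than the value `1 / β ^ 3` of the word `001`
  have htb : β ^ 3 * rotHole β θ < 1 := by
    have h1 : β ^ 3 * rotPoint β θ 0 < β ^ 2 := by linarith
    have h2 : β * rotPoint β θ 0 < 1 := by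
      refine lt_of_mul_lt_mul_left (a := β ^ 2) ?_ (by linarith)
      calc β ^ 2 * (β * rotPoint β θ 0) = β ^ 3 * rotPoint β θ 0 := by ring
        _ < β ^ 2 * 1 := by linarith
    calc β ^ 3 * rotHole β θ = β * (β ^ 2 * rotHole β θ) := by ring
      _ < 1 := by rw [ht]; exact h2
  refine subset_survivorSet_of_return (A := freePoint β '' Ico 0 1) (p := 2) (by norm_num) ?_
    ⟨x, hx, rfl⟩
  rintro _ ⟨z, hz, rfl⟩
  have hz' := betaMap_mem 2 0 z
  have hrec : β ^ 2 * freePoint β z =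
      1 + (β - 1) * rcode 2 0 z 0 + freePoint β (betaMap 2 0 z) := by
    rw [freePoint, blockVal_succ (by linarith) _ _ (binary_two hz), seqShift_rcode,
      Function.iterate_one, freePoint]
    field_simp
  obtain ⟨h1, h2⟩ := hbounds z hz
  obtain ⟨h3, h4⟩ := hbounds _ hz'
  set y := freePoint β z with hy
  set y' := freePoint β (betaMap 2 0 z) with hy'
  set t := rotHole β θ with htdef
  have hty : β * t ≤ y' := by
    refine le_of_mul_le_mul_left (a := β ^ 2) ?_ (by linarith)
    calc β ^ 2 * (β * t) = β ^ 3 * t := by ring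
      _ ≤ _ := by linarith
  have hβt : t < β * t := by nlinarith
  have hty0 : t ≤ y := by
    refine le_of_mul_le_mul_left (a := β ^ 2) ?_ (by linarith)
    nlinarith
  have hy0 : 0 < y := by linarith
  rcases binary_two hz 0 with hd | hd <;> rw [hd] at hrec
  · have e1' : β * (β * y) = 1 + y' := by
      calc β * (β * y) = β ^ 2 * y := by ring
        _ = 1 + y' := by rw [hrec]; ring
    have e1 : betaMap β 0 y = β * y := betaMap_eq_mul ⟨by positivity, by
      refine lt_of_mul_lt_mul_left (a := β) ?_ hβ0.le
      rw [e1']; linarith⟩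
    have e2 : betaMap β 0 (β * y) = y' := by
      have : β * (β * y) - 1 = y' := by rw [e1']; ring
      rw [betaMap_eq_mul_sub_one (by rw [this]; constructor <;> linarith), this]
    refine ⟨⟨hy0.le, by linarith⟩, fun j hj => ?_, _, hz', ?_⟩
    · interval_cases j
      · exact hty0
      · change t ≤ betaMap β 0 y
        rw [e1]; nlinarith
    · change y' = betaMap β 0 (betaMap β 0 y)
      rw [e1, e2]
  · have e1' : β * (β * y - 1) = y' := by
      calc β * (β * y - 1) = β ^ 2 * y - β := by ring
        _ = y' := by rw [hrec]; ring
    have hty1 : t ≤ β * y - 1 := by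
      refine le_of_mul_le_mul_left (a := β) ?_ hβ0
      rw [e1']; exact hty
    have e1 : betaMap β 0 y = β * y - 1 :=
      betaMap_eq_mul_sub_one ⟨by linarith, by
        refine lt_of_mul_lt_mul_left (a := β) ?_ hβ0.le
        rw [e1']; linarith⟩
    have e2 : betaMap β 0 (β * y - 1) = y' := by
      rw [betaMap_eq_mul (by rw [e1']; constructor <;> linarith), e1']
    refine ⟨⟨hy0.le, by linarith⟩, fun j hj => ?_, _, hz', ?_⟩
    · interval_cases j
      · exact hty0
      · change t ≤ betaMap β 0 y
        rw [e1]; exact hty1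
    · change y' = betaMap β 0 (betaMap β 0 y)
      rw [e1, e2]

lemma dimH_survivorSet_pos (h : IsRotationBase β θ) :
    0 < dimH (survivorSet β (rotHole β θ)) := by
  have hβ := h.lower
  obtain ⟨hp1, hp2, hp3⟩ := h.pow_bounds
  have hB : 1 < β ^ 2 := by linarith
  have hne : β ^ 2 ≠ 0 := by linarith
  have hκ : 0 < (β - 1) / 8 := by linarith
  refine (dimH_pos_of_sq_le (P := freePoint β) hκ fun x hx y hy hxy => ?_).trans_le
    (dimH_mono ?_)
  · have hbx := binary_two hx
    have hby := binary_two hy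
    obtain ⟨n, hag, hn, hn'⟩ := rcode_lex_rcode (β := 2) (α := 0) (by norm_num) le_rfl
      (by norm_num) hx hy hxy
    -- two points whose expansions differ first at `n` are at distance at most `2 ^ (-n)`
    have h1 := seqVal_sub_of_lex (β := 2) (by norm_num) 0 hbx hby n hag hn hn'
    rw [seqVal_rcode (by norm_num) le_rfl (by norm_num) hx,
      seqVal_rcode (by norm_num) le_rfl (by norm_num) hy,
      seqVal_shift_rcode (by norm_num) le_rfl (by norm_num) hx,
      seqVal_shift_rcode (by norm_num) le_rfl (by norm_num) hy] at h1
    have h2 : y - x ≤ 2 / 2 ^ (n + 1) := by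
      rw [h1]
      have h3 := (iterate_betaMap_mem (β := 2) (α := 0) hx (n + 1)).1
      have h4 := (iterate_betaMap_mem (β := 2) (α := 0) hy (n + 1)).2
      gcongr
      linarith
    have h3 := seqVal_sub_of_lex hB 0 hbx hby n hag hn hn'
    have h4 : (1 : ℝ) / 2 / (β ^ 2) ^ (n + 1) ≤ seqVal (β ^ 2) 0 (rcode 2 0 y) -
        seqVal (β ^ 2) 0 (rcode 2 0 x) := by
      rw [h3]
      have h5 := seqVal_zero_nonneg hB (hby.shift (n + 1))
      have h6 := seqVal_zero_le hB (hbx.shift (n + 1))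
      have h7 : 1 / (β ^ 2 - 1) ≤ 1 / 2 := one_div_le_one_div_of_le (by norm_num) (by linarith)
      gcongr
      linarith
    have e : freePoint β y - freePoint β x = (β - 1) * (seqVal (β ^ 2) 0 (rcode 2 0 y) -
        seqVal (β ^ 2) 0 (rcode 2 0 x)) := by
      rw [freePoint, freePoint, blockVal, blockVal, sub_mul, div_mul_cancel₀ _ hne,
        div_mul_cancel₀ _ hne]
      ring
    rw [e]
    have h8 : (y - x) ^ 2 ≤ (2 / 2 ^ (n + 1)) ^ 2 :=
      pow_le_pow_left₀ (by linarith) h2 2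
    have h9 : ((2 : ℝ) / 2 ^ (n + 1)) ^ 2 = 4 / 4 ^ (n + 1) := by
      rw [div_pow, ← pow_mul, mul_comm (n + 1) 2, pow_mul]; norm_num
    have h10 : (1 : ℝ) / 2 / 4 ^ (n + 1) ≤ 1 / 2 / (β ^ 2) ^ (n + 1) := by
      gcongr
    calc (β - 1) / 8 * (y - x) ^ 2 ≤ (β - 1) / 8 * (4 / 4 ^ (n + 1)) := by
          rw [← h9]; exact mul_le_mul_of_nonneg_left h8 hκ.le
      _ = (β - 1) * (1 / 2 / 4 ^ (n + 1)) := by ring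
      _ ≤ _ := mul_le_mul_of_nonneg_left (h10.trans h4) (by linarith)
  · rintro _ ⟨x, hx, rfl⟩
    exact h.freePoint_mem_survivorSet hx

end IsRotationBase

end IntermediateBeta

open IntermediateBeta in
theorem theorem1p1 :
    -- every intermediate map is conjugate to a greedy map with a hole at zero
    (∀ β α : ℝ, (β, α) ∈ paramSet →
      ∃ β' ∈ Ioo (1 : ℝ) 2, ∃ t ∈ Icc (0 : ℝ) 1,
        TopConj (betaMap β α) (Icc 0 1) (betaMap β' 0) (survivorSet β' t) ∧
        (α < 2 - β →
          ExactIncTopConj (betaMap β α) (Icc 0 1) (betaMap β' 0) (survivorSet β' t))) ∧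
    -- the converse fails, for a survivor set that is large
    (∃ β' ∈ Ioo (1 : ℝ) 2, ∃ t ∈ Icc (0 : ℝ) 1,
      t ∈ bifurcationSet β' ∧ 0 < dimH (survivorSet β' t) ∧
      ∀ β α : ℝ, (β, α) ∈ paramSet →
        ¬ TopConj (betaMap β α) (Icc 0 1) (betaMap β' 0) (survivorSet β' t) ∧
        ¬ TopConj (betaMap β' 0) (survivorSet β' t) (betaMap β α) (Icc 0 1)) ∧
    -- the correspondence for small holes, when the orbit of `1` hits `0`
    (∀ β' ∈ Ioo (1 : ℝ) 2, (∃ n : ℕ, (betaMap β' 0)^[n] 1 = 0) →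
      ∃ δ ∈ Ioo (0 : ℝ) β'⁻¹, ∀ t ∈ bifurcationSet β', t < δ →
        ∃ q ∈ paramSet,
          ExactIncTopConj (betaMap q.1 q.2) (Icc 0 1) (betaMap β' 0) (survivorSet β' t) ∧
          ∀ q' ∈ paramSet,
            IncTopConj (betaMap q'.1 q'.2) (Icc 0 1) (betaMap β' 0) (survivorSet β' t) →
              q' = q) := by
  refine ⟨?_, ?_, ?_⟩
  · rintro β α ⟨⟨hβ1, hβ2⟩, hα0, hα⟩
    simp only at hβ1 hβ2 hα0 hα
    rcases hα.eq_or_lt with rfl | hlt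
    · exact ⟨β, ⟨hβ1, hβ2⟩, 0, by norm_num, topConj_flip hβ1, fun h => absurd h (lt_irrefl _)⟩
    · obtain ⟨b, t, hm⟩ := exists_matched hβ1 hα0 (by linarith)
      exact ⟨b, ⟨hm.one_lt_base, hm.base_lt_two⟩, t, Ico_subset_Icc_self hm.hole_mem,
        exactIncTopConj_topConj hm.exactIncTopConj, fun _ => hm.exactIncTopConj⟩
  · obtain ⟨b, θ, h⟩ := exists_isRotationBase
    have hb := h.lower
    have ht := h.rotHole_mem_bifurcationSet
    refine ⟨b, ⟨by linarith, h.upper⟩, rotHole b θ, Ico_subset_Icc_self ht.1, ht,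
      h.dimH_survivorSet_pos, ?_⟩
    rintro β α ⟨⟨hβ1, -⟩, -⟩
    refine ⟨?_, ?_⟩
    · rintro ⟨φ, C, hc⟩
      exact h.partialConj_false hβ1 hc.partialConj
    · rintro ⟨φ, C, hc⟩
      exact h.partialConj_false hβ1 (hc.partialConj_symm fun y hy => betaMap_mem_survivorSet hy)
  · intro b hb hfin
    obtain ⟨δ, hδ, h⟩ := exists_hole_bound hb hfin
    refine ⟨δ, hδ, fun t ht htδ => ?_⟩
    obtain ⟨β, α, hm⟩ := h t ht htδ
    refine ⟨(β, α), ⟨⟨hm.one_lt, by linarith [hm.nonneg, hm.lt_two]⟩, hm.nonneg,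
      by linarith [hm.lt_two]⟩, hm.exactIncTopConj, ?_⟩
    rintro ⟨β', α'⟩ ⟨⟨hβ1, -⟩, hα0, hα⟩ hc
    simp only at hβ1 hα0 hα hc
    obtain ⟨h1, h2⟩ := hm.kneading_eq hβ1 hα0 (by linarith) hc
    obtain ⟨h3, h4⟩ := eq_of_kneading_eq hβ1 hα0 (by linarith) hm.one_lt hm.nonneg hm.lt_two.le
      h1 h2
    rw [h3, h4]
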